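/- All graphs are finite and simple. For an integer $k \ge 1$, let $L_k$ denote the ladder with $k$ rungs, that is, the graph with vertex set $\{1,2\}\times\{1,\dots,k\}$ in which $(i,j)$ and $(i',j')$ are adjacent if and only if $|i-i'|+|j-j'|=1$. A separation of a graph $G$ is a pair $(A_1,A_2)$ of vertex subsets with $A_1\cup A_2=V(G)$ such that every edge of $G$ has both endpoints in $A_1$ or both endpoints in $A_2$; its order is $|A_1\cap A_2|$, and it is nontrivial if $A_1\ne V(G)$ and $A_2\neq V(G)$. A graph is $3$-connected if it has at least $4$ vertices and no nontrivial separation of order at most $2$. A graph $H$ is a minor of a graph $G$ if one can assign to each vertex $u$ of $H$ a nonempty connected subgraph $\phi(u)$ of $G$ so that $\phi(u)$ and $\phi(v)$ are vertex-disjoint for distinct $u,v\in V(H)$, and $G$ has an edge between $\phi(u)$ and $\phi(v)$ for every edge $uv\in E(H)$. **Theorem (Bumping a ladder).** For every integer $k\ge 1$ there exists an integer $N\ge 1$ such that every $3$-connected graph $G$ that contains the union of $N$ vertex-disjoint copies of $L_k$ as a minor contains $L_{k+1}$ as a minor. -/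

import Mathlib

namespace LadderMinor

/-- A separation of `G`: a pair of vertex sets covering all vertices such that every edge
has both endpoints in `A` or both endpoints in `B`. -/
structure IsSeparation {V : Type*} (G : SimpleGraph V) (A B : Set V) : Prop where
  cover : A ∪ B = Set.univ
  edge : ∀ ⦃u v : V⦄, G.Adj u v → (u ∈ A ∧ v ∈ A) ∨ (u ∈ B ∧ v ∈ B)

/-- `k`-connectedness (meant for `k ≥ 1`): at least `k + 1` vertices, and no nontrivial
separation of order at most `k - 1`. -/
def IsKConnected {V : Type*} (G : SimpleGraph V) (k : ℕ) : Prop :=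
  (k : ℕ∞) + 1 ≤ ENat.card V ∧
    ∀ A B : Set V, IsSeparation G A B → (A ∩ B).encard < (k : ℕ∞) →
      A = Set.univ ∨ B = Set.univ

/-- `φ` is an `H`-model in `G`: it assigns to the vertices of `H` pairwise vertex-disjoint
connected (in particular nonempty) subgraphs of `G`, such that `G` has an edge between `φ u`
and `φ v` for every edge `uv` of `H`. -/
structure IsModel {W V : Type*} (H : SimpleGraph W) (G : SimpleGraph V)
    (φ : W → G.Subgraph) : Prop where
  connected : ∀ u : W, (φ u).Connected
  disjoint : ∀ ⦃u v : W⦄, u ≠ v → Disjoint (φ u).verts (φ v).verts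
  edge : ∀ ⦃u v : W⦄, H.Adj u v → ∃ x ∈ (φ u).verts, ∃ y ∈ (φ v).verts, G.Adj x y

/-- `H` is a minor of `G`. -/
def IsMinor {W V : Type*} (H : SimpleGraph W) (G : SimpleGraph V) : Prop :=
  ∃ φ : W → G.Subgraph, IsModel H G φ

/-- The ladder with `k` rungs, i.e. the `2 × k` grid graph (indices start at `0`). -/
def ladder (k : ℕ) : SimpleGraph (Fin 2 × Fin k) where
  Adj x y := |(x.1 : ℤ) - (y.1 : ℤ)| + |(x.2 : ℤ) - (y.2 : ℤ)| = 1
  symm := ⟨fun x y h => by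
    rw [abs_sub_comm (y.1 : ℤ), abs_sub_comm (y.2 : ℤ)]
    exact h⟩
  loopless := ⟨fun x h => by simp at h⟩

/-- The disjoint union of `N` copies of `H`. -/
def disjointCopies {W : Type*} (N : ℕ) (H : SimpleGraph W) : SimpleGraph (Fin N × W) where
  Adj x y := x.1 = y.1 ∧ H.Adj x.2 y.2
  symm := ⟨fun _ _ h => ⟨h.1.symm, h.2.symm⟩⟩
  loopless := ⟨fun _ h => H.irrefl h.2⟩

end LadderMinor

/-! Call a connected set that contains a model of the ladder with `k` rungs a block, and a vertex
adjacent to every block of a family a hub. For `k ≥ 2` the proof is a downward induction on the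
number `t` of hubs: for each `t ≤ k + 1` some number of disjoint blocks with `t` common hubs forces
`k + 1` rungs in a 3-connected graph (`Forces`). The theorem is the case `t = 0`. With `k + 1` hubs,
blocks and hubs form a `K_{k+1,k+1}` minor, which contains the longer ladder (`forces_succ`).

Three-connectivity enters through `exists_rootedPair`. Three disjoint paths leave a minimal ladder
model inside a set `X`. Since ladders are subcubic, the model can be rearranged so that the paths
start in three different branch sets, or in the three branch sets of a subdivided edge
(`Critical.spread`). Cutting at the middle one gives two ladders, with `r` and `s` rungs, rooted at
outer neighbours `t₁, t₂` and `t₂, t₃` of `X`. The cut column may be used on both sides, so `r + s ≥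
k + 1`: this is the extra rung. If two disjoint sets produce the same roots and the same `r, s`,
then `2r` or `2s` is at least `k + 1`, and two equal ladders are glued along their common roots.
Hence many sets attached to a bounded set suffice, by pigeonhole (`ladIn_of_isolated`).

For the step from `t + 1` hubs to `t` (`Forces.exists_pred`), consider which blocks touch. A block
touching many others yields a star, whose centre is one more hub, or a comb, which is a long chain
of blocks (`starIn_or_combIn`). If every block touches few others, there are many components, which
are attached to hubs only, or a long path of blocks, again a chain.

A long chain (`Forces.exists_chain`) can be regrouped so that only consecutive blocks touch, unless
a new hub or a longer ladder appears. Across `k ^ 2 + 1` consecutive blocks, Menger's theorem gives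
either two disjoint paths, which serve as rails with one rung per block (`ladIn_of_rungs`, by
Erdős–Szekeres), or a cut vertex. Cut vertices at regular distances divide the chain into segments
attached only to hubs and to two cut vertices; two segments of the same type are then glued, using
hubs and the rest of the chain as connections (`HubPath.ladIn`). -/

namespace LadderMinor

/-! ### Connected vertex sets, components, splittings and links. -/

variable {V : Type*}

/-- A vertex set is connected in `G` if it is nonempty and its only nonempty subset closed under
adjacency inside the set is the whole set. -/
def Conn (G : SimpleGraph V) (S : Set V) : Prop :=
  S.Nonempty ∧ ∀ A ⊆ S, A.Nonempty → (∀ a ∈ A, ∀ b ∈ S, G.Adj a b → b ∈ A) → S ⊆ A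

/-- Two vertex sets touch if there is an edge between them. -/
def Touch (G : SimpleGraph V) (S T : Set V) : Prop := ∃ a ∈ S, ∃ b ∈ T, G.Adj a b

variable {G : SimpleGraph V} {S T : Set V}

theorem Touch.symm (h : Touch G S T) : Touch G T S := by
  obtain ⟨a, ha, b, hb, hab⟩ := h
  exact ⟨b, hb, a, ha, hab.symm⟩

theorem Touch.mono {S' T' : Set V} (h : Touch G S T) (hS : S ⊆ S') (hT : T ⊆ T') :
    Touch G S' T' := by
  obtain ⟨a, ha, b, hb, hab⟩ := h
  exact ⟨a, hS ha, b, hT hb, hab⟩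

theorem touch_union_left {S' : Set V} :
    Touch G (S ∪ S') T ↔ Touch G S T ∨ Touch G S' T := by
  constructor
  · rintro ⟨a, ha | ha, b, hb, hab⟩
    · exact Or.inl ⟨a, ha, b, hb, hab⟩
    · exact Or.inr ⟨a, ha, b, hb, hab⟩
  · rintro (h | h)
    · exact h.mono Set.subset_union_left subset_rfl
    · exact h.mono Set.subset_union_right subset_rfl

theorem touch_union_right {T' : Set V} :
    Touch G S (T ∪ T') ↔ Touch G S T ∨ Touch G S T' := by
  constructor
  · rintro ⟨a, ha, b, hb | hb, hab⟩
    · exact Or.inl ⟨a, ha, b, hb, hab⟩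
    · exact Or.inr ⟨a, ha, b, hb, hab⟩
  · rintro (h | h)
    · exact h.mono subset_rfl Set.subset_union_left
    · exact h.mono subset_rfl Set.subset_union_right

theorem conn_singleton (x : V) : Conn G {x} := by
  refine ⟨⟨x, rfl⟩, ?_⟩
  rintro A hA ⟨y, hy⟩ -
  have := hA hy
  simp only [Set.mem_singleton_iff] at this
  subst this
  simpa using hy

theorem Conn.union_inter (hS : Conn G S) (hT : Conn G T) (h : (S ∩ T).Nonempty) :
    Conn G (S ∪ T) := by
  refine ⟨hS.1.mono Set.subset_union_left, fun A hA hne hcl => ?_⟩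
  have key : ∀ {X : Set V}, Conn G X → X ⊆ S ∪ T → (A ∩ X).Nonempty → X ⊆ A := by
    intro X hX hXST hAX
    exact (hX.2 (A ∩ X) Set.inter_subset_right hAX
      (fun a ha b hb hab => ⟨hcl a ha.1 b (hXST hb) hab, hb⟩)).trans Set.inter_subset_left
  obtain ⟨z, hzS, hzT⟩ := h
  obtain ⟨a, ha⟩ := hne
  rcases hA ha with haS | haT
  · have h1 := key hS Set.subset_union_left ⟨a, ha, haS⟩
    have h2 := key hT Set.subset_union_right ⟨z, h1 hzS, hzT⟩
    exact Set.union_subset h1 h2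
  · have h1 := key hT Set.subset_union_right ⟨a, ha, haT⟩
    have h2 := key hS Set.subset_union_left ⟨z, h1 hzT, hzS⟩
    exact Set.union_subset h2 h1

theorem conn_pair {a b : V} (h : G.Adj a b) : Conn G {a, b} := by
  refine ⟨⟨a, by simp⟩, fun A hA hne hcl => ?_⟩
  obtain ⟨c, hc⟩ := hne
  have hcab := hA hc
  simp only [Set.mem_insert_iff, Set.mem_singleton_iff] at hcab
  rintro d (rfl | rfl)
  · rcases hcab with rfl | rfl
    · exact hc
    · exact hcl _ hc _ (by simp) h.symm
  · rcases hcab with rfl | rfl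
    · exact hcl _ hc _ (by simp) h
    · exact hc

theorem Conn.union_touch (hS : Conn G S) (hT : Conn G T) (h : Touch G S T) :
    Conn G (S ∪ T) := by
  obtain ⟨a, ha, b, hb, hab⟩ := h
  have h1 := hS.union_inter (conn_pair hab) ⟨a, ha, by simp⟩
  have h2 := h1.union_inter hT ⟨b, by simp, hb⟩
  convert h2 using 1
  ext x
  simp only [Set.mem_union, Set.mem_insert_iff, Set.mem_singleton_iff]
  constructor
  · tauto
  · rintro ((h | rfl | rfl) | h) <;> tauto

theorem Conn.insert_adj {x : V} (hS : Conn G S) (h : ∃ y ∈ S, G.Adj y x) : Conn G (insert x S) := by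
  have := hS.union_touch (conn_singleton x) (by
    obtain ⟨y, hy, hyx⟩ := h
    exact ⟨y, hy, x, rfl, hyx⟩)
  rwa [Set.union_singleton] at this

theorem conn_sUnion {F : Set (Set V)} {x : V} (hF : ∀ S ∈ F, Conn G S ∧ x ∈ S)
    (hne : F.Nonempty) : Conn G (⋃₀ F) := by
  obtain ⟨S0, hS0⟩ := hne
  refine ⟨⟨x, S0, hS0, (hF S0 hS0).2⟩, fun A hA hne hcl => ?_⟩
  have key : ∀ S ∈ F, (A ∩ S).Nonempty → S ⊆ A := by
    intro S hS hAS
    exact ((hF S hS).1.2 (A ∩ S) Set.inter_subset_right hAS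
      (fun a ha b hb hab => ⟨hcl a ha.1 b ⟨S, hS, hb⟩ hab, hb⟩)).trans Set.inter_subset_left
  obtain ⟨a, ha⟩ := hne
  obtain ⟨S1, hS1, haS1⟩ := hA ha
  have hx : x ∈ A := key S1 hS1 ⟨a, ha, haS1⟩ (hF S1 hS1).2
  rintro y ⟨S, hS, hy⟩
  exact key S hS ⟨x, hx, (hF S hS).2⟩ hy

theorem Conn.exists_exit (hS : Conn G S) {A : Set V} (h1 : (S ∩ A).Nonempty)
    (h2 : ¬ S ⊆ A) : ∃ a ∈ S ∩ A, ∃ b ∈ S \ A, G.Adj a b := by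
  by_contra hcon
  push Not at hcon
  apply h2
  refine (hS.2 (S ∩ A) Set.inter_subset_left h1 ?_).trans Set.inter_subset_right
  intro a ha b hb hab
  by_contra hb'
  exact hcon a ha b ⟨hb, fun h => hb' ⟨hb, h⟩⟩ hab

/-- The component of `x` in the subgraph induced by `S`. -/
def comp (G : SimpleGraph V) (S : Set V) (x : V) : Set V :=
  ⋃₀ {C | C ⊆ S ∧ Conn G C ∧ x ∈ C}

theorem comp_subset (x : V) : comp G S x ⊆ S := Set.sUnion_subset fun _ h => h.1

theorem conn_comp {x : V} (hx : x ∈ S) : Conn G (comp G S x) :=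
  conn_sUnion (fun _ h => h.2) ⟨{x}, by simpa using hx, conn_singleton x, rfl⟩

theorem subset_comp {x : V} {C : Set V} (hC : Conn G C) (hCS : C ⊆ S) (hx : x ∈ C) :
    C ⊆ comp G S x := Set.subset_sUnion_of_mem ⟨hCS, hC, hx⟩

theorem mem_comp {x : V} (hx : x ∈ S) : x ∈ comp G S x :=
  subset_comp (conn_singleton x) (by simpa using hx) rfl rfl

theorem comp_closed {x y z : V} (hx : x ∈ S) (hy : y ∈ comp G S x) (hz : z ∈ S)
    (h : G.Adj y z) : z ∈ comp G S x := by
  have := (conn_comp (G := G) hx).insert_adj (x := z) ⟨y, hy, h⟩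
  refine subset_comp this ?_ (Set.mem_insert_of_mem _ (mem_comp hx)) (Set.mem_insert _ _)
  exact Set.insert_subset hz (comp_subset x)

theorem conn_subset_comp {x : V} {C : Set V} (hx : x ∈ S) (hC : Conn G C) (hCS : C ⊆ S)
    (h : (C ∩ comp G S x).Nonempty) : C ⊆ comp G S x := by
  have := hC.union_inter (conn_comp (G := G) hx) h
  exact Set.subset_union_left.trans
    (subset_comp this (Set.union_subset hCS (comp_subset x)) (Or.inr (mem_comp hx)))

theorem comp_eq {x y : V} (hx : x ∈ S) (hy : y ∈ comp G S x) : comp G S y = comp G S x := by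
  have hyS := comp_subset x hy
  apply Set.Subset.antisymm
  · exact conn_subset_comp hx (conn_comp hyS) (comp_subset y) ⟨y, mem_comp hyS, hy⟩
  · exact conn_subset_comp hyS (conn_comp hx) (comp_subset x) ⟨y, hy, mem_comp hyS⟩

theorem comp_disjoint {x y : V} (hx : x ∈ S) (hy : y ∈ S) (h : comp G S x ≠ comp G S y) :
    Disjoint (comp G S x) (comp G S y) := by
  rw [Set.disjoint_left]
  intro z hz hz'
  exact h ((comp_eq hx hz).symm.trans (comp_eq hy hz'))

/-- A maximal proper connected subset containing `c` misses exactly one vertex: adding a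
neighbouring vertex keeps it connected, so by maximality it gives all of `S`. -/
theorem Conn.exists_noncut [Finite V] (hS : Conn G S) {c : V} (hc : c ∈ S) (h : S ≠ {c}) :
    ∃ x ∈ S, x ≠ c ∧ Conn G (S \ {x}) := by
  have hfin : {A : Set V | A ⊆ S ∧ A ≠ S ∧ Conn G A ∧ c ∈ A}.Finite := Set.toFinite _
  obtain ⟨A, hA⟩ := hfin.exists_maximal ⟨{c}, by simpa using hc, h.symm, conn_singleton c, rfl⟩
  obtain ⟨⟨hAS, hne, hconn, hcA⟩, hmax⟩ := hA
  obtain ⟨a, ha, b, hb, hab⟩ := hS.exists_exit (A := A) ⟨c, hc, hcA⟩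
    (fun h => hne (Set.Subset.antisymm hAS h))
  have h2 : insert b A = S := by
    by_contra hne2
    have := hmax (y := insert b A) ⟨Set.insert_subset hb.1 hAS, hne2, hconn.insert_adj ⟨a, ha.2, hab⟩,
      Set.mem_insert_of_mem _ hcA⟩ (Set.subset_insert _ _)
    exact hb.2 (this (Set.mem_insert _ _))
  refine ⟨b, hb.1, fun h => hb.2 (h ▸ hcA), ?_⟩
  rw [← h2, Set.insert_sdiff_of_mem _ (Set.mem_singleton b), Set.sdiff_singleton_eq_self hb.2]
  exact hconn

theorem Conn.touch_of_union_eq (hS : Conn G S) {C D : Set V} (h : C ∪ D = S) (hC : C.Nonempty)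
    (hD : D.Nonempty) (hdisj : Disjoint C D) : Touch G C D := by
  obtain ⟨d, hd⟩ := hD
  obtain ⟨a, ha, b, hb, hab⟩ := hS.exists_exit (A := C)
    (hC.imp fun c hc => ⟨h ▸ Or.inl hc, hc⟩)
    (fun h' => Set.disjoint_right.1 hdisj hd (h' (h ▸ Or.inr hd)))
  refine ⟨a, ha.2, b, ?_, hab⟩
  have := hb.1
  rw [← h] at this
  exact this.resolve_left hb.2

/-- Absorption: disjoint connected sets inside `U` can be enlarged, inside `U`, to disjoint
connected sets whose union is closed under adjacency in `U`. -/
theorem exists_absorb [Finite V] {ι : Type*} [Finite ι] (U : Set V) (B : ι → Set V)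
    (hB : ∀ i, Conn G (B i)) (hBU : ∀ i, B i ⊆ U)
    (hd : ∀ i j, i ≠ j → Disjoint (B i) (B j)) :
    ∃ B' : ι → Set V, (∀ i, B i ⊆ B' i) ∧ (∀ i, Conn G (B' i)) ∧ (∀ i, B' i ⊆ U) ∧
      (∀ i j, i ≠ j → Disjoint (B' i) (B' j)) ∧
      ∀ i, ∀ u ∈ B' i, ∀ v ∈ U, G.Adj u v → ∃ j, v ∈ B' j := by
  classical
  have hfin : {F : ι → Set V | (∀ i, B i ⊆ F i) ∧ (∀ i, Conn G (F i)) ∧ (∀ i, F i ⊆ U) ∧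
      (∀ i j, i ≠ j → Disjoint (F i) (F j))}.Finite := Set.toFinite _
  -- A maximal family works: a neighbour in `U` outside all its members could be inserted into one
  -- of them.
  obtain ⟨F, hF⟩ := hfin.exists_maximal ⟨B, fun _ => subset_rfl, hB, hBU, hd⟩
  obtain ⟨⟨h1, h2, h3, h4⟩, hmax⟩ := hF
  refine ⟨F, h1, h2, h3, h4, fun i u hu v hv huv => ?_⟩
  by_contra hcon
  push Not at hcon
  have hle : F ≤ Function.update F i (insert v (F i)) := by
    intro j
    by_cases hj : j = i
    · subst hj; simp
    · simp [hj]
  have := hmax (y := Function.update F i (insert v (F i))) ⟨fun j => (h1 j).trans (hle j), ?_, ?_, ?_⟩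
    hle
  · exact hcon i (this i (by simp))
  · intro j
    by_cases hj : j = i
    · subst hj
      simpa using (h2 j).insert_adj ⟨u, hu, huv⟩
    · simpa [hj] using h2 j
  · intro j
    by_cases hj : j = i
    · subst hj
      simpa using Set.insert_subset hv (h3 j)
    · simpa [hj] using h3 j
  · intro j l hjl
    by_cases hj : j = i
    · subst hj
      have : l ≠ j := hjl.symm
      simp only [Function.update_self, ne_eq, this, not_false_eq_true, Function.update_of_ne,
        Set.disjoint_insert_left]
      exact ⟨hcon l, h4 _ _ hjl⟩
    · by_cases hl : l = i
      · subst hl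
        simp only [Function.update_self, ne_eq, hj, not_false_eq_true, Function.update_of_ne,
          Set.disjoint_insert_right]
        exact ⟨hcon j, h4 _ _ hjl⟩
      · simpa [hj, hl] using h4 _ _ hjl

/-- The singletons of `a` and `b` are enlarged by absorption inside `S`; as `S` is connected, the
two resulting sets exhaust it. -/
theorem Conn.exists_split [Finite V] (hS : Conn G S) {a b : V} (ha : a ∈ S) (hb : b ∈ S)
    (hab : a ≠ b) : ∃ C D : Set V, C ∪ D = S ∧ Disjoint C D ∧ Conn G C ∧ Conn G D ∧
      a ∈ C ∧ b ∈ D := by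
  obtain ⟨F, h1, h2, h3, h4, h5⟩ := exists_absorb (G := G) S (fun i : Bool => if i then {a} else {b})
    (by intro i; cases i <;> simp [conn_singleton]) (by intro i; cases i <;> simp [ha, hb])
    (by intro i j; cases i <;> cases j <;> simp [hab, hab.symm])
  refine ⟨F true, F false, ?_, h4 _ _ (by simp), h2 _, h2 _, h1 true (by simp), h1 false (by simp)⟩
  apply Set.Subset.antisymm (Set.union_subset (h3 _) (h3 _))
  apply hS.2 _ (Set.union_subset (h3 _) (h3 _)) ⟨a, Or.inl (h1 true (by simp))⟩
  intro u hu v hv huv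
  have : ∃ j, v ∈ F j := by
    rcases hu with hu | hu
    · exact h5 _ u hu v hv huv
    · exact h5 _ u hu v hv huv
  obtain ⟨j, hj⟩ := this
  cases j
  · exact Or.inr hj
  · exact Or.inl hj

/-- In a connected set split into two connected parts, one of the parts contains a vertex that is
not a cut vertex of the whole set. -/
theorem exists_noncut_of_split [Finite V] {C D : Set V} (hC : Conn G C) (hD : Conn G D)
    (hdisj : Disjoint C D) (ht : Touch G C D) :
    ∃ x ∈ C, Conn G ((C ∪ D) \ {x}) := by
  obtain ⟨c, hc, d, hd, hcd⟩ := ht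
  have hxD : ∀ x ∈ C, D \ {x} = D := fun x hx =>
    Set.sdiff_singleton_eq_self (Set.disjoint_left.1 hdisj hx)
  by_cases h : C = {c}
  · refine ⟨c, hc, ?_⟩
    rw [Set.union_sdiff_distrib, hxD c hc, h, Set.sdiff_self, Set.empty_union]
    exact hD
  · obtain ⟨x, hx, hxc, hconn⟩ := hC.exists_noncut hc h
    refine ⟨x, hx, ?_⟩
    rw [Set.union_sdiff_distrib, hxD x hx]
    exact hconn.union_touch hD ⟨c, ⟨hc, fun h => hxc h.symm⟩, d, hd, hcd⟩

/-- A connected set meeting disjoint sets `P` and `Q` contains a connected set that meets `P` in a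
single vertex, avoids `Q`, and is adjacent to a vertex of `Q`. -/
theorem exists_link {C P Q : Set V} (hC : Conn G C) (hP : (C ∩ P).Nonempty)
    (hQ : (C ∩ Q).Nonempty) (hPQ : Disjoint P Q) :
    ∃ D ⊆ C, ∃ a b, Conn G D ∧ a ∈ D ∧ a ∈ P ∧ (∀ x ∈ D, x ∈ P → x = a) ∧ Disjoint D Q ∧
      b ∈ C ∧ b ∈ Q ∧ ∃ d ∈ D, G.Adj d b := by
  by_contra hcon
  push Not at hcon
  -- `A` consists of the vertices from which `Q` is reached inside `C` without meeting `P`. Without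
  -- a link, `A` is closed under adjacency in `C`, so it equals `C`; but no vertex of `P` belongs to
  -- it.
  let A : Set V := {u | u ∈ C ∧ (u ∈ Q ∨ ∃ D ⊆ C, Conn G D ∧ u ∈ D ∧ Disjoint D P ∧ Disjoint D Q ∧
    ∃ b ∈ C ∩ Q, ∃ d ∈ D, G.Adj d b)}
  have hCA : C ⊆ A := by
    apply hC.2 A (fun u hu => hu.1)
    · obtain ⟨q, hq⟩ := hQ
      exact ⟨q, hq.1, Or.inl hq.2⟩
    · rintro u ⟨huC, hu⟩ w hwC huw
      refine ⟨hwC, ?_⟩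
      by_cases hwQ : w ∈ Q
      · exact Or.inl hwQ
      right
      have hE : ∃ E ⊆ C, Conn G E ∧ w ∈ E ∧ E ∩ P ⊆ {w} ∧ Disjoint E Q ∧
          ∃ b ∈ C ∩ Q, ∃ d ∈ E, G.Adj d b := by
        rcases hu with hu | ⟨D, hDC, hD, huD, hDP, hDQ, b, hb, d, hd, hdb⟩
        · exact ⟨{w}, by simpa using hwC, conn_singleton w, rfl, Set.inter_subset_left,
            by simpa using hwQ, u, ⟨huC, hu⟩, w, rfl, huw.symm⟩
        · refine ⟨insert w D, Set.insert_subset hwC hDC, hD.insert_adj ⟨u, huD, huw⟩,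
            Set.mem_insert _ _, ?_, ?_, b, hb, d, Set.mem_insert_of_mem _ hd, hdb⟩
          · rintro x ⟨hx | hx, hxP⟩
            · exact hx
            · exact absurd hxP (Set.disjoint_left.1 hDP hx)
          · rw [Set.disjoint_insert_left]
            exact ⟨hwQ, hDQ⟩
      obtain ⟨E, hEC, hE, hwE, hEP, hEQ, b, hb, d, hd, hdb⟩ := hE
      by_cases hwP : w ∈ P
      · exact absurd hdb (hcon E hEC w b hE hwE hwP (fun x hx hxP => hEP ⟨hx, hxP⟩) hEQ hb.1 hb.2 d hd)
      · refine ⟨E, hEC, hE, hwE, ?_, hEQ, b, hb, d, hd, hdb⟩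
        rw [Set.disjoint_left]
        intro x hx hxP
        have : x = w := hEP ⟨hx, hxP⟩
        exact hwP (this ▸ hxP)
  obtain ⟨p, hpC, hpP⟩ := hP
  rcases (hCA hpC).2 with h | ⟨D, -, -, hpD, hDP, -⟩
  · exact Set.disjoint_left.1 hPQ hpP h
  · exact Set.disjoint_left.1 hDP hpD hpP

/-- A connected set contains a path between any two of its vertices. -/
theorem Conn.exists_path (hS : Conn G S) {a b : V} (ha : a ∈ S) (hb : b ∈ S) :
    ∃ (n : ℕ) (p : ℕ → V), p 0 = a ∧ p n = b ∧ (∀ i ≤ n, p i ∈ S) ∧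
      (∀ i < n, G.Adj (p i) (p (i + 1))) ∧ ∀ i ≤ n, ∀ j ≤ n, p i = p j → i = j := by
  let A : Set V := {y | ∃ (n : ℕ) (p : ℕ → V), p 0 = a ∧ p n = y ∧ (∀ i ≤ n, p i ∈ S) ∧
      (∀ i < n, G.Adj (p i) (p (i + 1))) ∧ ∀ i ≤ n, ∀ j ≤ n, p i = p j → i = j}
  refine hS.2 A ?_ ⟨a, 0, fun _ => a, rfl, rfl, fun _ _ => ha, by simp, by simp⟩ ?_ hb
  · rintro y ⟨n, p, -, rfl, hp, -⟩
    exact hp n le_rfl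
  · rintro y ⟨n, p, h0, rfl, hp, hadj, hinj⟩ z hz hyz
    by_cases hzp : ∃ i ≤ n, p i = z
    · obtain ⟨i, hi, rfl⟩ := hzp
      exact ⟨i, p, h0, rfl, fun j hj => hp j (hj.trans hi), fun j hj => hadj j (by omega),
        fun j hj l hl => hinj j (by omega) l (by omega)⟩
    · push Not at hzp
      refine ⟨n + 1, fun i => if i ≤ n then p i else z, by simpa using h0, by simp, ?_, ?_, ?_⟩
      · intro i hi
        dsimp only
        split_ifs with h
        · exact hp i h
        · exact hz
      · intro i hi
        dsimp only
        rw [if_pos (by omega)]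
        split_ifs with h
        · exact hadj i (by omega)
        · have : i = n := by omega
          subst this
          exact hyz
      · intro i hi j hj
        dsimp only
        split_ifs with h1 h2 h2
        · exact hinj i h1 j h2
        · intro h; exact absurd h (hzp i h1)
        · intro h; exact absurd h.symm (hzp j h2)
        · intro _; omega

/-- The union of consecutively touching connected sets is connected. -/
theorem conn_iUnion_Icc (U : ℕ → Set V) {a b : ℕ} (hab : a ≤ b)
    (hU : ∀ i, a ≤ i → i ≤ b → Conn G (U i))
    (ht : ∀ i, a ≤ i → i < b → Touch G (U i) (U (i + 1))) :
    Conn G (⋃ i ∈ Set.Icc a b, U i) := by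
  induction b, hab using Nat.le_induction with
  | base => simpa using hU a le_rfl le_rfl
  | succ b hab ih =>
    have h1 := ih (fun i h h' => hU i h (by omega)) (fun i h h' => ht i h (by omega))
    have h2 := h1.union_touch (hU (b + 1) (by omega) le_rfl) ((ht b hab (by omega)).mono
      (Set.subset_biUnion_of_mem (u := U) (show b ∈ Set.Icc a b from ⟨hab, le_rfl⟩)) subset_rfl)
    convert h2 using 1
    ext x
    simp only [Set.mem_iUnion, Set.mem_Icc, Set.mem_union]
    constructor
    · rintro ⟨i, hi, hx⟩
      by_cases h : i ≤ b
      · exact Or.inl ⟨i, ⟨hi.1, h⟩, hx⟩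
      · have : i = b + 1 := by omega
        exact Or.inr (this ▸ hx)
    · rintro (⟨i, hi, hx⟩ | hx)
      · exact ⟨i, ⟨hi.1, by omega⟩, hx⟩
      · exact ⟨b + 1, ⟨by omega, le_rfl⟩, hx⟩

end LadderMinor

/-! ### Menger's theorem for vertex sets. -/

namespace LadderMinor

variable {V : Type*}

theorem Conn.mono_graph {G G' : SimpleGraph V} (h : G' ≤ G) {S : Set V} (hS : Conn G' S) :
    Conn G S :=
  ⟨hS.1, fun A hA hne hcl => hS.2 A hA hne fun a ha b hb hab => hcl a ha b hb (h hab)⟩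

theorem IsSeparation.symm {G : SimpleGraph V} {X Y : Set V} (h : IsSeparation G X Y) :
    IsSeparation G Y X :=
  ⟨by rw [Set.union_comm]; exact h.cover, fun _ _ huv => (h.edge huv).symm⟩

/-- `n` disjoint connected sets joining `A` to `B`. -/
def Linked (G : SimpleGraph V) (n : ℕ) (A B : Set V) : Prop :=
  ∃ D : Fin n → Set V, (∀ i, Conn G (D i)) ∧ (∀ i j, i ≠ j → Disjoint (D i) (D j)) ∧
    (∀ i, (D i ∩ A).Nonempty) ∧ ∀ i, (D i ∩ B).Nonempty

/-- No separation of order less than `n` separates `A` from `B`. -/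
def Unseparated (G : SimpleGraph V) (n : ℕ) (A B : Set V) : Prop :=
  ∀ X Y : Set V, IsSeparation G X Y → A ⊆ X → B ⊆ Y → n ≤ (X ∩ Y).ncard

theorem Unseparated.symm {G : SimpleGraph V} {n : ℕ} {A B : Set V} (h : Unseparated G n A B) :
    Unseparated G n B A := fun X Y hXY hB hA => by
  rw [Set.inter_comm]
  exact h Y X hXY.symm hA hB

/-- The part inside `X` of the linkage in the inductive step of Menger's theorem. -/
theorem exists_half_linkage [Finite V] {G : SimpleGraph V} {n : ℕ} {A B X Y : Set V} {x y : V}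
    (ih : ∀ G' : SimpleGraph V, G' < G → ∀ A B : Set V, Unseparated G' n A B → Linked G' n A B)
    (h : Unseparated G n A B) (hxy : G.Adj x y)
    (hsep : IsSeparation (G.deleteEdges {s(x, y)}) X Y)
    (hA : A ⊆ X) (hB : B ⊆ Y) (hxX : x ∈ X) (hyY : y ∈ Y) :
    ∃ D : Fin n → Set V, (∀ i, Conn G (D i)) ∧ (∀ i j, i ≠ j → Disjoint (D i) (D j)) ∧
      (∀ i, (D i ∩ A).Nonempty) ∧ (∀ i, D i ⊆ X) ∧ ∀ i, (D i ∩ insert x (X ∩ Y)).Nonempty := by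
  -- The graph induced on `X` without the edge `xy`, kept on the full vertex type so that it is
  -- strictly below `G` and the induction hypothesis applies.
  let G1 : SimpleGraph V :=
    { Adj := fun u v => (G.deleteEdges {s(x, y)}).Adj u v ∧ u ∈ X ∧ v ∈ X
      symm := ⟨fun u v huv => ⟨huv.1.symm, huv.2.2, huv.2.1⟩⟩
      loopless := ⟨fun u hu => (G.deleteEdges {s(x, y)}).irrefl hu.1⟩ }
  have hle : G1 ≤ G := fun u v huv => (G.deleteEdges_le _) huv.1
  have hlt : G1 < G := by
    refine lt_of_le_of_ne hle fun heq => ?_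
    have : G1.Adj x y := heq ▸ hxy
    simp [G1] at this
  obtain ⟨D, hD, hdisj, hDA, hDS⟩ := ih G1 hlt A (insert x (X ∩ Y)) (by
    intro X' Y' hsep' hA' hS'
    -- A separation of `A` from `insert x (X ∩ Y)` in `G1` extends across `Y` to a separation of `A`
    -- from `B` in `G` of no larger order. The deleted edge lies on the second side because `x ∈ Y'`
    -- and `y ∈ Y`.
    have := h (X' ∩ X) ((Y' ∩ X) ∪ Y) ⟨?_, ?_⟩ (Set.subset_inter hA' hA)
      (hB.trans Set.subset_union_right)
    · refine this.trans (Set.ncard_le_ncard ?_ (Set.toFinite _))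
      rintro z ⟨⟨hz1, hz2⟩, hz3 | hz3⟩
      · exact ⟨hz1, hz3.1⟩
      · exact ⟨hz1, hS' (Or.inr ⟨hz2, hz3⟩)⟩
    · ext z
      have h1 := Set.ext_iff.1 hsep'.cover z
      have h2 := Set.ext_iff.1 hsep.cover z
      simp only [Set.mem_union, Set.mem_univ, iff_true, Set.mem_inter_iff] at h1 h2 ⊢
      tauto
    · intro u v huv
      by_cases he : s(u, v) = s(x, y)
      · right
        rw [Sym2.eq_iff] at he
        have hx : x ∈ (Y' ∩ X) ∪ Y := Or.inl ⟨hS' (Set.mem_insert _ _), hxX⟩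
        rcases he with ⟨rfl, rfl⟩ | ⟨rfl, rfl⟩
        · exact ⟨hx, Or.inr hyY⟩
        · exact ⟨Or.inr hyY, hx⟩
      · have huv' : (G.deleteEdges {s(x, y)}).Adj u v := by
          rw [SimpleGraph.deleteEdges_adj]
          exact ⟨huv, by simpa using he⟩
        rcases hsep.edge huv' with h1 | h1
        · rcases hsep'.edge (show G1.Adj u v from ⟨huv', h1⟩) with h2 | h2
          · exact Or.inl ⟨⟨h2.1, h1.1⟩, h2.2, h1.2⟩
          · exact Or.inr ⟨Or.inl ⟨h2.1, h1.1⟩, Or.inl ⟨h2.2, h1.2⟩⟩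
        · exact Or.inr ⟨Or.inr h1.1, Or.inr h1.2⟩)
  refine ⟨D, fun i => (hD i).mono_graph hle, hdisj, hDA, fun i => ?_, hDS⟩
  by_contra hcon
  obtain ⟨a, ha⟩ := hDA i
  obtain ⟨u, hu, v, hv, huv⟩ := (hD i).exists_exit (A := X) ⟨a, ha.1, hA ha.2⟩ hcon
  exact hv.2 huv.2.2

/-- Menger's theorem, for vertex sets. -/
theorem menger [Finite V] {n : ℕ} (G : SimpleGraph V) :
    ∀ A B : Set V, Unseparated G n A B → Linked G n A B := by
  induction G using WellFoundedLT.induction with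
  | ind G ih =>
  intro A B h
  by_cases hG : ∃ x y, G.Adj x y
  swap
  · push Not at hG
    have hn := h A (Aᶜ ∪ B) ⟨by ext z; simp; tauto, fun u v huv => absurd huv (hG u v)⟩ subset_rfl
      Set.subset_union_right
    rw [Set.inter_union_distrib_left, Set.inter_compl_self, Set.empty_union,
      ← Nat.card_coe_set_eq] at hn
    have : Nonempty (Fin n ↪ ↥(A ∩ B)) := by
      have : Fintype ↥(A ∩ B) := Fintype.ofFinite _
      apply Function.Embedding.nonempty_of_card_le
      simpa [Nat.card_eq_fintype_card] using hn
    obtain ⟨e⟩ := this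
    refine ⟨fun i => {(e i : V)}, fun i => conn_singleton _, fun i j hij => ?_,
      fun i => ⟨e i, rfl, (e i).2.1⟩, fun i => ⟨e i, rfl, (e i).2.2⟩⟩
    simpa using fun h' => hij (e.injective (Subtype.ext h'))
  obtain ⟨x, y, hxy⟩ := hG
  have hle : G.deleteEdges {s(x, y)} ≤ G := G.deleteEdges_le _
  have hlt : G.deleteEdges {s(x, y)} < G := by
    refine lt_of_le_of_ne hle fun heq => ?_
    have : (G.deleteEdges {s(x, y)}).Adj x y := by rw [heq]; exact hxy
    simp at this
  by_cases hU : Unseparated (G.deleteEdges {s(x, y)}) n A B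
  · obtain ⟨D, hD, h'⟩ := ih _ hlt A B hU
    exact ⟨D, fun i => (hD i).mono_graph hle, h'⟩
  unfold Unseparated at hU
  push Not at hU
  obtain ⟨X, Y, hsep, hA, hB, hS⟩ := hU
  -- The edge `xy` must cross from `X \ Y` to `Y \ X` in one direction; otherwise the small
  -- separation of the smaller graph would also separate `G`.
  wlog hxX : x ∈ X ∧ x ∉ Y ∧ y ∈ Y ∧ y ∉ X generalizing x y
  · by_cases hyX : y ∈ X ∧ y ∉ Y ∧ x ∈ Y ∧ x ∉ X
    · refine this y x hxy.symm ?_ ?_ ?_ hyX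
      · rwa [Sym2.eq_swap]
      · rwa [Sym2.eq_swap]
      · rwa [Sym2.eq_swap]
    · exfalso
      have hcov : ∀ z, z ∈ X ∨ z ∈ Y := fun z => by
        have := Set.ext_iff.1 hsep.cover z
        simpa using this
      have : IsSeparation G X Y := by
        refine ⟨hsep.cover, fun u v huv => ?_⟩
        by_cases he : s(u, v) = s(x, y)
        · have h1 := hcov x
          have h2 := hcov y
          rw [Sym2.eq_iff] at he
          rcases he with ⟨rfl, rfl⟩ | ⟨rfl, rfl⟩ <;> tauto
        · exact hsep.edge (by
            rw [SimpleGraph.deleteEdges_adj]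
            exact ⟨huv, by simpa using he⟩)
      exact absurd (h X Y this hA hB) (by omega)
  obtain ⟨hxX, hxY, hyY, hyX⟩ := hxX
  obtain ⟨D, hD1, hD2, hD3, hD4, hD5⟩ := exists_half_linkage ih h hxy hsep hA hB hxX hyY
  obtain ⟨D', hE1, hE2, hE3, hE4, hE5⟩ := exists_half_linkage (x := y) (y := x) ih h.symm hxy.symm
    (by rw [Sym2.eq_swap]; exact hsep.symm) hB hA hyY hxX
  rw [Set.inter_comm] at hE5
  have hxS : (insert x (X ∩ Y)).ncard ≤ n := by
    rw [Set.ncard_insert_of_notMem (fun h' => hxY h'.2) (Set.toFinite _)]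
    omega
  have hyS : (insert y (X ∩ Y)).ncard ≤ n := by
    rw [Set.ncard_insert_of_notMem (fun h' => hyX h'.1) (Set.toFinite _)]
    omega
  -- A set of at most `n` vertices met by `n` disjoint sets is used up completely, one vertex for
  -- each set. This makes the ends of the two half linkages on the separator match.
  have key : ∀ (T : Set V) (F : Fin n → Set V), T.ncard ≤ n →
      (∀ i j, i ≠ j → Disjoint (F i) (F j)) → (∀ i, (F i ∩ T).Nonempty) →
      ∃ e : Fin n → V, (∀ i, e i ∈ F i) ∧ (∀ i, e i ∈ T) ∧ ∀ t ∈ T, ∃ i, e i = t := by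
    intro T F hT hF1 hF2
    choose e he using hF2
    have hinj : Function.Injective e := by
      intro i j hij
      by_contra hne
      exact Set.disjoint_left.1 (hF1 i j hne) (he i).1 (hij ▸ (he j).1)
    refine ⟨e, fun i => (he i).1, fun i => (he i).2, ?_⟩
    have h1 : Set.range e ⊆ T := by
      rintro _ ⟨i, rfl⟩
      exact (he i).2
    have h2 : Set.range e = T := by
      apply Set.eq_of_subset_of_ncard_le h1 _ (Set.toFinite _)
      rwa [← Nat.card_coe_set_eq (Set.range e), Nat.card_range_of_injective hinj, Nat.card_eq_fintype_card,
        Fintype.card_fin]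
    intro t ht
    rw [← h2] at ht
    exact ht
  obtain ⟨e, he1, he2, he3⟩ := key _ D hxS hD2 hD5
  obtain ⟨f, hf1, hf2, hf3⟩ := key _ D' hyS hE2 hE5
  -- The half ending at `x` is continued through the edge `xy` by the half starting at `y`; every
  -- other pair of halves shares its vertex in `X ∩ Y`.
  have hσ : ∀ i, ∃ j, (e i = x ∧ f j = y) ∨ (e i ∈ X ∩ Y ∧ f j = e i) := by
    intro i
    rcases he2 i with h1 | h1
    · obtain ⟨j, hj⟩ := hf3 y (Set.mem_insert _ _)
      exact ⟨j, Or.inl ⟨h1, hj⟩⟩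
    · obtain ⟨j, hj⟩ := hf3 (e i) (Set.mem_insert_of_mem _ h1)
      exact ⟨j, Or.inr ⟨h1, hj⟩⟩
  choose σ hσ using hσ
  have uniq : ∀ (T : Set V) (F : Fin n → Set V) (e : Fin n → V), 
      (∀ i j, i ≠ j → Disjoint (F i) (F j)) → (∀ i, e i ∈ F i) → (∀ t ∈ T, ∃ i, e i = t) →
      ∀ i, ∀ z ∈ F i, z ∈ T → z = e i := by
    intro T F e hF he hT i z hz hzT
    obtain ⟨j, rfl⟩ := hT z hzT
    by_contra hne
    have hij : i ≠ j := fun h' => hne (by rw [h'])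
    exact Set.disjoint_left.1 (hF i j hij) hz (he j)
  have heinj : ∀ i j, e i = e j → i = j := by
    intro i j hij
    by_contra hne
    exact Set.disjoint_left.1 (hD2 i j hne) (he1 i) (hij ▸ he1 j)
  have hσinj : ∀ i j, σ i = σ j → i = j := by
    intro i j hij
    apply heinj
    rcases hσ i with ⟨h1, h2⟩ | ⟨h1, h2⟩ <;> rcases hσ j with ⟨h3, h4⟩ | ⟨h3, h4⟩
    · rw [h1, h3]
    · rw [hij, h4] at h2
      exact absurd (h2 ▸ h3.1) hyX
    · rw [← hij, h2] at h4
      exact absurd (h4 ▸ h1.1) hyX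
    · rw [← h2, ← h4, hij]
  refine ⟨fun i => D i ∪ D' (σ i), fun i => ?_, fun i j hij => ?_,
    fun i => (hD3 i).mono (Set.inter_subset_inter_left _ Set.subset_union_left),
    fun i => (hE3 (σ i)).mono (Set.inter_subset_inter_left _ Set.subset_union_right)⟩
  · rcases hσ i with ⟨h1, h2⟩ | ⟨h1, h2⟩
    · exact (hD1 i).union_touch (hE1 _) ⟨x, h1 ▸ he1 i, y, h2 ▸ hf1 _, hxy⟩
    · exact (hD1 i).union_inter (hE1 _) ⟨e i, he1 i, h2 ▸ hf1 _⟩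
  · have cross : ∀ i j, i ≠ j → Disjoint (D i) (D' (σ j)) := by
      intro i j hij
      rw [Set.disjoint_left]
      intro z hz hz'
      have hzS : z ∈ X ∩ Y := ⟨hD4 i hz, hE4 _ hz'⟩
      have h1 := uniq _ D e hD2 he1 he3 i z hz (Or.inr hzS)
      have h2 := uniq _ D' f hE2 hf1 hf3 (σ j) z hz' (Or.inr hzS)
      apply hij
      apply heinj
      rcases hσ j with ⟨h3, h4⟩ | ⟨h3, h4⟩
      · rw [h4] at h2
        exact absurd (h2 ▸ hzS.1) hyX
      · rw [← h1, h2, h4]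
    rw [Set.disjoint_union_left, Set.disjoint_union_right, Set.disjoint_union_right]
    exact ⟨⟨hD2 i j hij, cross i j hij⟩, (cross j i hij.symm).symm,
      hE2 _ _ (fun h' => hij (hσinj i j h'))⟩

end LadderMinor

/-! ### Ladder models, gluing of rooted ladders, and ladders from two rails and many rungs. -/

namespace LadderMinor

variable {V : Type*} {G : SimpleGraph V}

/-- `f` is a model of the ladder with `r` rungs, given by its branch sets: `f b j` is the branch
set of the vertex in row `b` and column `j`. -/
structure Lad (G : SimpleGraph V) (r : ℕ) (f : Bool → ℕ → Set V) : Prop where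
  conn : ∀ b j, j < r → Conn G (f b j)
  disj : ∀ b j b' j', j < r → j' < r → (b, j) ≠ (b', j') → Disjoint (f b j) (f b' j')
  rung : ∀ j, j < r → Touch G (f true j) (f false j)
  rail : ∀ b j, j + 1 < r → Touch G (f b j) (f b (j + 1))

/-- The vertex set `S` contains a model of the ladder with `r` rungs. -/
def LadIn (G : SimpleGraph V) (r : ℕ) (S : Set V) : Prop :=
  ∃ f, Lad G r f ∧ ∀ b j, j < r → f b j ⊆ S

/-- `S` contains a model of the ladder with `r ≥ 1` rungs such that the branch sets of the two
vertices in the last column are adjacent to `u` and `v`, respectively. -/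
def RootedLad (G : SimpleGraph V) (r : ℕ) (S : Set V) (u v : V) : Prop :=
  1 ≤ r ∧ ∃ f, Lad G r f ∧ (∀ b j, j < r → f b j ⊆ S) ∧
    Touch G (f true (r - 1)) {u} ∧ Touch G (f false (r - 1)) {v}

theorem LadIn.mono {r r' : ℕ} {S S' : Set V} (h : LadIn G r S) (hr : r' ≤ r) (hS : S ⊆ S') :
    LadIn G r' S' := by
  obtain ⟨f, hf, hfS⟩ := h
  exact ⟨f, ⟨fun b j hj => hf.conn b j (by omega),
    fun b j b' j' hj hj' h => hf.disj b j b' j' (by omega) (by omega) h,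
    fun j hj => hf.rung j (by omega), fun b j hj => hf.rail b j (by omega)⟩,
    fun b j hj => (hfS b j (by omega)).trans hS⟩

theorem Lad.reflect {r : ℕ} {f : Bool → ℕ → Set V} (h : Lad G r f) :
    Lad G r (fun b j => f b (r - 1 - j)) := by
  refine ⟨fun b j hj => h.conn b _ (by omega), fun b j b' j' hj hj' hne =>
    h.disj _ _ _ _ (by omega) (by omega) ?_, fun j hj => h.rung _ (by omega), fun b j hj => ?_⟩
  · intro heq
    apply hne
    simp only [Prod.mk.injEq] at heq ⊢
    exact ⟨heq.1, by omega⟩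
  · have := (h.rail b (r - 1 - (j + 1)) (by omega)).symm
    rwa [show r - 1 - (j + 1) + 1 = r - 1 - j by omega] at this

theorem Lad.flip {r : ℕ} {f : Bool → ℕ → Set V} (h : Lad G r f) :
    Lad G r (fun b j => f (!b) j) := by
  refine ⟨fun b j hj => h.conn _ _ hj, fun b j b' j' hj hj' hne =>
    h.disj _ _ _ _ hj hj' ?_, fun j hj => (h.rung _ hj).symm, fun b j hj => h.rail _ _ hj⟩
  intro heq
  apply hne
  simpa using heq

theorem RootedLad.symm {r : ℕ} {S : Set V} {u v : V} (h : RootedLad G r S u v) :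
    RootedLad G r S v u := by
  obtain ⟨hr, f, hf, hS, h1, h2⟩ := h
  exact ⟨hr, _, hf.flip, fun b j hj => hS _ _ hj, h2, h1⟩

theorem touch_singleton_mem {S C : Set V} {u : V} (h : Touch G S {u}) (hu : u ∈ C) :
    Touch G S C := h.mono subset_rfl (by simpa using hu)

/-- Two rooted ladders whose roots are joined by disjoint connected sets form a ladder. -/
theorem RootedLad.join {r s : ℕ} {S T C D : Set V} {u v u' v' : V}
    (h : RootedLad G r S u v) (h' : RootedLad G s T u' v') (hC : Conn G C) (hD : Conn G D)
    (hu : u ∈ C) (hu' : u' ∈ C) (hv : v ∈ D) (hv' : v' ∈ D) (hCD : Disjoint C D)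
    (hST : Disjoint S T) (hSC : Disjoint S C) (hSD : Disjoint S D) (hTC : Disjoint T C)
    (hTD : Disjoint T D) : LadIn G (r + s) Set.univ := by
  obtain ⟨hr, f, hf, hfS, hf1, hf2⟩ := h
  obtain ⟨hs, g, hg, hgT, hg1, hg2⟩ := h'
  let K : Bool → Set V := fun b => if b then C else D
  have hK : ∀ b, Conn G (K b) := by intro b; cases b <;> simpa [K]
  have hSK : ∀ b, Disjoint S (K b) := by intro b; cases b <;> simpa [K]
  have hTK : ∀ b, Disjoint T (K b) := by intro b; cases b <;> simpa [K]
  have hKK : ∀ b b', b ≠ b' → Disjoint (K b) (K b') := by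
    intro b b'; cases b <;> cases b' <;> simp [K, hCD, hCD.symm]
  have hfK : ∀ b, Touch G (f b (r - 1)) (K b) := by
    intro b; cases b
    · simpa [K] using touch_singleton_mem hf2 hv
    · simpa [K] using touch_singleton_mem hf1 hu
  have hgK : ∀ b, Touch G (g b (s - 1)) (K b) := by
    intro b; cases b
    · simpa [K] using touch_singleton_mem hg2 hv'
    · simpa [K] using touch_singleton_mem hg1 hu'
  -- The connectors are absorbed into the last column of the first ladder, and the second ladder is
  -- appended in reversed column order, so that its last column comes next.
  let F : Bool → ℕ → Set V := fun b j =>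
    if j + 1 < r then f b j else if j < r then f b j ∪ K b else g b (r + s - 1 - j)
  have hF1 : ∀ b j, j < r → F b j ⊆ f b j ∪ K b := by
    intro b j hj
    by_cases h1 : j + 1 < r
    · simp [F, h1]
    · simp [F, h1, hj]
  have hF1' : ∀ b j, j < r → f b j ⊆ F b j := by
    intro b j hj
    by_cases h1 : j + 1 < r
    · simp [F, h1]
    · simp [F, h1, hj]
  have hF2 : ∀ b j, r ≤ j → F b j = g b (r + s - 1 - j) := by
    intro b j hj
    simp [F, show ¬ j + 1 < r by omega, show ¬ j < r by omega]
  have hFr : ∀ b, F b (r - 1) = f b (r - 1) ∪ K b := by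
    intro b
    simp [F, show ¬ r - 1 + 1 < r by omega, show r - 1 < r by omega]
  have hdFr : ∀ b j b' j', j < r → j' < r → (b, j) ≠ (b', j') → Disjoint (F b j) (F b' j') := by
    intro b j b' j' hj hj' hne
    have hd := hf.disj b j b' j' hj hj' hne
    have h1 : Disjoint (f b j) (K b') := (hSK b').mono_left (hfS b j hj)
    have h2 : Disjoint (K b) (f b' j') := ((hSK b).mono_left (hfS b' j' hj')).symm
    by_cases hj1 : j + 1 < r
    · have : F b j = f b j := by simp [F, hj1]
      rw [this]
      exact (Set.disjoint_union_right.2 ⟨hd, h1⟩).mono_right (hF1 b' j' hj')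
    · by_cases hj2 : j' + 1 < r
      · have : F b' j' = f b' j' := by simp [F, hj2]
        rw [this]
        exact (Set.disjoint_union_left.2 ⟨hd, h2⟩).mono_left (hF1 b j hj)
      · have hjj : j = j' := by omega
        have hbb : b ≠ b' := fun hb => hne (by rw [hb, hjj])
        exact (Set.disjoint_union_left.2 ⟨Set.disjoint_union_right.2 ⟨hd, h1⟩,
          Set.disjoint_union_right.2 ⟨h2, hKK b b' hbb⟩⟩).mono (hF1 b j hj) (hF1 b' j' hj')
  have hcross : ∀ b j b' j', j < r → r ≤ j' → j' < r + s → Disjoint (F b j) (F b' j') := by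
    intro b j b' j' hj hj' hj''
    rw [hF2 b' j' hj']
    have h1 := hgT b' (r + s - 1 - j') (by omega)
    exact (Set.disjoint_union_left.2 ⟨hST.mono (hfS b j hj) h1,
      ((hTK b).mono_left h1).symm⟩).mono_left (hF1 b j hj)
  refine ⟨F, ⟨?_, ?_, ?_, ?_⟩, fun _ _ _ => Set.subset_univ _⟩
  · intro b j hj
    by_cases h1 : j + 1 < r
    · simpa [F, h1] using hf.conn b j (by omega)
    · by_cases h2 : j < r
      · have : j = r - 1 := by omega
        subst this
        rw [hFr]
        exact (hf.conn b _ h2).union_touch (hK b) (hfK b)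
      · rw [hF2 b j (by omega)]
        exact hg.conn b _ (by omega)
  · intro b j b' j' hj hj' hne
    by_cases h1 : j < r
    · by_cases h2 : j' < r
      · exact hdFr b j b' j' h1 h2 hne
      · exact hcross b j b' j' h1 (by omega) hj'
    · by_cases h2 : j' < r
      · exact (hcross b' j' b j h2 (by omega) hj).symm
      · rw [hF2 b j (by omega), hF2 b' j' (by omega)]
        refine hg.disj _ _ _ _ (by omega) (by omega) fun heq => hne ?_
        simp only [Prod.mk.injEq] at heq ⊢
        exact ⟨heq.1, by omega⟩
  · intro j hj
    by_cases h1 : j < r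
    · exact (hf.rung j h1).mono (hF1' _ _ h1) (hF1' _ _ h1)
    · rw [hF2 _ _ (by omega), hF2 _ _ (by omega)]
      exact hg.rung _ (by omega)
  · intro b j hj
    by_cases h1 : j + 1 < r
    · exact (hf.rail b j h1).mono (hF1' _ _ (by omega)) (hF1' _ _ h1)
    · by_cases h2 : j < r
      · have : j = r - 1 := by omega
        subst this
        rw [hFr, hF2 _ _ (by omega), show r + s - 1 - (r - 1 + 1) = s - 1 by omega]
        exact (hgK b).symm.mono Set.subset_union_right subset_rfl
      · rw [hF2 _ _ (by omega), hF2 _ _ (by omega)]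
        have := (hg.rail b (r + s - 1 - (j + 1)) (by omega)).symm
        rwa [show r + s - 1 - (j + 1) + 1 = r + s - 1 - j by omega] at this

/-- The Erdős–Szekeres theorem for a finite family of pairs of integers. -/
theorem erdos_szekeres_pairs {ι : Type*} [Finite ι] (k : ℕ) (α β : ι → ℕ)
    (hα : Function.Injective α) (hβ : Function.Injective β) (hk : k * k < Nat.card ι) :
    ∃ s : ℕ → ι, (∀ i < k, α (s i) < α (s (i + 1))) ∧
      ((∀ i < k, β (s i) < β (s (i + 1))) ∨ ∀ i < k, β (s (i + 1)) < β (s i)) := by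
  classical
  -- `P R i l`: a sequence of `l + 1` terms ends at `i`, increases in `α` and is `R`-monotone in
  -- `β`.
  let P : (ℕ → ℕ → Prop) → ι → ℕ → Prop := fun R i l => ∃ s : ℕ → ι, s l = i ∧
    (∀ j < l, α (s j) < α (s (j + 1))) ∧ ∀ j < l, R (β (s j)) (β (s (j + 1)))
  by_cases hex : ∃ i, P (· < ·) i k ∨ P (· > ·) i k
  · obtain ⟨i, ⟨s, -, h1, h2⟩ | ⟨s, -, h1, h2⟩⟩ := hex
    · exact ⟨s, h1, Or.inl h2⟩
    · exact ⟨s, h1, Or.inr h2⟩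
  exfalso
  push Not at hex
  have h0 : ∀ R i, P R i 0 := fun R i => ⟨fun _ => i, rfl, by simp, by simp⟩
  have hstep : ∀ R i j l, α i < α j → R (β i) (β j) → P R i l → P R j (l + 1) := by
    rintro R i j l hij hR ⟨s, rfl, h1, h2⟩
    refine ⟨fun n => if n ≤ l then s n else j, by simp, ?_, ?_⟩
    · intro n hn
      dsimp only
      rw [if_pos (by omega)]
      split_ifs with h
      · exact h1 n (by omega)
      · rwa [show n = l by omega]
    · intro n hn
      dsimp only
      rw [if_pos (by omega)]
      split_ifs with h
      · exact h2 n (by omega)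
      · rwa [show n = l by omega]
  let L : (ℕ → ℕ → Prop) → ι → ℕ := fun R i => Nat.findGreatest (P R i) k
  have hL : ∀ R i, P R i (L R i) := fun R i => Nat.findGreatest_spec (Nat.zero_le k) (h0 R i)
  have hLk : ∀ R i, ¬ P R i k → L R i < k := by
    intro R i hn
    refine lt_of_le_of_ne (Nat.findGreatest_le k) fun h => hn ?_
    have := hL R i
    rwa [h] at this
  have hLt : ∀ R i j, α i < α j → R (β i) (β j) → ¬ P R i k → L R i < L R j := by
    intro R i j hij hR hn
    have := hLk R i hn
    exact Nat.le_findGreatest (by omega) (hstep R i j _ hij hR (hL R i))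
  -- Each index is labelled by the lengths of the longest increasing and longest decreasing
  -- sequences ending there. Of two indices, the one with larger `α` has a larger label in one
  -- coordinate, so the labels are distinct.
  let F : ι → Fin k × Fin k := fun i =>
    (⟨L (· < ·) i, hLk _ i (hex i).1⟩, ⟨L (· > ·) i, hLk _ i (hex i).2⟩)
  have key : ∀ i j, F i = F j → ¬ α i < α j := by
    intro i j hF hij
    simp only [F, Prod.mk.injEq, Fin.mk.injEq] at hF
    have hne : β i ≠ β j := fun h => by
      have := hβ h
      subst this
      exact lt_irrefl _ hij
    rcases lt_or_gt_of_ne hne with h | h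
    · exact absurd hF.1 (hLt (· < ·) i j hij h (hex i).1).ne
    · exact absurd hF.2 (hLt (· > ·) i j hij h (hex i).2).ne
  have hFinj : Function.Injective F := by
    intro i j hF
    apply hα
    have h1 := key i j hF
    have h2 := key j i hF.symm
    omega
  have := Nat.card_le_card_of_injective F hFinj
  rw [Nat.card_eq_fintype_card (α := Fin k × Fin k)] at this
  simp only [Fintype.card_prod, Fintype.card_fin] at this
  omega

/-- A sequence of `a` disjoint connected sets, consecutive ones touching. -/
structure Chain (G : SimpleGraph V) (U : ℕ → Set V) (a : ℕ) : Prop where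
  conn : ∀ i, i < a → Conn G (U i)
  disj : ∀ i j, i < a → j < a → i ≠ j → Disjoint (U i) (U j)
  touch : ∀ i, i + 1 < a → Touch G (U i) (U (i + 1))

theorem Chain.reflect {U : ℕ → Set V} {a : ℕ} (h : Chain G U a) :
    Chain G (fun i => U (a - 1 - i)) a := by
  refine ⟨fun i hi => h.conn _ (by omega), fun i j hi hj hij => h.disj _ _ (by omega) (by omega)
    (by omega), fun i hi => ?_⟩
  have := (h.touch (a - 1 - (i + 1)) (by omega)).symm
  rwa [show a - 1 - (i + 1) + 1 = a - 1 - i by omega] at this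

theorem Chain.conn_Icc {U : ℕ → Set V} {a i j : ℕ} (h : Chain G U a) (hij : i ≤ j) (hj : j < a) :
    Conn G (⋃ l ∈ Set.Icc i j, U l) :=
  conn_iUnion_Icc U hij (fun l _ hl => h.conn l (by omega)) (fun l _ hl => h.touch l (by omega))

theorem Chain.disjoint_Icc {U : ℕ → Set V} {a i j i' j' : ℕ} (h : Chain G U a) (hj : j < a)
    (hj' : j' < a) (hlt : j < i') :
    Disjoint (⋃ l ∈ Set.Icc i j, U l) (⋃ l ∈ Set.Icc i' j', U l) := by
  simp only [Set.disjoint_iUnion_left, Set.disjoint_iUnion_right, Set.mem_Icc]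
  intro l hl l' hl'
  exact h.disj _ _ (hl'.2.trans_lt hj) (hl.2.trans_lt hj') (by omega)

/-- The interval of rail indices used by the `j`-th column of a ladder whose rungs attach at the
increasing positions `p 0 < ... < p k`. -/
def segEnd (p : ℕ → ℕ) (k j : ℕ) : ℕ := if j < k then p (j + 1) - 1 else p j

theorem segEnd_spec {p : ℕ → ℕ} {k : ℕ} (hp : ∀ i < k, p i < p (i + 1)) :
    (∀ j ≤ k, p j ≤ segEnd p k j) ∧ (∀ j j', j < j' → j' ≤ k → segEnd p k j < p j') ∧
      (∀ j < k, segEnd p k j + 1 = p (j + 1)) ∧ ∀ j ≤ k, segEnd p k j ≤ p k := by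
  have mono : ∀ j j', j ≤ j' → j' ≤ k → p j ≤ p j' := by
    intro j j' hjj
    induction j', hjj using Nat.le_induction with
    | base => exact fun _ => le_rfl
    | succ n hn ih =>
      intro h
      have h1 := ih (by omega)
      have h2 := hp n (by omega)
      omega
  refine ⟨fun j hj => ?_, fun j j' hjj hj' => ?_, fun j hj => ?_, fun j hj => ?_⟩
  · unfold segEnd
    split_ifs with h
    · have := hp j h; omega
    · exact le_rfl
  · unfold segEnd
    rw [if_pos (by omega)]
    have h1 := mono (j + 1) j' (by omega) hj'
    have h2 := hp j (by omega)
    omega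
  · unfold segEnd
    rw [if_pos hj]
    have h2 := hp j (by omega)
    omega
  · unfold segEnd
    split_ifs with h
    · have := mono (j + 1) k (by omega) le_rfl
      omega
    · exact mono j k hj le_rfl

/-- Two disjoint rails together with more than `k ^ 2` disjoint rungs form a ladder. -/
theorem ladIn_of_rungs {ι : Type*} [Finite ι] {k a b : ℕ} {U W : ℕ → Set V} (hU : Chain G U a)
    (hW : Chain G W b) (hUW : ∀ i j, i < a → j < b → Disjoint (U i) (W j)) (α β : ι → ℕ)
    (E : ι → Set V) (hα : Function.Injective α) (hβ : Function.Injective β)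
    (hαa : ∀ i, α i < a) (hβb : ∀ i, β i < b)
    (hE : ∀ i, Conn G (E i ∪ U (α i))) (hEt : ∀ i, Touch G (E i ∪ U (α i)) (W (β i)))
    (hEE : ∀ i j, i ≠ j → Disjoint (E i) (E j))
    (hEU : ∀ i j, j < a → j ≠ α i → Disjoint (E i) (U j))
    (hEW : ∀ i j, j < b → Disjoint (E i) (W j)) (hk : k * k < Nat.card ι) :
    LadIn G (k + 1) Set.univ := by
  obtain ⟨s, hs, hs'⟩ := erdos_szekeres_pairs k α β hα hβ hk
  -- If the attachments on the second rail decrease, that rail is traversed backwards.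
  wlog hinc : ∀ i < k, β (s i) < β (s (i + 1)) generalizing W β
  · have hdec := hs'.resolve_left hinc
    refine this hW.reflect (fun i j hi hj => hUW i _ hi (by omega)) (fun i => b - 1 - β i) ?_
      (fun i => by have := hβb i; omega) ?_ (fun i j hj => hEW i _ (by omega)) (Or.inl ?_) ?_
    · intro i j hij
      have h1 := hβb i
      have h2 := hβb j
      exact hβ (by simp only at hij; omega)
    · intro i
      have h1 := hβb i
      simpa only [show b - 1 - (b - 1 - β i) = β i by omega] using hEt i
    · intro i hi
      have h1 := hβb (s i)
      have h2 := hdec i hi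
      omega
    · intro i hi
      have h1 := hβb (s i)
      have h2 := hdec i hi
      omega
  obtain ⟨p, hp⟩ : ∃ p : ℕ → ℕ, ∀ i, α (s i) = p i := ⟨_, fun _ => rfl⟩
  obtain ⟨q, hq⟩ : ∃ q : ℕ → ℕ, ∀ i, β (s i) = q i := ⟨_, fun _ => rfl⟩
  simp only [hp] at hs
  simp only [hq] at hinc
  obtain ⟨a1, a2, a3, a4⟩ := segEnd_spec hs
  obtain ⟨b1, b2, b3, b4⟩ := segEnd_spec hinc
  have hαa' : ∀ i, p i < a := fun i => hp i ▸ hαa (s i)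
  have hβb' : ∀ i, q i < b := fun i => hq i ▸ hβb (s i)
  have hE' : ∀ i, Conn G (E (s i) ∪ U (p i)) := fun i => hp i ▸ hE (s i)
  have hEt' : ∀ i, Touch G (E (s i) ∪ U (p i)) (W (q i)) := fun i => by
    have := hEt (s i)
    rwa [hp, hq] at this
  have hsinj : ∀ i j, i ≤ k → j ≤ k → i ≠ j → s i ≠ s j := by
    intro i j hi hj hij heq
    have heq' : p i = p j := by rw [← hp, heq, hp]
    rcases lt_or_gt_of_ne hij with h | h
    · have h1 := a2 i j h hj
      have h2 := a1 i hi
      omega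
    · have h1 := a2 j i h hi
      have h2 := a1 j hj
      omega
  have haa : ∀ j ≤ k, segEnd p k j < a := fun j hj => (a4 j hj).trans_lt (hαa' _)
  have hbb : ∀ j ≤ k, segEnd q k j < b := fun j hj => (b4 j hj).trans_lt (hβb' _)
  -- Each rail is cut just before the attachment of the next chosen rung, so that consecutive pieces
  -- touch. The connector `E (s j)` is added to the piece on the `U` side.
  let R : ℕ → Set V := fun j => ⋃ l ∈ Set.Icc (p j) (segEnd p k j), U l
  let R' : ℕ → Set V := fun j => ⋃ l ∈ Set.Icc (q j) (segEnd q k j), W l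
  have hUR : ∀ j ≤ k, ∀ l, p j ≤ l → l ≤ segEnd p k j → U l ⊆ R j := fun j _ l h1 h2 =>
    Set.subset_biUnion_of_mem (u := U) (show l ∈ Set.Icc _ _ from ⟨h1, h2⟩)
  have hWR : ∀ j ≤ k, ∀ l, q j ≤ l → l ≤ segEnd q k j → W l ⊆ R' j := fun j _ l h1 h2 =>
    Set.subset_biUnion_of_mem (u := W) (show l ∈ Set.Icc _ _ from ⟨h1, h2⟩)
  have hRR : ∀ i j, i ≤ k → j ≤ k → i ≠ j → Disjoint (R i) (R j) := by
    intro i j hi hj hij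
    rcases lt_or_gt_of_ne hij with h | h
    · exact hU.disjoint_Icc (haa i hi) (haa j hj) (a2 i j h hj)
    · exact (hU.disjoint_Icc (haa j hj) (haa i hi) (a2 j i h hi)).symm
  have hRR' : ∀ i j, i ≤ k → j ≤ k → i ≠ j → Disjoint (R' i) (R' j) := by
    intro i j hi hj hij
    rcases lt_or_gt_of_ne hij with h | h
    · exact hW.disjoint_Icc (hbb i hi) (hbb j hj) (b2 i j h hj)
    · exact (hW.disjoint_Icc (hbb j hj) (hbb i hi) (b2 j i h hi)).symm
  have hER : ∀ i j, i ≤ k → j ≤ k → i ≠ j → Disjoint (E (s i)) (R j) := by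
    intro i j hi hj hij
    simp only [R, Set.disjoint_iUnion_right, Set.mem_Icc]
    intro l hl
    refine hEU _ _ (hl.2.trans_lt (haa j hj)) ?_
    rw [hp]
    rcases lt_or_gt_of_ne hij with h | h
    · have h1 := a2 i j h hj
      have h2 := a1 i hi
      omega
    · have h1 := a2 j i h hi
      omega
  have hcross : ∀ i j, i ≤ k → j ≤ k → Disjoint (E (s i) ∪ R i) (R' j) := by
    intro i j hi hj
    rw [Set.disjoint_union_left]
    simp only [R, R', Set.disjoint_iUnion_right, Set.disjoint_iUnion_left, Set.mem_Icc]
    exact ⟨fun l hl => hEW _ _ (hl.2.trans_lt (hbb j hj)),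
      fun l hl l' hl' => hUW _ _ (hl'.2.trans_lt (haa i hi)) (hl.2.trans_lt (hbb j hj))⟩
  refine ⟨fun c j => if c then E (s j) ∪ R j else R' j, ⟨?_, ?_, ?_, ?_⟩,
    fun _ _ _ => Set.subset_univ _⟩
  · intro c j hj
    cases c
    · exact hW.conn_Icc (b1 j (by omega)) (hbb j (by omega))
    · have h1 := hUR j (by omega) (p j) le_rfl (a1 j (by omega))
      have h2 := (hE' j).union_inter (hU.conn_Icc (a1 j (by omega)) (haa j (by omega)))
        (by
          obtain ⟨z, hz⟩ := (hU.conn (p j) (hαa' _)).1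
          exact ⟨z, Or.inr hz, h1 hz⟩)
      rw [Set.union_assoc, Set.union_eq_self_of_subset_left h1] at h2
      simpa using h2
  · intro c j c' j' hj hj' hne
    cases c <;> cases c'
    · simp only [Bool.false_eq_true, if_false]
      exact hRR' _ _ (by omega) (by omega) (fun h => hne (by rw [h]))
    · simpa using (hcross j' j (by omega) (by omega)).symm
    · simpa using hcross j j' (by omega) (by omega)
    · have hjj : j ≠ j' := fun h => hne (by rw [h])
      simp only [if_true, Set.disjoint_union_left, Set.disjoint_union_right]
      exact ⟨⟨hEE _ _ (hsinj j j' (by omega) (by omega) hjj),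
        (hER j' j (by omega) (by omega) hjj.symm).symm⟩,
        hER j j' (by omega) (by omega) hjj, hRR _ _ (by omega) (by omega) hjj⟩
  · intro j hj
    simp only [if_true, Bool.false_eq_true, if_false]
    refine (hEt' j).mono (Set.union_subset_union_right _
      (hUR j (by omega) (p j) le_rfl (a1 j (by omega)))) (hWR j (by omega) (q j) le_rfl (b1 j (by omega)))
  · intro c j hj
    cases c
    · simp only [Bool.false_eq_true, if_false]
      have h3 := b3 j (by omega)
      have h5 := hbb (j + 1) (by omega)
      have h6 := b1 (j + 1) (by omega)
      have := hW.touch (segEnd q k j) (by omega)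
      refine this.mono (hWR j (by omega) _ (b1 j (by omega)) le_rfl) ?_
      rw [h3]
      exact hWR _ (by omega) _ le_rfl (b1 _ (by omega))
    · simp only [if_true]
      have h3 := a3 j (by omega)
      have h5 := haa (j + 1) (by omega)
      have h6 := a1 (j + 1) (by omega)
      have := hU.touch (segEnd p k j) (by omega)
      refine this.mono ((hUR j (by omega) _ (a1 j (by omega)) le_rfl).trans
        Set.subset_union_right) ?_
      rw [h3]
      exact (hUR _ (by omega) _ le_rfl (a1 _ (by omega))).trans Set.subset_union_right

end LadderMinor

/-! ### Critical models of subcubic graphs and the separation of three attachment vertices. -/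

namespace LadderMinor

variable {V W : Type*} {G : SimpleGraph V} {H : SimpleGraph W}

/-- An `H`-model in `G` given by branch sets. -/
structure SetModel (H : SimpleGraph W) (G : SimpleGraph V) (φ : W → Set V) : Prop where
  conn : ∀ u, Conn G (φ u)
  disj : ∀ u v, u ≠ v → Disjoint (φ u) (φ v)
  edge : ∀ u v, H.Adj u v → Touch G (φ u) (φ v)

/-- A model of `H` with the edge `vw` subdivided; `E` is the branch set of the new vertex. -/
structure SubdivModel (H : SimpleGraph W) (G : SimpleGraph V) (φ : W → Set V) (E : Set V)
    (v w : W) : Prop where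
  adj : H.Adj v w
  conn : ∀ u, Conn G (φ u)
  connE : Conn G E
  disj : ∀ u v, u ≠ v → Disjoint (φ u) (φ v)
  disjE : ∀ u, Disjoint E (φ u)
  edge : ∀ a b, H.Adj a b → s(a, b) ≠ s(v, w) → Touch G (φ a) (φ b)
  left : Touch G (φ v) E
  right : Touch G E (φ w)

/-- A model is critical if no single vertex can be removed from a branch set. -/
def Critical (H : SimpleGraph W) (G : SimpleGraph V) (φ : W → Set V) : Prop :=
  ∀ v, ∀ x ∈ φ v, Conn G (φ v \ {x}) →
    ∃ w, H.Adj v w ∧ ∀ y ∈ φ v, ∀ z ∈ φ w, G.Adj y z → y = x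

/-- An inclusion-minimal model is critical: a vertex violating the condition could be deleted from
its branch set. -/
theorem SetModel.exists_critical [Finite V] [Finite W] {φ : W → Set V} {X : Set V}
    (h : SetModel H G φ) (hX : ∀ u, φ u ⊆ X) :
    ∃ ψ, SetModel H G ψ ∧ (∀ u, ψ u ⊆ X) ∧ Critical H G ψ := by
  classical
  have hfin : {ψ : W → Set V | SetModel H G ψ ∧ ∀ u, ψ u ⊆ X}.Finite := Set.toFinite _
  obtain ⟨ψ, ⟨hψ, hψX⟩, hmin⟩ := hfin.exists_minimal ⟨φ, h, hX⟩
  refine ⟨ψ, hψ, hψX, fun v x hx hconn => ?_⟩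
  by_contra hcon
  push Not at hcon
  have hle : ∀ u, Function.update ψ v (ψ v \ {x}) u ⊆ ψ u := by
    intro u
    by_cases hu : u = v
    · subst hu; simp
    · simp [hu]
  have hv : ∀ w, H.Adj v w → Touch G (ψ v \ {x}) (ψ w) := by
    intro w hw
    obtain ⟨y, hy, z, hz, hyz, hne⟩ := hcon w hw
    exact ⟨y, ⟨hy, hne⟩, z, hz, hyz⟩
  have := hmin (y := Function.update ψ v (ψ v \ {x})) ⟨⟨?_, ?_, ?_⟩, fun u => (hle u).trans (hψX u)⟩
    hle v hx
  · simp at this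
  · intro u
    by_cases hu : u = v
    · subst hu; simpa using hconn
    · simpa [hu] using hψ.conn u
  · intro a b hab
    exact (hψ.disj a b hab).mono (hle a) (hle b)
  · intro a b hab
    by_cases ha : a = v
    · subst ha
      have : b ≠ a := hab.ne'
      simpa [this] using hv b hab
    · by_cases hb : b = v
      · subst hb
        simpa [ha] using (hv a hab.symm).symm
      · simpa [ha, hb] using hψ.edge a b hab

/-- Splitting a branch set `φ v` into three parts, keeping the first at `v`, using the second to
subdivide the edge `vw` and moving the third to `w`. -/
theorem SetModel.subdivide {φ : W → Set V} (h : SetModel H G φ) {v w : W}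
    (hvw : H.Adj v w) {C D D' : Set V} (hC : Conn G C) (hD : Conn G D)
    (hD' : Conn G (φ w ∪ D')) (hCv : C ⊆ φ v) (hDv : D ⊆ φ v) (hD'v : D' ⊆ φ v)
    (hCD : Disjoint C D) (hCD' : Disjoint C D') (hDD' : Disjoint D D')
    (hu : ∀ u, H.Adj v u → u ≠ w → Touch G C (φ u)) (h1 : Touch G C D)
    (h2 : Touch G D (φ w ∪ D')) :
    ∃ ψ, SubdivModel H G ψ D v w ∧ ψ v = C ∧ ψ w = φ w ∪ D' ∧ (∀ u, u ≠ v → φ u ⊆ ψ u) ∧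
      ∀ u, ψ u ⊆ ⋃ u, φ u := by
  classical
  have hne : v ≠ w := hvw.ne
  let ψ : W → Set V := fun u => if u = w then φ w ∪ D' else if u = v then C else φ u
  have hv : ψ v = C := by simp [ψ, hne]
  have hw : ψ w = φ w ∪ D' := by simp [ψ]
  have ho : ∀ u, u ≠ v → u ≠ w → ψ u = φ u := fun u h1 h2 => by simp [ψ, h1, h2]
  have hge : ∀ u, u ≠ v → φ u ⊆ ψ u := by
    intro u h1
    by_cases h2 : u = w
    · subst h2; rw [hw]; exact Set.subset_union_left
    · rw [ho u h1 h2]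
  have hdv : ∀ u, u ≠ v → Disjoint C (ψ u) ∧ Disjoint D (ψ u) := by
    intro u h1
    have h3 := h.disj v u (Ne.symm h1)
    by_cases h2 : u = w
    · subst h2; rw [hw]
      exact ⟨Set.disjoint_union_right.2 ⟨h3.mono_left hCv, hCD'⟩,
        Set.disjoint_union_right.2 ⟨h3.mono_left hDv, hDD'⟩⟩
    · rw [ho u h1 h2]
      exact ⟨h3.mono_left hCv, h3.mono_left hDv⟩
  have hdw : ∀ u, u ≠ v → u ≠ w → Disjoint (ψ w) (ψ u) := by
    intro u h1 h2
    rw [hw, ho u h1 h2]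
    exact Set.disjoint_union_left.2 ⟨h.disj _ _ (Ne.symm h2), (h.disj _ _ (Ne.symm h1)).mono_left hD'v⟩
  refine ⟨ψ, ⟨hvw, ?_, hD, ?_, ?_, ?_, by rw [hv]; exact h1, by rw [hw]; exact h2⟩, hv, hw, hge, ?_⟩
  · intro u
    by_cases h1 : u = v
    · subst h1; rwa [hv]
    · by_cases h2 : u = w
      · subst h2; rwa [hw]
      · rw [ho u h1 h2]; exact h.conn u
  · intro a b hab
    by_cases ha : a = v
    · subst ha
      rw [hv]
      exact (hdv b (Ne.symm hab)).1
    · by_cases hb : b = v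
      · subst hb
        rw [hv]
        exact (hdv a ha).1.symm
      · by_cases ha' : a = w
        · subst ha'
          exact hdw b hb (Ne.symm hab)
        · by_cases hb' : b = w
          · subst hb'
            exact (hdw a ha hab).symm
          · rw [ho a ha ha', ho b hb hb']
            exact h.disj a b hab
  · intro u
    by_cases h1 : u = v
    · subst h1; rw [hv]; exact hCD.symm
    · exact (hdv u h1).2
  · intro a b hab hne'
    by_cases ha : a = v
    · subst ha
      have hb : b ≠ w := fun hb => hne' (by rw [hb])
      rw [hv]
      exact (hu b hab hb).mono subset_rfl (hge b hab.ne')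
    · by_cases hb : b = v
      · subst hb
        have ha' : a ≠ w := fun ha' => hne' (by rw [ha', Sym2.eq_swap])
        rw [hv]
        exact ((hu a hab.symm ha').mono subset_rfl (hge a ha)).symm
      · exact (h.edge a b hab).mono (hge a ha) (hge b hb)
  · intro u
    by_cases h1 : u = v
    · subst h1; rw [hv]; exact hCv.trans (Set.subset_iUnion φ _)
    · by_cases h2 : u = w
      · subst h2; rw [hw]
        exact Set.union_subset (Set.subset_iUnion φ _) (hD'v.trans (Set.subset_iUnion φ _))
      · rw [ho u h1 h2]; exact Set.subset_iUnion φ _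

theorem SubdivModel.symm {φ : W → Set V} {E : Set V} {v w : W} (h : SubdivModel H G φ E v w) :
    SubdivModel H G φ E w v :=
  ⟨h.adj.symm, h.conn, h.connE, h.disj, h.disjE, fun a b hab hne => h.edge a b hab
    (by rwa [Sym2.eq_swap (a := v)]), h.right.symm, h.left.symm⟩

/-- Contracting one of the two halves of the subdivided edge. -/
theorem SubdivModel.merge {φ : W → Set V} {E : Set V} {v w : W} (h : SubdivModel H G φ E v w) :
    ∃ ψ, SetModel H G ψ ∧ ψ w = φ w ∪ E ∧ ∀ u, u ≠ w → ψ u = φ u := by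
  classical
  let ψ : W → Set V := fun u => if u = w then φ w ∪ E else φ u
  have hw : ψ w = φ w ∪ E := by simp [ψ]
  have ho : ∀ u, u ≠ w → ψ u = φ u := fun u h2 => by simp [ψ, h2]
  have hge : ∀ u, φ u ⊆ ψ u := by
    intro u
    by_cases h2 : u = w
    · subst h2; rw [hw]; exact Set.subset_union_left
    · rw [ho u h2]
  have hd : ∀ u, u ≠ w → Disjoint (ψ w) (ψ u) := by
    intro u hu
    rw [hw, ho u hu]
    exact Set.disjoint_union_left.2 ⟨h.disj _ _ (Ne.symm hu), h.disjE u⟩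
  have hvw : Touch G (ψ v) (ψ w) := by
    rw [ho v h.adj.ne, hw]
    exact h.left.mono subset_rfl Set.subset_union_right
  refine ⟨ψ, ⟨?_, ?_, ?_⟩, hw, ho⟩
  · intro u
    by_cases h2 : u = w
    · subst h2; rw [hw]; exact (h.conn u).union_touch h.connE h.right.symm
    · rw [ho u h2]; exact h.conn u
  · intro a b hab
    by_cases ha : a = w
    · subst ha; exact hd b (Ne.symm hab)
    · by_cases hb : b = w
      · subst hb; exact (hd a hab).symm
      · rw [ho a ha, ho b hb]; exact h.disj a b hab
  · intro a b hab
    by_cases he : s(a, b) = s(v, w)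
    · rw [Sym2.eq_iff] at he
      rcases he with ⟨rfl, rfl⟩ | ⟨rfl, rfl⟩
      · exact hvw
      · exact hvw.symm
    · exact (h.edge a b hab he).mono (hge a) (hge b)

/-- Either the vertices of `S` meet three branch sets of an `H`-model inside `X`, or they meet the
three branch sets of a subdivided edge. -/
def Spread (H : SimpleGraph W) (G : SimpleGraph V) (X S : Set V) : Prop :=
  (∃ ψ, SetModel H G ψ ∧ (∀ u, ψ u ⊆ X) ∧ ∃ u₁ u₂ u₃, u₁ ≠ u₂ ∧ u₁ ≠ u₃ ∧ u₂ ≠ u₃ ∧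
    (ψ u₁ ∩ S).Nonempty ∧ (ψ u₂ ∩ S).Nonempty ∧ (ψ u₃ ∩ S).Nonempty) ∨
  ∃ ψ E v w, SubdivModel H G ψ E v w ∧ (∀ u, ψ u ⊆ X) ∧ E ⊆ X ∧
    (ψ v ∩ S).Nonempty ∧ (E ∩ S).Nonempty ∧ (ψ w ∩ S).Nonempty

/-- Maximum degree at most three. -/
def Subcubic (H : SimpleGraph W) : Prop :=
  ∀ v a b c d, H.Adj v a → H.Adj v b → H.Adj v c → H.Adj v d →
    a = b ∨ a = c ∨ a = d ∨ b = c ∨ b = d ∨ c = d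

/-- `C` contains a vertex whose removal leaves the branch set connected. By criticality some
neighbouring branch set is reached only through that vertex, hence not from `D`. -/
theorem Critical.exists_exclusive [Finite V] {φ : W → Set V} (hcr : Critical H G φ) {v : W}
    {C D : Set V} (hC : Conn G C) (hD : Conn G D) (hdisj : Disjoint C D) (ht : Touch G C D)
    (hCD : C ∪ D = φ v) : ∃ w, H.Adj v w ∧ ¬ Touch G D (φ w) := by
  obtain ⟨x, hx, hconn⟩ := exists_noncut_of_split hC hD hdisj ht
  rw [hCD] at hconn
  obtain ⟨w, hw, h⟩ := hcr v x (hCD ▸ Or.inl hx) hconn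
  refine ⟨w, hw, ?_⟩
  rintro ⟨y, hy, z, hz, hyz⟩
  have := h y (hCD ▸ Or.inr hy) z hz hyz
  exact Set.disjoint_right.1 hdisj hy (this ▸ hx)

theorem SetModel.touch_or {φ : W → Set V} (h : SetModel H G φ) {v w : W} (hvw : H.Adj v w)
    {C D : Set V} (hCD : C ∪ D = φ v) : Touch G C (φ w) ∨ Touch G D (φ w) := by
  have := h.edge v w hvw
  rwa [← hCD, touch_union_left] at this

/-- Each half of a split branch set has a neighbour exclusive to it. As there are at most three
neighbours, one half, called `C`, is needed for a single neighbour `w` only, and can therefore be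
used to subdivide the edge `vw`. Which of `a`, `b` lies in `C` is not under control. -/
theorem Critical.exists_split [Finite V] {φ : W → Set V} (hcr : Critical H G φ)
    (h : SetModel H G φ) (hH : Subcubic H) {v : W} {a b : V} (ha : a ∈ φ v) (hb : b ∈ φ v)
    (hab : a ≠ b) : ∃ C D w, C ∪ D = φ v ∧ Disjoint C D ∧ Conn G C ∧ Conn G D ∧ H.Adj v w ∧
      ¬ Touch G D (φ w) ∧ (∀ u, H.Adj v u → u ≠ w → Touch G D (φ u)) ∧
      ((a ∈ C ∧ b ∈ D) ∨ (b ∈ C ∧ a ∈ D)) := by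
  obtain ⟨C, D, hCD, hdisj, hC, hD, haC, hbD⟩ := (h.conn v).exists_split ha hb hab
  have ht := (h.conn v).touch_of_union_eq hCD hC.1 hD.1 hdisj
  have hDC : D ∪ C = φ v := by rw [Set.union_comm, hCD]
  obtain ⟨w₁, hw₁, hn₁⟩ := hcr.exists_exclusive hC hD hdisj ht hCD
  obtain ⟨w₂, hw₂, hn₂⟩ := hcr.exists_exclusive hD hC hdisj.symm ht.symm hDC
  by_cases hall : ∀ u, H.Adj v u → u ≠ w₁ → Touch G D (φ u)
  · exact ⟨C, D, w₁, hCD, hdisj, hC, hD, hw₁, hn₁, hall, Or.inl ⟨haC, hbD⟩⟩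
  · push Not at hall
    obtain ⟨u₀, hu₀, hne, hn₀⟩ := hall
    refine ⟨D, C, w₂, hDC, hdisj.symm, hD, hC, hw₂, hn₂, ?_, Or.inr ⟨hbD, haC⟩⟩
    intro u hu huw
    -- The exclusive neighbours `w₁`, `w₂`, the neighbour `u₀` missed by `D` and a neighbour `u`
    -- missed by `C` would be too many: any coincidence among the four contradicts the contacts
    -- found.
    by_contra hnu
    have t1 := h.touch_or hw₁ hCD
    have t2 := h.touch_or hw₂ hCD
    have t0 := h.touch_or hu₀ hCD
    have t := h.touch_or hu hCD
    rcases hH v w₁ w₂ u₀ u hw₁ hw₂ hu₀ hu with rfl | rfl | rfl | rfl | rfl | rfl <;> tauto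

/-- Attachment vertices sharing a branch set are separated by splitting that set. A part carrying a
single edge becomes a subdividing vertex or is contracted into the other end, so three different
branch sets or a subdivided edge result. -/
theorem Critical.spread [Finite V] {φ : W → Set V} (hcr : Critical H G φ)
    (h : SetModel H G φ) (hH : Subcubic H) {S : Set V} {a b c : V} (haS : a ∈ S) (hbS : b ∈ S)
    (hcS : c ∈ S) (hab : a ≠ b) (hac : a ≠ c) (hbc : b ≠ c) (ha : a ∈ ⋃ u, φ u)
    (hb : b ∈ ⋃ u, φ u) (hc : c ∈ ⋃ u, φ u) : Spread H G (⋃ u, φ u) S := by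
  have hsub : ∀ u, φ u ⊆ ⋃ u, φ u := Set.subset_iUnion φ
  -- two vertices in the same branch set, the third one elsewhere
  have two : ∀ a b c : V, a ∈ S → b ∈ S → c ∈ S → a ≠ b → ∀ v u, u ≠ v → a ∈ φ v → b ∈ φ v →
      c ∈ φ u → Spread H G (⋃ u, φ u) S := by
    intro a b c haS hbS hcS hab v u huv ha hb hc
    obtain ⟨C, D, w, hCD, hdisj, hC, hD, hw, hnw, hall, hor⟩ := hcr.exists_split h hH ha hb hab
    have hCS : (C ∩ S).Nonempty := by
      rcases hor with ⟨h1, h2⟩ | ⟨h1, h2⟩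
      exacts [⟨a, h1, haS⟩, ⟨b, h1, hbS⟩]
    have hDS : (D ∩ S).Nonempty := by
      rcases hor with ⟨h1, h2⟩ | ⟨h1, h2⟩
      exacts [⟨b, h2, hbS⟩, ⟨a, h2, haS⟩]
    have hCv : C ⊆ φ v := hCD ▸ Set.subset_union_left
    have hDv : D ⊆ φ v := hCD ▸ Set.subset_union_right
    have ht := (h.conn v).touch_of_union_eq hCD hC.1 hD.1 hdisj
    obtain ⟨ψ, hψ, hψv, hψw, hge, hψX⟩ := h.subdivide hw (D' := ∅) hD hC (by simpa using h.conn w)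
      hDv hCv (Set.empty_subset _) hdisj.symm (Set.disjoint_empty _) (Set.disjoint_empty _) hall
      ht.symm (by simpa using (h.touch_or hw hCD).resolve_right hnw)
    have hcu : (ψ u ∩ S).Nonempty := ⟨c, hge u huv hc, hcS⟩
    by_cases huw : u = w
    · subst huw
      exact Or.inr ⟨ψ, C, v, u, hψ, hψX, hCv.trans (hsub v), hψv ▸ hDS, hCS, hcu⟩
    -- When `c` is not at `w`, the subdividing part is contracted into `w`, and `v`, `w`, `u` are
    -- three different hit branch sets.
    · obtain ⟨χ, hχ, hχw, hχo⟩ := hψ.merge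
      refine Or.inl ⟨χ, hχ, ?_, v, w, u, hw.ne, huv.symm, Ne.symm huw, ?_, ?_, ?_⟩
      · intro x
        by_cases hx : x = w
        · subst hx; rw [hχw]; exact Set.union_subset (hψX _) (hCv.trans (hsub v))
        · rw [hχo x hx]; exact hψX x
      · rw [hχo v hw.ne, hψv]; exact hDS
      · rw [hχw]; exact hCS.mono (Set.inter_subset_inter_left _ Set.subset_union_right)
      · rw [hχo u huw]; exact hcu
  -- three vertices in the same branch set
  have three : ∀ v, a ∈ φ v → b ∈ φ v → c ∈ φ v → Spread H G (⋃ u, φ u) S := by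
    intro v ha hb hc
    have : ∃ a b : V, a ∈ S ∧ b ∈ S ∧ a ≠ c ∧ b ≠ c ∧ a ∈ φ v ∧ b ∈ φ v ∧
        ∃ C D w, C ∪ D = φ v ∧ Disjoint C D ∧ Conn G C ∧ Conn G D ∧ H.Adj v w ∧
        ¬ Touch G D (φ w) ∧ (∀ u, H.Adj v u → u ≠ w → Touch G D (φ u)) ∧ a ∈ C ∧ b ∈ D := by
      obtain ⟨C, D, w, h1, h2, h3, h4, h5, h6, h7, ⟨h8, h9⟩ | ⟨h8, h9⟩⟩ :=
        hcr.exists_split h hH ha hb hab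
      · exact ⟨a, b, haS, hbS, hac, hbc, ha, hb, C, D, w, h1, h2, h3, h4, h5, h6, h7, h8, h9⟩
      · exact ⟨b, a, hbS, haS, hbc, hac, hb, ha, C, D, w, h1, h2, h3, h4, h5, h6, h7, h8, h9⟩
    clear haS hbS hac hbc ha hb hab
    obtain ⟨a, b, haS, hbS, hac, hbc, ha, hb, C₁, C₂, w₁, hCC, hdisj, hC₁, hC₂, hw₁, hn₁, hall,
      haC, hbC⟩ := this
    have hC₁v : C₁ ⊆ φ v := hCC ▸ Set.subset_union_left
    have hC₂v : C₂ ⊆ φ v := hCC ▸ Set.subset_union_right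
    have ht := (h.conn v).touch_of_union_eq hCC hC₁.1 hC₂.1 hdisj
    rcases (hCC ▸ hc : c ∈ C₁ ∪ C₂) with hcC | hcC
    · obtain ⟨D, D', hDD, hdD, hD, hD', haD, hcD⟩ := hC₁.exists_split haC hcC hac
      have hDS : (D ∩ S).Nonempty := ⟨a, haD, haS⟩
      have hDS' : (D' ∩ S).Nonempty := ⟨c, hcD, hcS⟩
      have ht' : Touch G D C₂ ∨ Touch G D' C₂ := by rwa [← hDD, touch_union_left] at ht
      clear haD hcD hcS hcC haC hac haS
      wlog htD : Touch G D C₂ generalizing D D'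
      · exact this D' D (by rw [Set.union_comm, hDD]) hdD.symm hD' hD hDS' hDS ht'.symm
          (ht'.resolve_left htD)
      have hD1 : D ⊆ C₁ := hDD ▸ Set.subset_union_left
      have hD1' : D' ⊆ C₁ := hDD ▸ Set.subset_union_right
      have htDD := hC₁.touch_of_union_eq hDD hD.1 hD'.1 hdD
      -- `C₂` already reaches every neighbour except `w₁`, so the neighbour exclusive to the outer
      -- piece `D'` can only be `w₁`. Thus `C₂`, `D`, `D'` lie in this order along the edge from `v`
      -- to `w₁`.
      obtain ⟨w, hw, hnw⟩ := hcr.exists_exclusive (v := v) hD' (hD.union_touch hC₂ htD)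
        (Set.disjoint_union_right.2 ⟨hdD.symm, hdisj.mono_left hD1'⟩)
        (htDD.symm.mono subset_rfl Set.subset_union_left)
        (by rw [← Set.union_assoc, Set.union_comm D' D, hDD, hCC])
      rw [touch_union_left, not_or] at hnw
      have hww : w = w₁ := by
        by_contra hne
        exact hnw.2 (hall w hw hne)
      subst hww
      have hwD' : Touch G D' (φ w) := by
        have h1 := (h.touch_or hw hCC).resolve_right hn₁
        rw [← hDD, touch_union_left] at h1
        exact h1.resolve_left hnw.1
      obtain ⟨ψ, hψ, hψv, hψw, hge, hψX⟩ := h.subdivide hw hC₂ hD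
        ((h.conn w).union_touch hD' hwD'.symm) hC₂v (hD1.trans hC₁v) (hD1'.trans hC₁v)
        (hdisj.mono_left hD1).symm (hdisj.mono_left hD1').symm hdD hall htD.symm
        (htDD.mono subset_rfl Set.subset_union_right)
      refine Or.inr ⟨ψ, D, v, w, hψ, hψX, (hD1.trans hC₁v).trans (hsub v), ?_, hDS, ?_⟩
      · rw [hψv]; exact ⟨b, hbC, hbS⟩
      · rw [hψw]; exact hDS'.mono (Set.inter_subset_inter_left _ Set.subset_union_right)
    · obtain ⟨D, D', hDD, hdD, hD, hD', hbD, hcD⟩ := hC₂.exists_split hbC hcC hbc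
      have hDS : (D ∩ S).Nonempty := ⟨b, hbD, hbS⟩
      have hDS' : (D' ∩ S).Nonempty := ⟨c, hcD, hcS⟩
      have ht' : Touch G C₁ D ∨ Touch G C₁ D' := by rwa [← hDD, touch_union_right] at ht
      clear hbD hcD hcS hcC hbC hbc hbS
      wlog htD : Touch G C₁ D generalizing D D'
      · exact this D' D (by rw [Set.union_comm, hDD]) hdD.symm hD' hD hDS' hDS ht'.symm
          (ht'.resolve_left htD)
      have hD1 : D ⊆ C₂ := hDD ▸ Set.subset_union_left
      have hD1' : D' ⊆ C₂ := hDD ▸ Set.subset_union_right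
      have htDD := hC₂.touch_of_union_eq hDD hD.1 hD'.1 hdD
      have hCS : (C₁ ∩ S).Nonempty := ⟨a, haC, haS⟩
      have htw₁ : Touch G C₁ (φ w₁) := (h.touch_or hw₁ hCC).resolve_right hn₁
      have hw₁D : ¬ Touch G D (φ w₁) := fun h' => hn₁ (h'.mono hD1 subset_rfl)
      have hw₁D' : ¬ Touch G D' (φ w₁) := fun h' => hn₁ (h'.mono hD1' subset_rfl)
      obtain ⟨w, hw, hnw⟩ := hcr.exists_exclusive (v := v) hD' (hD.union_touch hC₁ htD.symm)
        (Set.disjoint_union_right.2 ⟨hdD.symm, (hdisj.mono_right hD1').symm⟩)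
        (htDD.symm.mono subset_rfl Set.subset_union_left)
        (by rw [← Set.union_assoc, Set.union_comm D' D, hDD, Set.union_comm, hCC])
      rw [touch_union_left, not_or] at hnw
      have hww : w ≠ w₁ := fun h' => hnw.2 (h' ▸ htw₁)
      have htall : ∀ u, H.Adj v u → u ≠ w₁ → Touch G D (φ u) ∨ Touch G D' (φ u) := by
        intro u hu hne
        have := hall u hu hne
        rwa [← hDD, touch_union_left] at this
      have htwD' : Touch G D' (φ w) := (htall w hw hww).resolve_left hnw.1
      -- If `D'` serves all neighbours other than `w₁`, then `D'` stays at `v`, `D` subdivides the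
      -- edge and `C₁` moves to `w₁`. Otherwise, the degree bound lets `D` serve everything except
      -- `w` and `w₁`; then `C₁` is contracted into `w₁` and `D'` into `w`.
      by_cases hall' : ∀ u, H.Adj v u → u ≠ w₁ → Touch G D' (φ u)
      · obtain ⟨ψ, hψ, hψv, hψw, hge, hψX⟩ := h.subdivide hw₁ hD' hD
          ((h.conn w₁).union_touch hC₁ htw₁.symm) (hD1'.trans hC₂v) (hD1.trans hC₂v) hC₁v
          hdD.symm (hdisj.mono_right hD1').symm (hdisj.mono_right hD1).symm hall' htDD.symm
          (htD.symm.mono subset_rfl Set.subset_union_right)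
        refine Or.inr ⟨ψ, D, v, w₁, hψ, hψX, (hD1.trans hC₂v).trans (hsub v), ?_, hDS, ?_⟩
        · rw [hψv]; exact hDS'
        · rw [hψw]; exact hCS.mono (Set.inter_subset_inter_left _ Set.subset_union_right)
      · push Not at hall'
        obtain ⟨u₀, hu₀, hne₀, hn₀⟩ := hall'
        have hu₀w : u₀ ≠ w := fun h' => hn₀ (h' ▸ htwD')
        have hallD : ∀ u, H.Adj v u → u ≠ w₁ → u ≠ w → Touch G D (φ u) := by
          intro u hu h1 h2
          by_cases hu0 : u = u₀
          · subst hu0; exact (htall u hu h1).resolve_right hn₀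
          · rcases hH v w₁ w u₀ u hw₁ hw hu₀ hu with h' | h' | h' | h' | h' | h'
            · exact absurd h'.symm hww
            · exact absurd h'.symm hne₀
            · exact absurd h'.symm h1
            · exact absurd h'.symm hu₀w
            · exact absurd h'.symm h2
            · exact absurd h'.symm hu0
        obtain ⟨ψ, hψ, hψv, hψw, hge, hψX⟩ := h.subdivide hw₁ (D' := ∅) hC₂ hC₁
          (by simpa using h.conn w₁) hC₂v hC₁v (Set.empty_subset _) hdisj.symm
          (Set.disjoint_empty _) (Set.disjoint_empty _) hall ht.symm (by simpa using htw₁)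
        obtain ⟨χ, hχ, hχw, hχo⟩ := hψ.merge
        have hχX : ∀ u, χ u ⊆ ⋃ u, φ u := by
          intro x
          by_cases hx : x = w₁
          · subst hx; rw [hχw]; exact Set.union_subset (hψX _) (hC₁v.trans (hsub v))
          · rw [hχo x hx]; exact hψX x
        have hχv : χ v = C₂ := by rw [hχo v hw₁.ne, hψv]
        have hge' : ∀ u, u ≠ v → φ u ⊆ χ u := by
          intro x hx
          by_cases hx' : x = w₁
          · subst hx'; rw [hχw]; exact (hge _ hx).trans Set.subset_union_left
          · rw [hχo x hx']; exact hge x hx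
        obtain ⟨ψ', hψ', hψ'v, hψ'w, hge'', hψ'X⟩ := hχ.subdivide hw (D' := ∅) hD hD'
          (by simpa using hχ.conn w) (hχv ▸ hD1) (hχv ▸ hD1') (Set.empty_subset _) hdD
          (Set.disjoint_empty _) (Set.disjoint_empty _) (by
            intro u hu hne
            by_cases hu1 : u = w₁
            · subst hu1; rw [hχw]; exact htD.symm.mono subset_rfl Set.subset_union_right
            · exact (hallD u hu hu1 hne).mono subset_rfl (hge' u hu.ne')) htDD
          (by simpa using htwD'.mono subset_rfl (hge' w hw.ne'))
        obtain ⟨χ', hχ', hχ'w, hχ'o⟩ := hψ'.merge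
        refine Or.inl ⟨χ', hχ', ?_, v, w, w₁, hw.ne, hw₁.ne, hww, ?_, ?_, ?_⟩
        · intro x
          have hX : ⋃ u, χ u ⊆ ⋃ u, φ u := Set.iUnion_subset hχX
          by_cases hx : x = w
          · subst hx; rw [hχ'w]
            exact Set.union_subset ((hψ'X _).trans hX) ((hD1'.trans hC₂v).trans (hsub v))
          · rw [hχ'o x hx]; exact (hψ'X x).trans hX
        · rw [hχ'o v hw.ne, hψ'v]; exact hDS
        · rw [hχ'w]; exact hDS'.mono (Set.inter_subset_inter_left _ Set.subset_union_right)
        · rw [hχ'o w₁ (Ne.symm hww)]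
          refine hCS.mono (Set.inter_subset_inter_left _ ?_)
          refine Set.Subset.trans ?_ (hge'' w₁ hw₁.ne')
          rw [hχw]; exact Set.subset_union_right
  simp only [Set.mem_iUnion] at ha hb hc
  obtain ⟨u, hu⟩ := ha
  obtain ⟨v, hv⟩ := hb
  obtain ⟨w, hw⟩ := hc
  by_cases huv : u = v
  · subst huv
    by_cases huw : u = w
    · subst huw; exact three u hu hv hw
    · exact two a b c haS hbS hcS hab u w (Ne.symm huw) hu hv hw
  · by_cases huw : u = w
    · subst huw
      exact two a c b haS hcS hbS hac u v (Ne.symm huv) hu hw hv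
    · by_cases hvw : v = w
      · subst hvw
        exact two b c a hbS hcS haS hbc v u huv hv hw hu
      · exact Or.inl ⟨φ, h, hsub, u, v, w, huv, huw, hvw, ⟨a, hu, haS⟩, ⟨b, hv, hbS⟩, ⟨c, hw, hcS⟩⟩

end LadderMinor

/-! ### Cutting a ladder with three attachments into two rooted ladders. -/

namespace LadderMinor

variable {V : Type*} {G : SimpleGraph V}

/-- The ladder with `k` rungs, with rows indexed by `Bool`. -/
def boolLadder (k : ℕ) : SimpleGraph (Bool × Fin k) where
  Adj x y := (x.1 ≠ y.1 ∧ x.2 = y.2) ∨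
    (x.1 = y.1 ∧ ((x.2 : ℕ) + 1 = y.2 ∨ (y.2 : ℕ) + 1 = x.2))
  symm := ⟨fun x y h => by
    rcases h with ⟨h1, h2⟩ | ⟨h1, h2⟩
    · exact Or.inl ⟨h1.symm, h2.symm⟩
    · exact Or.inr ⟨h1.symm, h2.symm⟩⟩
  loopless := ⟨fun x h => by
    rcases h with ⟨h1, h2⟩ | ⟨h1, h2⟩
    · exact h1 rfl
    · omega⟩

theorem boolLadder_adj {k : ℕ} (x y : Bool × Fin k) : (boolLadder k).Adj x y ↔
    (x.1 ≠ y.1 ∧ x.2 = y.2) ∨ (x.1 = y.1 ∧ ((x.2 : ℕ) + 1 = y.2 ∨ (y.2 : ℕ) + 1 = x.2)) :=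
  Iff.rfl

theorem subcubic_boolLadder (k : ℕ) : Subcubic (boolLadder k) := by
  rintro ⟨v, i⟩ ⟨a, ia⟩ ⟨b, ib⟩ ⟨c, ic⟩ ⟨d, id⟩ ha hb hc hd
  simp only [boolLadder_adj, Prod.mk.injEq, Fin.ext_iff] at *
  have e1 : ∀ {x y z : Bool}, x ≠ y → x ≠ z → y = z := by decide
  rcases ha with ⟨ha, ha'⟩ | ⟨ha, ha' | ha'⟩ <;> rcases hb with ⟨hb, hb'⟩ | ⟨hb, hb' | hb'⟩
  · exact Or.inl ⟨e1 ha hb, by omega⟩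
  all_goals rcases hc with ⟨hc, hc'⟩ | ⟨hc, hc' | hc'⟩
  all_goals first
    | exact Or.inl ⟨by rw [← ha, ← hb], by omega⟩
    | exact Or.inr (Or.inl ⟨by rw [← ha, ← hc], by omega⟩)
    | exact Or.inr (Or.inl ⟨e1 ha hc, by omega⟩)
    | exact Or.inr (Or.inr (Or.inr (Or.inl ⟨by rw [← hb, ← hc], by omega⟩)))
    | exact Or.inr (Or.inr (Or.inr (Or.inl ⟨e1 hb hc, by omega⟩)))
    | skip
  all_goals rcases hd with ⟨hd, hd'⟩ | ⟨hd, hd' | hd'⟩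
  all_goals first
    | exact Or.inr (Or.inr (Or.inl ⟨by rw [← ha, ← hd], by omega⟩))
    | exact Or.inr (Or.inr (Or.inl ⟨e1 ha hd, by omega⟩))
    | exact Or.inr (Or.inr (Or.inr (Or.inr (Or.inl ⟨by rw [← hb, ← hd], by omega⟩))))
    | exact Or.inr (Or.inr (Or.inr (Or.inr (Or.inl ⟨e1 hb hd, by omega⟩))))
    | exact Or.inr (Or.inr (Or.inr (Or.inr (Or.inr ⟨by rw [← hc, ← hd], by omega⟩))))
    | exact Or.inr (Or.inr (Or.inr (Or.inr (Or.inr ⟨e1 hc hd, by omega⟩))))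

/-- The family of branch sets indexed by `ℕ` obtained from one indexed by `Fin k`. -/
def extendFin {k : ℕ} (ψ : Bool × Fin k → Set V) (b : Bool) (j : ℕ) : Set V :=
  if h : j < k then ψ (b, ⟨j, h⟩) else ∅

theorem extendFin_of_lt {k : ℕ} (ψ : Bool × Fin k → Set V) (b : Bool) {j : ℕ} (h : j < k) :
    extendFin ψ b j = ψ (b, ⟨j, h⟩) := dif_pos h

theorem extendFin_fin {k : ℕ} (ψ : Bool × Fin k → Set V) (x : Bool × Fin k) :
    extendFin ψ x.1 x.2 = ψ x := extendFin_of_lt ψ x.1 x.2.2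

theorem Lad.setModel {k : ℕ} {f : Bool → ℕ → Set V} (h : Lad G k f) :
    SetModel (boolLadder k) G (fun x => f x.1 x.2) := by
  refine ⟨fun u => h.conn _ _ u.2.2, fun u v huv => h.disj _ _ _ _ u.2.2 v.2.2 ?_, ?_⟩
  · intro heq
    apply huv
    simp only [Prod.mk.injEq] at heq
    exact Prod.ext heq.1 (Fin.ext heq.2)
  · rintro ⟨a, i⟩ ⟨b, j⟩ (⟨h1, h2⟩ | ⟨h1, h2 | h2⟩)
    · simp only at h1 h2
      subst h2
      cases a <;> cases b
      · exact absurd rfl h1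
      · exact (h.rung _ i.2).symm
      · exact h.rung _ i.2
      · exact absurd rfl h1
    · simp only at h1 h2
      subst h1
      have := h.rail a i (by omega)
      simpa only [h2] using this
    · simp only at h1 h2
      subst h1
      have := (h.rail a j (by omega)).symm
      simpa only [h2] using this

theorem SetModel.lad {k : ℕ} {ψ : Bool × Fin k → Set V} (h : SetModel (boolLadder k) G ψ) :
    Lad G k (extendFin ψ) := by
  refine ⟨fun b j hj => ?_, fun b j b' j' hj hj' hne => ?_, fun j hj => ?_, fun b j hj => ?_⟩
  · rw [extendFin_of_lt ψ b hj]
    exact h.conn _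
  · rw [extendFin_of_lt ψ b hj, extendFin_of_lt ψ b' hj']
    refine h.disj _ _ fun heq => hne ?_
    simp only [Prod.mk.injEq, Fin.mk.injEq] at heq ⊢
    exact heq
  · rw [extendFin_of_lt ψ _ hj, extendFin_of_lt ψ _ hj]
    exact h.edge _ _ (Or.inl ⟨by simp, rfl⟩)
  · rw [extendFin_of_lt ψ _ hj, extendFin_of_lt ψ b (show j < k by omega)]
    exact h.edge _ _ (Or.inr ⟨rfl, Or.inl rfl⟩)

/-- Cutting a ladder after the column of one of two given vertices. -/
theorem Lad.rooted_of_le {k c d : ℕ} {f : Bool → ℕ → Set V} {X : Set V} (h : Lad G k f)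
    (hX : ∀ b j, j < k → f b j ⊆ X) {b b' : Bool} (hcd : c ≤ d) (hd : d < k)
    (hne : (b, c) ≠ (b', d)) {t t' : V} (ht : Touch G (f b c) {t}) (ht' : Touch G (f b' d) {t'}) :
    RootedLad G (c + 1) X t t' := by
  wlog hb : b = true generalizing f b b'
  · refine this h.flip (fun b j hj => hX _ j hj) (b := !b) (b' := !b') ?_ (by simpa using ht)
      (by simpa using ht') (by simpa using hb)
    intro heq
    apply hne
    simpa using heq
  subst hb
  -- The first root is met in row `true` at column `c`. The other vertex of that column is extended
  -- along row `false` to column `d`, and across its rung if needed, until it touches the second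
  -- root.
  let R : Set V := (⋃ l ∈ Set.Icc c d, f false l) ∪ f b' d
  have hsub : ∀ l, c ≤ l → l ≤ d → f false l ⊆ R := fun l h1 h2 =>
    (Set.subset_biUnion_of_mem (u := f false) (show l ∈ Set.Icc c d from ⟨h1, h2⟩)).trans
      Set.subset_union_left
  have hR : Conn G R := by
    have h1 := conn_iUnion_Icc (G := G) (f false) hcd (fun i _ hi => h.conn _ _ (by omega))
      (fun i _ hi => h.rail _ _ (by omega))
    have h2 : f false d ⊆ ⋃ l ∈ Set.Icc c d, f false l :=
      Set.subset_biUnion_of_mem (u := f false) (show d ∈ Set.Icc c d from ⟨hcd, le_rfl⟩)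
    cases b'
    · have : R = ⋃ l ∈ Set.Icc c d, f false l := Set.union_eq_self_of_subset_right h2
      rwa [this]
    · exact h1.union_touch (h.conn _ _ hd) ((h.rung d hd).symm.mono h2 subset_rfl)
  have hdR : ∀ b j, j ≤ c → (b, j) ≠ (false, c) → Disjoint (f b j) R := by
    intro b j hj hbj
    rw [Set.disjoint_union_right]
    simp only [Set.disjoint_iUnion_right, Set.mem_Icc]
    refine ⟨fun l hl => h.disj _ _ _ _ (by omega) (by omega) ?_,
      h.disj _ _ _ _ (by omega) (by omega) ?_⟩
    · intro heq
      simp only [Prod.mk.injEq] at heq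
      exact hbj (by rw [heq.1, show j = c by omega])
    · intro heq
      simp only [Prod.mk.injEq] at heq
      cases b'
      · exact hbj (by rw [heq.1, show j = c by omega])
      · apply hne
        rw [show c = d by omega]
  let g : Bool → ℕ → Set V := fun b j => if b = false ∧ j = c then R else f b j
  have hgR : g false c = R := by simp [g]
  have hgt : ∀ j, g true j = f true j := fun j => by simp [g]
  have hgf : ∀ b j, (b, j) ≠ (false, c) → g b j = f b j := by
    intro b j hj
    have : ¬ (b = false ∧ j = c) := by simpa using hj
    simp only [g, if_neg this]
  have hge : ∀ b j, f b j ⊆ g b j := by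
    intro b j
    by_cases hj : (b, j) = (false, c)
    · obtain ⟨rfl, rfl⟩ := Prod.mk.inj hj
      rw [hgR]
      exact hsub _ le_rfl hcd
    · rw [hgf b j hj]
  refine ⟨by omega, g, ⟨?_, ?_, ?_, ?_⟩, ?_, ?_, ?_⟩
  · intro b j hj
    by_cases hj' : (b, j) = (false, c)
    · obtain ⟨rfl, rfl⟩ := Prod.mk.inj hj'
      rwa [hgR]
    · rw [hgf b j hj']; exact h.conn _ _ (by omega)
  · intro b j b' j' hj hj' hne'
    by_cases h1 : (b, j) = (false, c)
    · have h2 : (b', j') ≠ (false, c) := fun h2 => hne' (h1.trans h2.symm)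
      obtain ⟨rfl, rfl⟩ := Prod.mk.inj h1
      rw [hgR, hgf _ _ h2]
      exact (hdR _ _ (by omega) h2).symm
    · by_cases h2 : (b', j') = (false, c)
      · obtain ⟨rfl, rfl⟩ := Prod.mk.inj h2
        rw [hgR, hgf _ _ h1]
        exact hdR _ _ (by omega) h1
      · rw [hgf _ _ h1, hgf _ _ h2]
        exact h.disj _ _ _ _ (by omega) (by omega) hne'
  · intro j hj
    exact (h.rung j (by omega)).mono (hge _ _) (hge _ _)
  · intro b j hj
    exact (h.rail b j (by omega)).mono (hge _ _) (hge _ _)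
  · intro b j hj
    by_cases hj' : (b, j) = (false, c)
    · obtain ⟨rfl, rfl⟩ := Prod.mk.inj hj'
      rw [hgR]
      refine Set.union_subset ?_ (hX _ _ hd)
      simp only [Set.iUnion_subset_iff, Set.mem_Icc]
      exact fun l hl => hX _ _ (by omega)
    · rw [hgf b j hj']; exact hX _ _ (by omega)
  · simpa [hgt] using ht
  · simp only [Nat.add_sub_cancel, hgR]
    exact ht'.mono Set.subset_union_right subset_rfl

theorem Lad.rooted_of_ge {k c d : ℕ} {f : Bool → ℕ → Set V} {X : Set V} (h : Lad G k f)
    (hX : ∀ b j, j < k → f b j ⊆ X) {b b' : Bool} (hcd : d ≤ c) (hc : c < k)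
    (hne : (b, c) ≠ (b', d)) {t t' : V} (ht : Touch G (f b c) {t}) (ht' : Touch G (f b' d) {t'}) :
    RootedLad G (k - c) X t t' := by
  have := h.reflect.rooted_of_le (X := X) (c := k - 1 - c) (d := k - 1 - d)
    (fun b j hj => hX b _ (by omega)) (b := b) (b' := b') (by omega) (by omega)
    (by
      intro heq
      apply hne
      simp only [Prod.mk.injEq] at heq ⊢
      exact ⟨heq.1, by omega⟩) (t := t) (t' := t')
    (by simpa only [show k - 1 - (k - 1 - c) = c by omega] using ht)
    (by simpa only [show k - 1 - (k - 1 - d) = d by omega] using ht')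
  rwa [show k - 1 - c + 1 = k - c by omega] at this

/-- Two rooted ladders in `X`, sharing the root `t₂`, with more than `k` rungs in total. -/
def RootedPair (G : SimpleGraph V) (k : ℕ) (X : Set V) (t₁ t₂ t₃ : V) : Prop :=
  ∃ r s, k + 1 ≤ r + s ∧ RootedLad G r X t₁ t₂ ∧ RootedLad G s X t₂ t₃

/-- Order the attachments by column and let `c` be the middle column, counted from `0`. The columns
from `c` on give `k - c` rungs rooted at the first two, and the columns up to `c` give `c + 1` rungs
rooted at the last two; column `c` is used twice. -/
theorem Lad.rootedPair {k : ℕ} {f : Bool → ℕ → Set V} {X : Set V} (h : Lad G k f)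
    (hX : ∀ b j, j < k → f b j ⊆ X) {p : Fin 3 → Bool × ℕ} (hp : ∀ i, (p i).2 < k)
    (hinj : Function.Injective p) {t : Fin 3 → V}
    (ht : ∀ i, Touch G (f (p i).1 (p i).2) {t i}) :
    ∃ i j l : Fin 3, i ≠ j ∧ i ≠ l ∧ j ≠ l ∧ RootedPair G k X (t i) (t j) (t l) := by
  have key : ∀ i j l : Fin 3, i ≠ j → i ≠ l → j ≠ l → (p i).2 ≤ (p j).2 → (p j).2 ≤ (p l).2 →
      ∃ i j l : Fin 3, i ≠ j ∧ i ≠ l ∧ j ≠ l ∧ RootedPair G k X (t i) (t j) (t l) := by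
    intro i j l hij hil hjl h1 h2
    refine ⟨i, j, l, hij, hil, hjl, k - (p j).2, (p j).2 + 1, by have := hp j; omega, ?_, ?_⟩
    · exact (h.rooted_of_ge hX h1 (hp j) (fun heq => hij (hinj heq.symm)) (ht j) (ht i)).symm
    · exact h.rooted_of_le hX h2 (hp l) (fun heq => hjl (hinj heq)) (ht j) (ht l)
  rcases le_total (p 0).2 (p 1).2 with h1 | h1 <;> rcases le_total (p 0).2 (p 2).2 with h2 | h2 <;>
    rcases le_total (p 1).2 (p 2).2 with h3 | h3
  · exact key 0 1 2 (by decide) (by decide) (by decide) h1 h3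
  · exact key 0 2 1 (by decide) (by decide) (by decide) h2 h3
  · exact key 2 0 1 (by decide) (by decide) (by decide) h2 h1
  · exact key 2 0 1 (by decide) (by decide) (by decide) h2 h1
  · exact key 1 0 2 (by decide) (by decide) (by decide) h1 h2
  · exact key 1 0 2 (by decide) (by decide) (by decide) h1 h2
  · exact key 1 2 0 (by decide) (by decide) (by decide) h3 h2
  · exact key 2 1 0 (by decide) (by decide) (by decide) h3 h1

/-- A ladder model in which the rail edge from column `c` to column `c + 1` in row `b` is
subdivided by a vertex with branch set `E`. -/
structure SubdivLad (G : SimpleGraph V) (k : ℕ) (f : Bool → ℕ → Set V) (E : Set V) (b : Bool)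
    (c : ℕ) : Prop where
  lt : c + 1 < k
  conn : ∀ b j, j < k → Conn G (f b j)
  disj : ∀ b j b' j', j < k → j' < k → (b, j) ≠ (b', j') → Disjoint (f b j) (f b' j')
  rung : ∀ j, j < k → Touch G (f true j) (f false j)
  rail : ∀ b' j, j + 1 < k → (b', j) ≠ (b, c) → Touch G (f b' j) (f b' (j + 1))
  connE : Conn G E
  disjE : ∀ b j, j < k → Disjoint E (f b j)
  left : Touch G (f b c) E
  right : Touch G E (f b (c + 1))

theorem SubdivLad.flip {k c : ℕ} {f : Bool → ℕ → Set V} {E : Set V} {b : Bool}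
    (h : SubdivLad G k f E b c) : SubdivLad G k (fun b j => f (!b) j) E (!b) c := by
  refine ⟨h.lt, fun b j hj => h.conn _ _ hj, fun b j b' j' hj hj' hne =>
    h.disj _ _ _ _ hj hj' ?_, fun j hj => (h.rung _ hj).symm, fun b j hj hne => h.rail _ _ hj ?_,
    h.connE, fun b j hj => h.disjE _ _ hj, by simpa using h.left, by simpa using h.right⟩
  · intro heq
    apply hne
    simpa using heq
  · intro heq
    apply hne
    simp only [Prod.mk.injEq] at heq ⊢
    exact ⟨by rw [← heq.1, Bool.not_not], heq.2⟩

theorem SubdivLad.reflect {k c : ℕ} {f : Bool → ℕ → Set V} {E : Set V} {b : Bool}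
    (h : SubdivLad G k f E b c) :
    SubdivLad G k (fun b j => f b (k - 1 - j)) E b (k - 2 - c) := by
  have hlt := h.lt
  refine ⟨by omega, fun b j hj => h.conn b _ (by omega), fun b j b' j' hj hj' hne =>
    h.disj _ _ _ _ (by omega) (by omega) ?_, fun j hj => h.rung _ (by omega),
    fun b j hj hne => ?_, h.connE, fun b j hj => h.disjE _ _ (by omega), ?_, ?_⟩
  · intro heq
    apply hne
    simp only [Prod.mk.injEq] at heq ⊢
    exact ⟨heq.1, by omega⟩
  · have := (h.rail b (k - 1 - (j + 1)) (by omega) (by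
      intro heq
      apply hne
      simp only [Prod.mk.injEq] at heq ⊢
      exact ⟨heq.1, by omega⟩)).symm
    rwa [show k - 1 - (j + 1) + 1 = k - 1 - j by omega] at this
  · simpa only [show k - 1 - (k - 2 - c) = c + 1 by omega] using h.right.symm
  · simpa only [show k - 1 - (k - 2 - c + 1) = c by omega] using h.left.symm

/-- The columns up to `c` are followed by a new last column: `E` continues row `b`, and the whole of
column `c + 1`, contracted to one vertex, continues the other row. The second half of the subdivided
rail edge becomes the new rung. -/
theorem SubdivLad.rooted {k c : ℕ} {f : Bool → ℕ → Set V} {E X : Set V} {b : Bool}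
    (h : SubdivLad G k f E b c) (hX : ∀ b j, j < k → f b j ⊆ X) (hEX : E ⊆ X) {t t' : V}
    (ht : Touch G E {t}) (ht' : Touch G (f b (c + 1)) {t'}) : RootedLad G (c + 2) X t t' := by
  wlog hb : b = true generalizing f b
  · exact this h.flip (fun b j hj => hX _ _ hj) (by simpa using ht') (by simpa using hb)
  subst hb
  have hlt := h.lt
  let g : Bool → ℕ → Set V := fun b j =>
    if j = c + 1 then (if b then E else f false (c + 1) ∪ f true (c + 1)) else f b j
  have hgt : g true (c + 1) = E := by simp [g]
  have hgf : g false (c + 1) = f false (c + 1) ∪ f true (c + 1) := by simp [g]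
  have hgo : ∀ b j, j ≤ c → g b j = f b j := fun b j hj => by
    simp [g, show j ≠ c + 1 by omega]
  have hgX : ∀ b, g b (c + 1) ⊆ X := by
    intro b
    cases b
    · rw [hgf]; exact Set.union_subset (hX _ _ hlt) (hX _ _ hlt)
    · rwa [hgt]
  have hdl : ∀ b b' j, j ≤ c → Disjoint (f b j) (g b' (c + 1)) := by
    intro b b' j hj
    cases b'
    · rw [hgf, Set.disjoint_union_right]
      constructor
      · refine h.disj _ _ _ _ (by omega) hlt fun heq => ?_
        simp only [Prod.mk.injEq] at heq
        omega
      · refine h.disj _ _ _ _ (by omega) hlt fun heq => ?_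
        simp only [Prod.mk.injEq] at heq
        omega
    · rw [hgt]; exact (h.disjE _ _ (by omega)).symm
  have hdd : Disjoint (g true (c + 1)) (g false (c + 1)) := by
    rw [hgt, hgf, Set.disjoint_union_right]
    exact ⟨h.disjE _ _ hlt, h.disjE _ _ hlt⟩
  refine ⟨by omega, g, ⟨?_, ?_, ?_, ?_⟩, ?_, ?_, ?_⟩
  · intro b j hj
    by_cases hj' : j ≤ c
    · rw [hgo b j hj']; exact h.conn _ _ (by omega)
    · have : j = c + 1 := by omega
      subst this
      cases b
      · rw [hgf]; exact (h.conn _ _ hlt).union_touch (h.conn _ _ hlt) (h.rung _ hlt).symm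
      · rw [hgt]; exact h.connE
  · intro b j b' j' hj hj' hne
    by_cases h1 : j ≤ c
    · rw [hgo b j h1]
      by_cases h2 : j' ≤ c
      · rw [hgo b' j' h2]
        exact h.disj _ _ _ _ (by omega) (by omega) hne
      · have : j' = c + 1 := by omega
        subst this
        exact hdl _ _ _ h1
    · have : j = c + 1 := by omega
      subst this
      by_cases h2 : j' ≤ c
      · rw [hgo b' j' h2]
        exact (hdl _ _ _ h2).symm
      · have : j' = c + 1 := by omega
        subst this
        cases b <;> cases b'
        · exact absurd rfl hne
        · exact hdd.symm
        · exact hdd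
        · exact absurd rfl hne
  · intro j hj
    by_cases h1 : j ≤ c
    · rw [hgo _ j h1, hgo _ j h1]; exact h.rung j (by omega)
    · have : j = c + 1 := by omega
      subst this
      rw [hgt, hgf]
      exact h.right.mono subset_rfl Set.subset_union_right
  · intro b j hj
    rw [hgo b j (by omega)]
    by_cases h1 : j + 1 ≤ c
    · rw [hgo _ _ h1]
      refine h.rail _ _ (by omega) fun heq => ?_
      simp only [Prod.mk.injEq] at heq
      omega
    · have : j = c := by omega
      subst this
      cases b
      · rw [hgf]
        exact (h.rail _ _ (by omega) (by simp)).mono subset_rfl Set.subset_union_left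
      · rw [hgt]; exact h.left
  · intro b j hj
    by_cases hj' : j ≤ c
    · rw [hgo b j hj']; exact hX _ _ (by omega)
    · have : j = c + 1 := by omega
      subst this
      exact hgX b
  · simpa only [show c + 2 - 1 = c + 1 by omega, hgt] using ht
  · simp only [show c + 2 - 1 = c + 1 by omega, hgf]
    exact ht'.mono Set.subset_union_right subset_rfl

/-- For a subdivided rung the middle set `E` is contracted into either end, one choice for each of
the two ladders, which share that column. For a subdivided rail edge the ladder is cut from both
sides at `E`, giving `k + 2` rungs altogether. -/
theorem SubdivModel.rootedPair {k : ℕ} {ψ : Bool × Fin k → Set V} {E X : Set V}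
    {v w : Bool × Fin k} (h : SubdivModel (boolLadder k) G ψ E v w) (hX : ∀ u, ψ u ⊆ X)
    (hEX : E ⊆ X) {t₁ t₂ t₃ : V} (h1 : Touch G (ψ v) {t₁}) (h2 : Touch G E {t₂})
    (h3 : Touch G (ψ w) {t₃}) : RootedPair G k X t₁ t₂ t₃ := by
  have hsymm : RootedPair G k X t₃ t₂ t₁ → RootedPair G k X t₁ t₂ t₃ := by
    rintro ⟨r, s, hrs, hr, hs⟩
    exact ⟨s, r, by omega, hs.symm, hr.symm⟩
  have rail : ∀ {v w : Bool × Fin k} {t₁ t₃ : V}, SubdivModel (boolLadder k) G ψ E v w →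
      v.1 = w.1 → (v.2 : ℕ) + 1 = w.2 → Touch G (ψ v) {t₁} → Touch G (ψ w) {t₃} →
      RootedPair G k X t₁ t₂ t₃ := by
    intro v w t₁ t₃ h hb hc h1 h3
    obtain ⟨b, c⟩ := v
    obtain ⟨b', c'⟩ := w
    simp only at hb hc
    subst hb
    have hlt : (c : ℕ) + 1 < k := by omega
    have hc' : c' = ⟨c + 1, hlt⟩ := Fin.ext hc.symm
    subst hc'
    have hS : SubdivLad G k (extendFin ψ) E b c := by
      refine ⟨hlt, ?_, ?_, ?_, ?_, h.connE, ?_, ?_, ?_⟩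
      · intro b j hj
        rw [extendFin_of_lt ψ b hj]; exact h.conn _
      · intro b j b' j' hj hj' hne
        rw [extendFin_of_lt ψ b hj, extendFin_of_lt ψ b' hj']
        refine h.disj _ _ fun heq => hne ?_
        simp only [Prod.mk.injEq, Fin.mk.injEq] at heq ⊢
        exact heq
      · intro j hj
        rw [extendFin_of_lt ψ _ hj, extendFin_of_lt ψ _ hj]
        refine h.edge _ _ (Or.inl ⟨by simp, rfl⟩) fun heq => ?_
        simp only [Sym2.eq_iff, Prod.mk.injEq] at heq
        rcases heq with ⟨⟨e1, -⟩, e2, -⟩ | ⟨⟨e1, -⟩, e2, -⟩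
        · exact absurd (e1.trans e2.symm) (by simp)
        · exact absurd (e1.trans e2.symm) (by simp)
      · intro b' j hj hne
        rw [extendFin_of_lt ψ _ hj, extendFin_of_lt ψ b' (show j < k by omega)]
        refine h.edge _ _ (Or.inr ⟨rfl, Or.inl rfl⟩) fun heq => hne ?_
        simp only [Sym2.eq_iff, Prod.mk.injEq, Fin.ext_iff] at heq
        rcases heq with ⟨⟨e1, e2⟩, -, -⟩ | ⟨⟨-, e2⟩, -, e4⟩
        · rw [e1, e2]
        · omega
      · intro b j hj
        rw [extendFin_of_lt ψ b hj]; exact h.disjE _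
      · rw [extendFin_fin ψ (b, c)]; exact h.left
      · rw [extendFin_of_lt ψ b hlt]; exact h.right
    have hXe : ∀ b j, j < k → extendFin ψ b j ⊆ X := by
      intro b j hj
      rw [extendFin_of_lt ψ b hj]; exact hX _
    have r1 := hS.rooted hXe hEX h2 (by rw [extendFin_of_lt ψ b hlt]; exact h3)
    have r2 := hS.reflect.rooted (X := X) (fun b j hj => hXe b _ (by omega)) hEX (t' := t₁) h2 (by
      rw [show k - 1 - (k - 2 - c + 1) = c by omega, extendFin_fin ψ (b, c)]
      exact h1)
    exact ⟨_, _, by omega, r2.symm, r1⟩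
  rcases h.adj with ⟨hb, hc⟩ | ⟨hb, hc | hc⟩
  -- The two rooted ladders need not be disjoint, since only one of them is used in each set later
  -- on; so they may come from two different contractions.
  · obtain ⟨φ₁, hφ₁, hw₁, ho₁⟩ := h.merge
    obtain ⟨φ₂, hφ₂, hw₂, ho₂⟩ := h.symm.merge
    have hX₁ : ∀ b j, j < k → extendFin φ₁ b j ⊆ X := by
      intro b j hj
      rw [extendFin_of_lt φ₁ b hj]
      by_cases hu : (b, ⟨j, hj⟩) = w
      · rw [hu, hw₁]; exact Set.union_subset (hX _) hEX
      · rw [ho₁ _ hu]; exact hX _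
    have hX₂ : ∀ b j, j < k → extendFin φ₂ b j ⊆ X := by
      intro b j hj
      rw [extendFin_of_lt φ₂ b hj]
      by_cases hu : (b, ⟨j, hj⟩) = v
      · rw [hu, hw₂]; exact Set.union_subset (hX _) hEX
      · rw [ho₂ _ hu]; exact hX _
    have hvw := h.adj.ne
    have r1 := hφ₁.lad.rooted_of_ge hX₁ (b := v.1) (b' := w.1) (c := v.2) (d := w.2)
      (by rw [hc]) v.2.2 (fun heq => hb (Prod.mk.inj heq).1) (t := t₁) (t' := t₂)
      (by rw [extendFin_fin φ₁ v, ho₁ v hvw]; exact h1)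
      (by rw [extendFin_fin φ₁ w, hw₁]; exact h2.mono Set.subset_union_right subset_rfl)
    have r2 := hφ₂.lad.rooted_of_le hX₂ (b := v.1) (b' := w.1) (c := v.2) (d := w.2)
      (by rw [hc]) w.2.2 (fun heq => hb (Prod.mk.inj heq).1) (t := t₂) (t' := t₃)
      (by rw [extendFin_fin φ₂ v, hw₂]; exact h2.mono Set.subset_union_right subset_rfl)
      (by rw [extendFin_fin φ₂ w, ho₂ w hvw.symm]; exact h3)
    exact ⟨_, _, by have := v.2.2; omega, r1, r2⟩
  · exact rail h hb hc h1 h3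
  · exact hsymm (rail h.symm hb.symm hc h3 h1)

end LadderMinor

/-! ### Rooted pairs in 3-connected graphs. -/

namespace LadderMinor

variable {V W : Type*} {G : SimpleGraph V} {H : SimpleGraph W}

/-- A set `F` together with the sets `E i` whose root `a i` lies in `F`. -/
def grow {ι : Type*} (a : ι → V) (E : ι → Set V) (F : Set V) : Set V :=
  F ∪ {x | ∃ i, a i ∈ F ∧ x ∈ E i}

section Grow

variable {ι : Type*} {a : ι → V} {E : ι → Set V} {X Y F F' : Set V}

theorem subset_grow : F ⊆ grow a E F := Set.subset_union_left

theorem grow_subset (hF : F ⊆ X) (hE : ∀ i, E i ⊆ X) : grow a E F ⊆ X := by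
  rintro x (hx | ⟨i, -, hx⟩)
  · exact hF hx
  · exact hE i hx

theorem conn_grow (hF : Conn G F) (hE : ∀ i, Conn G (E i)) (ha : ∀ i, a i ∈ E i) :
    Conn G (grow a E F) := by
  obtain ⟨x, hx⟩ := hF.1
  have h := conn_sUnion (G := G) (x := x) (F := insert F {S | ∃ i, a i ∈ F ∧ S = F ∪ E i}) (by
    rintro S (rfl | ⟨i, hi, rfl⟩)
    · exact ⟨hF, hx⟩
    · exact ⟨hF.union_inter (hE i) ⟨a i, hi, ha i⟩, Or.inl hx⟩) ⟨F, Set.mem_insert _ _⟩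
  convert h using 1
  ext y
  constructor
  · rintro (hy | ⟨i, hi, hy⟩)
    · exact ⟨F, Set.mem_insert _ _, hy⟩
    · exact ⟨F ∪ E i, Or.inr ⟨i, hi, rfl⟩, Or.inr hy⟩
  · rintro ⟨S, rfl | ⟨i, hi, rfl⟩, hy⟩
    · exact Or.inl hy
    · rcases hy with hy | hy
      · exact Or.inl hy
      · exact Or.inr ⟨i, hi, hy⟩

theorem disjoint_grow (hF : F ⊆ Y) (hF' : F' ⊆ Y) (hd : Disjoint F F')
    (hEd : ∀ i j, i ≠ j → Disjoint (E i) (E j)) (hEY : ∀ i, ∀ x ∈ E i, x ∈ Y → x = a i) :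
    Disjoint (grow a E F) (grow a E F') := by
  rw [Set.disjoint_left] at hd ⊢
  rintro x (hx | ⟨i, hi, hx⟩) (hx' | ⟨j, hj, hx'⟩)
  · exact hd hx hx'
  · exact hd hx (hEY j x hx' (hF hx) ▸ hj)
  · exact hd hi (hEY i x hx (hF' hx') ▸ hx')
  · by_cases hij : i = j
    · subst hij; exact hd hi hj
    · exact Set.disjoint_left.1 (hEd i j hij) hx hx'

theorem touch_grow {t : V} {i : ι} (hi : a i ∈ F) (ht : Touch G (E i) {t}) :
    Touch G (grow a E F) {t} :=
  ht.mono (fun _ hx => Or.inr ⟨i, hi, hx⟩) subset_rfl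

end Grow

/-- In a 3-connected graph, a vertex set containing a ladder with `k ≥ 2` rungs contains two ladders
rooted at outer neighbours, which share a root and have more than `k` rungs in total. -/
theorem exists_rootedPair [Finite V] {k : ℕ} {X : Set V} (hk : 2 ≤ k) (hG : IsKConnected G 3)
    (h : LadIn G k X) (hout : 3 ≤ Xᶜ.ncard) :
    ∃ t₁ t₂ t₃, t₁ ≠ t₂ ∧ t₁ ≠ t₃ ∧ t₂ ≠ t₃ ∧
      (∀ t ∈ ({t₁, t₂, t₃} : Set V), t ∉ X ∧ ∃ x ∈ X, G.Adj x t) ∧ RootedPair G k X t₁ t₂ t₃ := by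
  obtain ⟨f, hf, hfX⟩ := h
  obtain ⟨φ, hφ, hφX, hcr⟩ := hf.setModel.exists_critical (X := X) (fun u => hfX _ _ u.2.2)
  set Y : Set V := ⋃ u, φ u with hY
  have hYX : Y ⊆ X := Set.iUnion_subset hφX
  have hsub : ∀ u, φ u ⊆ Y := Set.subset_iUnion φ
  have hY3 : 3 ≤ Y.ncard := by
    choose x hx using fun u => (hφ.conn u).1
    have hinj : Function.Injective x := by
      intro u v huv
      by_contra hne
      exact Set.disjoint_left.1 (hφ.disj u v hne) (hx u) (huv ▸ hx v)
    have h1 : (Set.range x).ncard ≤ Y.ncard := Set.ncard_le_ncard (by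
      rintro _ ⟨u, rfl⟩
      exact hsub u (hx u)) (Set.toFinite _)
    rw [← Nat.card_coe_set_eq (Set.range x), Nat.card_range_of_injective hinj] at h1
    simp only [Nat.card_eq_fintype_card, Fintype.card_prod, Fintype.card_bool, Fintype.card_fin] at h1
    omega
  -- A separation of order less than `3` is trivial, so its order is at least the size of `Y` or of
  -- `Xᶜ`; both have at least three elements.
  obtain ⟨D, hD, hDd, hDY, hDX⟩ := menger (n := 3) G Y Xᶜ (by
    intro A B hsep hA hB
    by_contra hlt
    have h1 : (A ∩ B).encard < ((3 : ℕ) : ℕ∞) := by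
      rw [← (Set.toFinite (A ∩ B)).cast_ncard_eq]
      exact_mod_cast not_le.1 hlt
    rcases hG.2 A B hsep h1 with rfl | rfl
    · exact hlt (hout.trans (Set.ncard_le_ncard (by simpa using hB) (Set.toFinite _)))
    · exact hlt (hY3.trans (Set.ncard_le_ncard (by simpa using hA) (Set.toFinite _))))
  have hdisj : Disjoint Y Xᶜ := by
    rw [Set.disjoint_compl_right_iff_subset]
    exact hYX
  -- Each linking set is trimmed to a part `E i` inside `X` that meets the model only in `a i` and
  -- is adjacent to an outer vertex `t i`.
  choose E hED a t hE haE haY hEY hEX htD htX ht using fun i =>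
    exists_link (hD i) (hDY i) (hDX i) hdisj
  have hEd : ∀ i j, i ≠ j → Disjoint (E i) (E j) := fun i j hij =>
    (hDd i j hij).mono (hED i) (hED j)
  have hEX' : ∀ i, E i ⊆ X := fun i => by
    rw [← Set.disjoint_compl_right_iff_subset]
    exact hEX i
  have htE : ∀ i, Touch G (E i) {t i} := by
    intro i
    obtain ⟨d, hd, hdt⟩ := ht i
    exact ⟨d, hd, t i, rfl, hdt⟩
  have hainj : ∀ i j, i ≠ j → a i ≠ a j := fun i j hij heq =>
    Set.disjoint_left.1 (hEd i j hij) (haE i) (heq ▸ haE j)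
  have htinj : ∀ i j, i ≠ j → t i ≠ t j := fun i j hij heq =>
    Set.disjoint_left.1 (hDd i j hij) (htD i) (heq ▸ htD j)
  have concl : ∀ i j l : Fin 3, i ≠ j → i ≠ l → j ≠ l → RootedPair G k X (t i) (t j) (t l) →
      ∃ t₁ t₂ t₃, t₁ ≠ t₂ ∧ t₁ ≠ t₃ ∧ t₂ ≠ t₃ ∧
      (∀ t ∈ ({t₁, t₂, t₃} : Set V), t ∉ X ∧ ∃ x ∈ X, G.Adj x t) ∧
      RootedPair G k X t₁ t₂ t₃ := by
    intro i j l hij hil hjl hR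
    refine ⟨t i, t j, t l, htinj _ _ hij, htinj _ _ hil, htinj _ _ hjl, ?_, hR⟩
    have : ∀ i, t i ∉ X ∧ ∃ x ∈ X, G.Adj x (t i) := fun i => by
      obtain ⟨d, hd, hdt⟩ := ht i
      exact ⟨htX i, d, hEX' i hd, hdt⟩
    rintro x (rfl | rfl | rfl) <;> exact this _
  -- The rearranged model stays inside `Y`, so the sets `E i` still meet it only in `a i` and can be
  -- added to the branch sets containing these vertices. The branch sets then touch the roots `t i`.
  have hsp := hcr.spread hφ (subcubic_boolLadder k) (S := Set.range a) ⟨0, rfl⟩ ⟨1, rfl⟩ ⟨2, rfl⟩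
    (hainj 0 1 (by decide)) (hainj 0 2 (by decide)) (hainj 1 2 (by decide)) (haY 0) (haY 1) (haY 2)
  rcases hsp with ⟨ψ, hψ, hψX, u₁, u₂, u₃, h12, h13, h23, ⟨_, e1, i₁, rfl⟩, ⟨_, e2, i₂, rfl⟩,
    ⟨_, e3, i₃, rfl⟩⟩ | ⟨ψ, F, v, w, hψ, hψX, hFX, ⟨_, e1, i₁, rfl⟩, ⟨_, e2, i₂, rfl⟩,
    ⟨_, e3, i₃, rfl⟩⟩
  · have hmodel : SetModel (boolLadder k) G (fun u => grow a E (ψ u)) :=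
      ⟨fun u => conn_grow (hψ.conn u) hE haE,
        fun u v huv => disjoint_grow (hψX u) (hψX v) (hψ.disj u v huv) hEd hEY,
        fun u v huv => (hψ.edge u v huv).mono subset_grow subset_grow⟩
    have hd : ∀ {u v i j}, u ≠ v → a i ∈ ψ u → a j ∈ ψ v → i ≠ j := by
      intro u v i j huv hi hj hij
      subst hij
      exact Set.disjoint_left.1 (hψ.disj u v huv) hi hj
    obtain ⟨i, j, l, hij, hil, hjl, hR⟩ := hmodel.lad.rootedPair (X := X) (by
        intro b j hj
        rw [extendFin_of_lt _ b hj]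
        exact grow_subset ((hψX _).trans hYX) hEX')
      (p := fun i => ((![u₁, u₂, u₃] i).1, ((![u₁, u₂, u₃] i).2 : ℕ)))
      (fun i => (![u₁, u₂, u₃] i).2.2) (by
        have hinj : Function.Injective ![u₁, u₂, u₃] := by
          intro i j
          fin_cases i <;> fin_cases j <;> simp [h12, h13, h23, h12.symm, h13.symm, h23.symm]
        intro i j hij
        apply hinj
        simp only [Prod.mk.injEq] at hij
        exact Prod.ext hij.1 (Fin.ext hij.2)) (t := fun i => t (![i₁, i₂, i₃] i)) (by
        intro i
        rw [extendFin_fin]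
        fin_cases i
        · exact touch_grow e1 (htE i₁)
        · exact touch_grow e2 (htE i₂)
        · exact touch_grow e3 (htE i₃))
    have hinj : Function.Injective ![i₁, i₂, i₃] := by
      have h1 := hd h12 e1 e2
      have h2 := hd h13 e1 e3
      have h3 := hd h23 e2 e3
      intro i j
      fin_cases i <;> fin_cases j <;> simp [h1, h2, h3, h1.symm, h2.symm, h3.symm]
    exact concl _ _ _ (hinj.ne hij) (hinj.ne hil) (hinj.ne hjl) hR
  · have hmodel : SubdivModel (boolLadder k) G (fun u => grow a E (ψ u)) (grow a E F) v w :=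
      ⟨hψ.adj, fun u => conn_grow (hψ.conn u) hE haE, conn_grow hψ.connE hE haE,
        fun u v huv => disjoint_grow (hψX u) (hψX v) (hψ.disj u v huv) hEd hEY,
        fun u => disjoint_grow hFX (hψX u) (hψ.disjE u) hEd hEY,
        fun u v huv hne => (hψ.edge u v huv hne).mono subset_grow subset_grow,
        hψ.left.mono subset_grow subset_grow, hψ.right.mono subset_grow subset_grow⟩
    have hR := hmodel.rootedPair (X := X) (fun u => grow_subset ((hψX _).trans hYX) hEX')
      (grow_subset (hFX.trans hYX) hEX') (touch_grow e1 (htE i₁)) (touch_grow e2 (htE i₂))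
      (touch_grow e3 (htE i₃))
    refine concl _ _ _ ?_ ?_ ?_ hR
    · rintro rfl; exact Set.disjoint_left.1 (hψ.disjE v) e2 e1
    · rintro rfl; exact Set.disjoint_left.1 (hψ.disj v w hψ.adj.ne) e1 e3
    · rintro rfl; exact Set.disjoint_left.1 (hψ.disjE w) e2 e3

/-! ### Translation between minors given by subgraphs and models given by branch sets. -/

theorem Conn.connected_induce {S : Set V} (h : Conn G S) :
    ((⊤ : G.Subgraph).induce S).Connected := by
  rw [← SimpleGraph.connected_induce_iff]
  obtain ⟨x, hx⟩ := h.1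
  have key : ∀ y (hy : y ∈ S), (G.induce S).Reachable ⟨x, hx⟩ ⟨y, hy⟩ := by
    have := h.2 {y | ∃ hy : y ∈ S, (G.induce S).Reachable ⟨x, hx⟩ ⟨y, hy⟩} (fun y hy => hy.1)
      ⟨x, hx, SimpleGraph.Reachable.refl _⟩ (by
        rintro a ⟨ha, hxa⟩ b hb hab
        exact ⟨hb, hxa.trans (SimpleGraph.Adj.reachable (by simpa using hab))⟩)
    intro y hy
    exact (this hy).2
  have : Nonempty S := ⟨⟨x, hx⟩⟩
  exact ⟨fun u v => (key u.1 u.2).symm.trans (key v.1 v.2)⟩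

theorem conn_verts_of_connected {φ : G.Subgraph} (h : φ.Connected) : Conn G φ.verts := by
  rw [SimpleGraph.Subgraph.connected_iff'] at h
  refine ⟨by obtain ⟨x⟩ := h.nonempty; exact ⟨x, x.2⟩, ?_⟩
  rintro A hA ⟨a, ha⟩ hcl b hb
  have := h.preconnected ⟨a, hA ha⟩ ⟨b, hb⟩
  rw [SimpleGraph.reachable_iff_reflTransGen] at this
  have key : ∀ y : φ.verts, Relation.ReflTransGen φ.coe.Adj ⟨a, hA ha⟩ y → (y : V) ∈ A := by
    intro y hy
    induction hy with
    | refl => exact ha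
    | tail _ hbc ih => exact hcl _ ih _ (Subtype.mem _) (φ.adj_sub hbc)
  exact key _ this

theorem isMinor_ladder {k : ℕ} (h : LadIn G k Set.univ) : IsMinor (ladder k) G := by
  obtain ⟨f, hf, -⟩ := h
  let B : Fin 2 → Bool := fun i => i = 0
  have hB : Function.Injective B := by decide
  refine ⟨fun x => (⊤ : G.Subgraph).induce (f (B x.1) x.2), ⟨fun u => ?_, fun u v huv => ?_,
    fun u v huv => ?_⟩⟩
  · exact (hf.conn _ _ u.2.2).connected_induce
  · refine hf.disj _ _ _ _ u.2.2 v.2.2 fun heq => huv ?_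
    simp only [Prod.mk.injEq] at heq
    exact Prod.ext (hB heq.1) (Fin.ext heq.2)
  · have : (boolLadder k).Adj (B u.1, u.2) (B v.1, v.2) := by
      obtain ⟨a, i⟩ := u
      obtain ⟨b, j⟩ := v
      have h1 : |((a : ℕ) : ℤ) - ((b : ℕ) : ℤ)| + |((i : ℕ) : ℤ) - ((j : ℕ) : ℤ)| = 1 := huv
      rw [boolLadder_adj]
      simp only [Fin.ext_iff]
      fin_cases a <;> fin_cases b <;> simp [B] at h1 ⊢ <;> grind
    exact hf.setModel.edge _ _ this

theorem Lad.conn_iUnion {k : ℕ} {f : Bool → ℕ → Set V} (h : Lad G k f) (hk : 1 ≤ k) :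
    Conn G (⋃ i ∈ Set.Icc 0 (k - 1), (f true i ∪ f false i)) :=
  conn_iUnion_Icc (fun i => f true i ∪ f false i) (Nat.zero_le _)
    (fun i _ hi => (h.conn _ _ (by omega)).union_touch (h.conn _ _ (by omega)) (h.rung i (by omega)))
    (fun i _ hi => (h.rail true i (by omega)).mono Set.subset_union_left Set.subset_union_left)

theorem exists_blocks {N k : ℕ} (hk : 1 ≤ k)
    (h : IsMinor (disjointCopies N (ladder k)) G) : ∃ B : Fin N → Set V,
      (∀ i, Conn G (B i)) ∧ (∀ i j, i ≠ j → Disjoint (B i) (B j)) ∧ ∀ i, LadIn G k (B i) := by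
  obtain ⟨φ, hφ⟩ := h
  let R : Bool → Fin 2 := fun b => if b then 0 else 1
  have hR : Function.Injective R := by decide
  let f : Fin N → Bool × Fin k → Set V := fun n x => (φ (n, R x.1, x.2)).verts
  have hf : ∀ n, SetModel (boolLadder k) G (f n) := by
    intro n
    refine ⟨fun u => conn_verts_of_connected (hφ.connected _), fun u v huv => hφ.disjoint ?_,
      fun u v huv => hφ.edge ⟨rfl, ?_⟩⟩
    · intro heq
      apply huv
      simp only [Prod.mk.injEq, true_and] at heq
      exact Prod.ext (hR heq.1) heq.2
    · obtain ⟨a, i⟩ := u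
      obtain ⟨b, j⟩ := v
      show |(((R a : Fin 2) : ℕ) : ℤ) - (((R b : Fin 2) : ℕ) : ℤ)| +
        |((i : ℕ) : ℤ) - ((j : ℕ) : ℤ)| = 1
      rw [boolLadder_adj] at huv
      simp only [Fin.ext_iff] at huv
      cases a <;> cases b <;> simp [R] at huv ⊢ <;> grind
  let g : Fin N → Bool → ℕ → Set V := fun n => extendFin (f n)
  refine ⟨fun n => ⋃ i ∈ Set.Icc 0 (k - 1), (g n true i ∪ g n false i), fun n =>
    (hf n).lad.conn_iUnion hk, fun n m hnm => ?_, fun n => ⟨g n, (hf n).lad, fun b j hj => ?_⟩⟩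
  · simp only [Set.disjoint_iUnion_left, Set.disjoint_iUnion_right, Set.mem_Icc]
    have : ∀ b b' i j, i < k → j < k → Disjoint (g n b i) (g m b' j) := by
      intro b b' i j hi hj
      simp only [g]
      rw [extendFin_of_lt _ _ hi, extendFin_of_lt _ _ hj]
      exact hφ.disjoint fun heq => hnm (Prod.mk.inj heq).1
    intro j hj i hi
    rw [Set.disjoint_union_left, Set.disjoint_union_right, Set.disjoint_union_right]
    refine ⟨⟨?_, ?_⟩, ?_, ?_⟩ <;> exact this _ _ _ _ (by omega) (by omega)
  · refine Set.Subset.trans ?_ (Set.subset_biUnion_of_mem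
      (u := fun i => g n true i ∪ g n false i) (show j ∈ Set.Icc 0 (k - 1) from ⟨by omega, by omega⟩))
    cases b
    · exact Set.subset_union_right
    · exact Set.subset_union_left

end LadderMinor

/-! ### Gluing ladders from sets with few types of attachment. -/

namespace LadderMinor

variable {V : Type*} {G : SimpleGraph V}

theorem RootedLad.ladIn {r : ℕ} {X : Set V} {u v : V} (h : RootedLad G r X u v) : LadIn G r X := by
  obtain ⟨-, f, hf, hfX, -⟩ := h
  exact ⟨f, hf, hfX⟩

theorem LadIn.three_le_ncard [Finite V] {k : ℕ} {X : Set V} (h : LadIn G k X) (hk : 2 ≤ k) :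
    3 ≤ X.ncard := by
  obtain ⟨f, hf, hfX⟩ := h
  obtain ⟨a, ha⟩ := (hf.conn true 0 (by omega)).1
  obtain ⟨b, hb⟩ := (hf.conn false 0 (by omega)).1
  obtain ⟨c, hc⟩ := (hf.conn true 1 (by omega)).1
  have hab : a ≠ b := by
    rintro rfl
    exact Set.disjoint_left.1 (hf.disj _ _ _ _ (by omega) (by omega) (by simp)) ha hb
  have hac : a ≠ c := by
    rintro rfl
    exact Set.disjoint_left.1 (hf.disj _ _ _ _ (by omega) (by omega) (by simp)) ha hc
  have hbc : b ≠ c := by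
    rintro rfl
    exact Set.disjoint_left.1 (hf.disj _ _ _ _ (by omega) (by omega) (by simp)) hb hc
  have h3 : ({a, b, c} : Set V).ncard = 3 := Set.ncard_eq_three.2 ⟨a, b, c, hab, hac, hbc, rfl⟩
  rw [← h3]
  refine Set.ncard_le_ncard ?_ (Set.toFinite _)
  rintro x (rfl | rfl | rfl)
  · exact hfX _ _ (by omega) ha
  · exact hfX _ _ (by omega) hb
  · exact hfX _ _ (by omega) hc

theorem three_le_ncard_compl [Finite V] {k : ℕ} {X Y : Set V} (h : LadIn G k Y) (hk : 2 ≤ k)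
    (hXY : Disjoint X Y) : 3 ≤ Xᶜ.ncard :=
  (h.three_le_ncard hk).trans (Set.ncard_le_ncard (Set.disjoint_left.1 hXY.symm) (Set.toFinite _))

/-- Sufficiently many disjoint sets, each containing a ladder with `k` rungs and having all its
outer neighbours in a bounded set `Z`, give a longer ladder. -/
theorem ladIn_of_isolated [Finite V] {k m t : ℕ} (hk : 2 ≤ k) (hG : IsKConnected G 3) {Z : Set V}
    (hZ : Z.ncard ≤ t) {X : Fin m → Set V} (hX : ∀ i, LadIn G k (X i))
    (hd : ∀ i j, i ≠ j → Disjoint (X i) (X j)) (hXZ : ∀ i, Disjoint (X i) Z)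
    (hN : ∀ i, ∀ u ∈ X i, ∀ v, G.Adj u v → v ∈ X i ∨ v ∈ Z)
    (hm : t * t * t * ((k + 1) * (k + 1)) + 1 < m) : LadIn G (k + 1) Set.univ := by
  by_contra hcon
  -- A longer rooted ladder would already finish the proof. Bounded rung numbers leave finitely many
  -- types.
  have hsmall : ∀ {r i u v}, RootedLad G r (X i) u v → r < k + 1 := by
    intro r i u v h
    by_contra hr
    exact hcon (h.ladIn.mono (by omega) (Set.subset_univ _))
  -- The type of `X i` consists of its three roots, which lie in `Z`, and of the two rung numbers.
  -- There are at most `t ^ 3 * (k + 1) ^ 2` types, fewer than the number of sets.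
  have hex : ∀ i, ∃ c : Z × Z × Z × Fin (k + 1) × Fin (k + 1), c.1 ≠ c.2.1 ∧ c.2.1 ≠ c.2.2.1 ∧
      k + 1 ≤ (c.2.2.2.1 : ℕ) + c.2.2.2.2 ∧ RootedLad G c.2.2.2.1 (X i) c.1 c.2.1 ∧
      RootedLad G c.2.2.2.2 (X i) c.2.1 c.2.2.1 := by
    intro i
    obtain ⟨j, hj⟩ : ∃ j, j ≠ i := by
      have : Nontrivial (Fin m) := Fin.nontrivial_iff_two_le.2 (by omega)
      exact exists_ne i
    obtain ⟨t₁, t₂, t₃, h12, -, h23, ht, r, s, hrs, hr, hs⟩ :=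
      exists_rootedPair hk hG (hX i) (three_le_ncard_compl (hX j) hk (hd i j hj.symm))
    have hZ' : ∀ t ∈ ({t₁, t₂, t₃} : Set V), t ∈ Z := by
      intro t h
      obtain ⟨h1, u, hu, hut⟩ := ht t h
      exact (hN i u hu t hut).resolve_left h1
    exact ⟨(⟨t₁, hZ' _ (by simp)⟩, ⟨t₂, hZ' _ (by simp)⟩, ⟨t₃, hZ' _ (by simp)⟩, ⟨r, hsmall hr⟩,
      ⟨s, hsmall hs⟩), by simpa using h12, by simpa using h23, hrs, hr, hs⟩
  choose c h12 h23 hrs hr hs using hex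
  have hninj : ¬ Function.Injective c := by
    intro hinj
    have h1 := Nat.card_le_card_of_injective c hinj
    simp only [Nat.card_eq_fintype_card, Fintype.card_fin, Fintype.card_prod, Nat.card_prod] at h1
    rw [Nat.card_coe_set_eq] at h1
    have h2 : Z.ncard * (Z.ncard * (Z.ncard * ((k + 1) * (k + 1)))) ≤
        t * (t * (t * ((k + 1) * (k + 1)))) := by gcongr
    have h3 : t * (t * (t * ((k + 1) * (k + 1)))) = t * t * t * ((k + 1) * (k + 1)) := by ring
    omega
  simp only [Function.Injective, not_forall] at hninj
  obtain ⟨i, j, hij, hne⟩ := hninj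
  have same : ∀ {r : ℕ} {u v : V}, u ∈ Z → v ∈ Z → u ≠ v → RootedLad G r (X i) u v →
      RootedLad G r (X j) u v → k + 1 ≤ r + r → False := by
    intro r u v hu hv huv h1 h2 hkr
    have hz : ∀ i, ∀ z ∈ Z, Disjoint (X i) {z} := fun i z hz =>
      (hXZ i).mono_right (by simpa using hz)
    exact hcon ((h1.join h2 (conn_singleton u) (conn_singleton v) rfl rfl rfl rfl (by simpa using huv)
      (hd i j hne) (hz i u hu) (hz i v hv) (hz j u hu) (hz j v hv)).mono hkr subset_rfl)
  have hrj := hr j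
  have hsj := hs j
  rw [← hij] at hrj hsj
  have := hrs i
  by_cases hbig : k + 1 ≤ ((c i).2.2.2.1 : ℕ) + (c i).2.2.2.1
  · exact same (c i).1.2 (c i).2.1.2 (fun h => h12 i (Subtype.ext h)) (hr i) hrj hbig
  · exact same (c i).2.1.2 (c i).2.2.1.2 (fun h => h23 i (Subtype.ext h)) (hs i) hsj (by omega)

/-- A linear arrangement of disjoint connected sets `S 0, ..., S (m - 1)`, each containing a ladder
with `k` rungs. Every outer neighbour of `S g` lies in the hub set `Z` or is one of the two linking
vertices `x g` and `x (g + 1)`. -/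
structure HubPath (G : SimpleGraph V) (k : ℕ) (Z : Set V) (m : ℕ) (x : ℕ → V) (S : ℕ → Set V) :
    Prop where
  inj : ∀ g h, g ≤ m → h ≤ m → x g = x h → g = h
  notMem : ∀ g, g ≤ m → x g ∉ Z
  conn : ∀ g, g < m → Conn G (S g)
  disj : ∀ g h, g < m → h < m → g ≠ h → Disjoint (S g) (S h)
  disjZ : ∀ g, g < m → Disjoint (S g) Z
  notMemS : ∀ g h, g < m → h ≤ m → x h ∉ S g
  nbr : ∀ g, g < m → ∀ u ∈ S g, ∀ v, G.Adj u v → v ∈ S g ∨ v ∈ Z ∨ v = x g ∨ v = x (g + 1)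
  touchL : ∀ g, g < m → Touch G (S g) {x g}
  touchR : ∀ g, g < m → Touch G (S g) {x (g + 1)}
  touchZ : ∀ g, g < m → ∀ z ∈ Z, Touch G (S g) {z}
  lad : ∀ g, g < m → LadIn G k (S g)

namespace HubPath

variable {k m : ℕ} {Z : Set V} {x : ℕ → V} {S : ℕ → Set V}

theorem disj_singleton (h : HubPath G k Z m x S) {g l : ℕ} (hg : g < m) (hl : l ≤ m) :
    Disjoint (S g) {x l} := by
  simpa using h.notMemS g l hg hl

theorem disj_hub (h : HubPath G k Z m x S) {g : ℕ} (hg : g < m) {z : V} (hz : z ∈ Z) :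
    Disjoint (S g) {z} := (h.disjZ g hg).mono_right (by simpa using hz)

/-- A connected set joining the right end of `S i` to the left end of `S j`. -/
theorem exists_rail (h : HubPath G k Z m x S) {i j : ℕ} (hij : i + 1 < j) (hj : j < m) :
    ∃ D, Conn G D ∧ x (i + 1) ∈ D ∧ x j ∈ D ∧ ∀ T : Set V, (∀ l, i < l → l < j → Disjoint T (S l)) →
      (∀ l, i < l → l ≤ j → x l ∉ T) → Disjoint T D := by
  have h1 := conn_iUnion_Icc (G := G) (fun l => S l ∪ {x (l + 1)}) (a := i + 1) (b := j - 1)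
    (by omega) (fun l _ hl => (h.conn l (by omega)).union_touch (conn_singleton _)
      (h.touchR l (by omega)))
    (fun l _ hl => (h.touchL (l + 1) (by omega)).symm.mono Set.subset_union_right
      Set.subset_union_left)
  have h2 : S (i + 1) ∪ {x (i + 1 + 1)} ⊆ ⋃ l ∈ Set.Icc (i + 1) (j - 1), (S l ∪ {x (l + 1)}) :=
    Set.subset_biUnion_of_mem (u := fun l => S l ∪ {x (l + 1)})
      (show i + 1 ∈ Set.Icc (i + 1) (j - 1) from ⟨le_rfl, by omega⟩)
  refine ⟨_, (conn_singleton (x (i + 1))).union_touch h1 ((h.touchL (i + 1) (by omega)).symm.mono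
    subset_rfl (Set.subset_union_left.trans h2)), Or.inl rfl, Or.inr ?_, ?_⟩
  · have h3 : S (j - 1) ∪ {x (j - 1 + 1)} ⊆ ⋃ l ∈ Set.Icc (i + 1) (j - 1), (S l ∪ {x (l + 1)}) :=
      Set.subset_biUnion_of_mem (u := fun l => S l ∪ {x (l + 1)})
        (show j - 1 ∈ Set.Icc (i + 1) (j - 1) from ⟨by omega, le_rfl⟩)
    exact h3 (Or.inr (by rw [show j - 1 + 1 = j by omega]; rfl))
  · intro T hT hT'
    simp only [Set.disjoint_union_right, Set.disjoint_iUnion_right, Set.mem_Icc,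
      Set.disjoint_singleton_right]
    exact ⟨hT' _ (by omega) (by omega), fun l hl => ⟨hT l (by omega) (by omega),
      hT' _ (by omega) (by omega)⟩⟩

/-- A hub is joined to a linking vertex through an adjacent set. -/
theorem conn_hub_link (h : HubPath G k Z m x S) {g l : ℕ} (hg : g < m) {z : V} (hz : z ∈ Z)
    (hl : l = g ∨ l = g + 1) : Conn G (({z} ∪ S g) ∪ {x l}) := by
  refine ((conn_singleton z).union_touch (h.conn g hg) (h.touchZ g hg z hz).symm).union_touch
    (conn_singleton _) (Touch.mono ?_ Set.subset_union_right subset_rfl)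
  rcases hl with rfl | rfl
  · exact h.touchL _ hg
  · exact h.touchR _ hg

/-- The outer neighbour of `S g` of a given type: a hub, the left or the right linking vertex. -/
def root (x : ℕ → V) (g : ℕ) : Z ⊕ Bool → V
  | Sum.inl z => z
  | Sum.inr false => x g
  | Sum.inr true => x (g + 1)

theorem disj_conn_hub_link (h : HubPath G k Z m x S) {i g l : ℕ} (hi : i < m) (hg : g < m)
    (hl : l ≤ m) {z : V} (hz : z ∈ Z) (hig : i ≠ g) : Disjoint (S i) (({z} ∪ S g) ∪ {x l}) := by
  simp only [Set.disjoint_union_right]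
  exact ⟨⟨h.disj_hub hi hz, h.disj _ _ hi hg hig⟩, h.disj_singleton hi hl⟩

theorem hub_notMem (h : HubPath G k Z m x S) {g l : ℕ} (hg : g < m) (hl : l ≤ m) {z w : V}
    (hw : w ∈ Z) (hzw : z ≠ w) : w ∉ ({z} ∪ S g) ∪ {x l} := by
  rintro ((h1 | h1) | h1)
  · exact hzw h1.symm
  · exact Set.disjoint_left.1 (h.disjZ g hg) h1 hw
  · exact h.notMem l hl (h1 ▸ hw)

/-- Two ladders rooted at the same hub and at linking vertices on the same side are joined through
a second hub. -/
theorem join_same_side (h : HubPath G k Z m x S) {i j r : ℕ} (hi : 1 ≤ i) (hij : i + 3 ≤ j)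
    (hj : j + 1 < m) {a b : V} (ha : a ∈ Z) (hb : b ∈ Z) (hab : a ≠ b) (σ : Bool)
    (h1 : RootedLad G r (S i) a (root (Z := Z) x i (Sum.inr σ)))
    (h2 : RootedLad G r (S j) a (root (Z := Z) x j (Sum.inr σ))) (hr : k + 1 ≤ r + r) :
    LadIn G (k + 1) Set.univ := by
  have main : ∀ g g' l l', g < m → g' < m → (l = g ∨ l = g + 1) → (l' = g' ∨ l' = g' + 1) →
      g ≠ i → g ≠ j → g' ≠ i → g' ≠ j → RootedLad G r (S i) a (x l) →
      RootedLad G r (S j) a (x l') → LadIn G (k + 1) Set.univ := by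
    intro g g' l l' hg hg' hl hl' n1 n2 n3 n4 h1 h2
    -- The connector between the two linking vertices runs through the segment `S g`, the hub `b`
    -- and the segment `S g'`; the other connector is the hub `a` alone.
    have hD := (h.conn_hub_link hg hb hl).union_inter (h.conn_hub_link hg' hb hl')
      ⟨b, Or.inl (Or.inl rfl), Or.inl (Or.inl rfl)⟩
    refine (h1.join h2 (conn_singleton a) hD rfl rfl (Or.inl (Or.inr rfl)) (Or.inr (Or.inr rfl))
      ?_ (h.disj _ _ (by omega) (by omega) (by omega)) (h.disj_hub (by omega) ha) ?_
      (h.disj_hub (by omega) ha) ?_).mono hr subset_rfl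
    · rw [Set.disjoint_singleton_left]
      rintro (h3 | h3)
      · exact h.hub_notMem hg (by omega) ha hab.symm h3
      · exact h.hub_notMem hg' (by omega) ha hab.symm h3
    · exact Set.disjoint_union_right.2 ⟨h.disj_conn_hub_link (by omega) hg (by omega) hb n1.symm,
        h.disj_conn_hub_link (by omega) hg' (by omega) hb n3.symm⟩
    · exact Set.disjoint_union_right.2 ⟨h.disj_conn_hub_link (by omega) hg (by omega) hb n2.symm,
        h.disj_conn_hub_link (by omega) hg' (by omega) hb n4.symm⟩
  cases σ
  · exact main (i - 1) (j - 1) i j (by omega) (by omega) (by omega) (by omega) (by omega)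
      (by omega) (by omega) (by omega) h1 h2
  · exact main (i + 1) (j + 1) (i + 1) (j + 1) (by omega) (by omega) (by omega) (by omega)
      (by omega) (by omega) (by omega) (by omega) h1 h2

/-- Joining two ladders along the rail between them, the other roots being the same hub. -/
theorem join_rail (h : HubPath G k Z m x S) {i j r s : ℕ} (hij : i + 3 ≤ j)
    (hj : j + 1 < m) {u v : V} {C : Set V} (hC : Conn G C) (hu : u ∈ C) (hv : v ∈ C)
    (hCS : ∀ l, i ≤ l → l ≤ j → Disjoint C (S l)) (hCx : ∀ l, i < l → l ≤ j → x l ∉ C)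
    (h1 : RootedLad G r (S i) u (x (i + 1))) (h2 : RootedLad G s (S j) v (x j))
    (hrs : k + 1 ≤ r + s) : LadIn G (k + 1) Set.univ := by
  obtain ⟨D, hD, hD1, hD2, hD3⟩ := h.exists_rail (i := i) (j := j) (by omega) (by omega)
  refine (h1.join h2 hC hD hu hv hD1 hD2 (hD3 C (fun l h1 h2 => hCS l h1.le h2.le) hCx)
    (h.disj _ _ (by omega) (by omega) (by omega)) (hCS i le_rfl (by omega)).symm ?_
    (hCS j (by omega) le_rfl).symm ?_).mono hrs subset_rfl
  · exact hD3 _ (fun l h1 h2 => h.disj _ _ (by omega) (by omega) (by omega))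
      (fun l h1 h2 => h.notMemS _ _ (by omega) (by omega))
  · exact hD3 _ (fun l h1 h2 => h.disj _ _ (by omega) (by omega) (by omega))
      (fun l h1 h2 => h.notMemS _ _ (by omega) (by omega))

theorem join_rail_hub (h : HubPath G k Z m x S) {i j r s : ℕ} (hij : i + 3 ≤ j)
    (hj : j + 1 < m) {a : V} (ha : a ∈ Z)
    (h1 : RootedLad G r (S i) a (x (i + 1))) (h2 : RootedLad G s (S j) a (x j))
    (hrs : k + 1 ≤ r + s) : LadIn G (k + 1) Set.univ :=
  h.join_rail hij hj (conn_singleton a) rfl rfl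
    (fun l _ hl => (h.disj_hub (by omega) ha).symm)
    (fun l _ hl hx => h.notMem l (by omega) (by rw [Set.mem_singleton_iff.1 hx]; exact ha)) h1 h2 hrs

/-- The right linking vertex of `S j` is joined to the hub `a` through `S (j + 1)`, which lies
beyond the rail from `S i` to `S j`. -/
theorem join_rail_right (h : HubPath G k Z m x S) {i j r s : ℕ} (hij : i + 3 ≤ j)
    (hj : j + 1 < m) {a : V} (ha : a ∈ Z)
    (h1 : RootedLad G r (S i) a (x (i + 1))) (h2 : RootedLad G s (S j) (x (j + 1)) (x j))
    (hrs : k + 1 ≤ r + s) : LadIn G (k + 1) Set.univ := by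
  refine h.join_rail hij hj (h.conn_hub_link (g := j + 1) (l := j + 1) hj ha (Or.inl rfl))
    (Or.inl (Or.inl rfl)) (Or.inr rfl)
    (fun l _ hl => (h.disj_conn_hub_link (by omega) hj (by omega) ha (by omega)).symm) ?_ h1 h2 hrs
  rintro l _ hl ((hx | hx) | hx)
  · exact h.notMem l (by omega) (by rw [Set.mem_singleton_iff.1 hx]; exact ha)
  · exact h.notMemS _ _ hj (by omega) hx
  · have := h.inj _ _ (by omega) (by omega) hx
    omega

/-- The left linking vertex of `S i` is joined to the hub `a` through `S (i - 1)`, which lies before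
the rail from `S i` to `S j`. -/
theorem join_rail_left (h : HubPath G k Z m x S) {i j r s : ℕ} (hi : 1 ≤ i) (hij : i + 3 ≤ j)
    (hj : j + 1 < m) {a : V} (ha : a ∈ Z)
    (h1 : RootedLad G r (S i) (x i) (x (i + 1))) (h2 : RootedLad G s (S j) a (x j))
    (hrs : k + 1 ≤ r + s) : LadIn G (k + 1) Set.univ := by
  refine h.join_rail hij hj (h.conn_hub_link (g := i - 1) (l := i) (by omega) ha
    (Or.inr (by omega))) (Or.inr rfl) (Or.inl (Or.inl rfl))
    (fun l _ hl => (h.disj_conn_hub_link (by omega) (by omega) (by omega) ha (by omega)).symm) ?_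
    h1 h2 hrs
  rintro l hl' hl ((hx | hx) | hx)
  · exact h.notMem l (by omega) (by rw [Set.mem_singleton_iff.1 hx]; exact ha)
  · exact h.notMemS _ _ (by omega) (by omega) hx
  · have := h.inj _ _ (by omega) (by omega) hx
    omega

/-- Two sets of the same type, far apart, give a longer ladder. -/
theorem ladIn_of_same_type (h : HubPath G k Z m x S) {i j r s : ℕ} (hi : 1 ≤ i) (hij : i + 3 ≤ j)
    (hj : j + 1 < m) (hrs : k + 1 ≤ r + s) {a b c : Z ⊕ Bool} (hab : a ≠ b) (hac : a ≠ c)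
    (hbc : b ≠ c) (h1 : RootedLad G r (S i) (root x i a) (root x i b))
    (h1' : RootedLad G s (S i) (root x i b) (root x i c))
    (h2 : RootedLad G r (S j) (root x j a) (root x j b))
    (h2' : RootedLad G s (S j) (root x j b) (root x j c)) : LadIn G (k + 1) Set.univ := by
  have hubs : ∀ {r : ℕ} {a b : Z}, a ≠ b → RootedLad G r (S i) a b → RootedLad G r (S j) a b →
      k + 1 ≤ r + r → LadIn G (k + 1) Set.univ := by
    intro r a b hab h1 h2 hr
    refine (h1.join h2 (conn_singleton _) (conn_singleton _) rfl rfl rfl rfl ?_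
      (h.disj _ _ (by omega) (by omega) (by omega)) (h.disj_hub (by omega) a.2)
      (h.disj_hub (by omega) b.2) (h.disj_hub (by omega) a.2)
      (h.disj_hub (by omega) b.2)).mono hr subset_rfl
    simpa [Subtype.ext_iff] using fun h => hab (Subtype.ext h)
  have side : ∀ {r : ℕ} {a b : Z} {σ : Bool}, a ≠ b →
      RootedLad G r (S i) a (root (Z := Z) x i (Sum.inr σ)) →
      RootedLad G r (S j) a (root (Z := Z) x j (Sum.inr σ)) → k + 1 ≤ r + r →
      LadIn G (k + 1) Set.univ := fun {r a b σ} hab h1 h2 hr =>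
    h.join_same_side hi hij hj a.2 b.2 (fun h => hab (Subtype.ext h)) σ h1 h2 hr
  -- With a single hub in the triple, no second hub is available as a connector. The ladder with `r`
  -- rungs is then taken in one segment and the one with `s` rungs in the other, chosen so that the
  -- roots facing each other are joined by the rail between them.
  have both : ∀ {r s : ℕ} {a : Z} {σ τ : Bool}, σ ≠ τ → k + 1 ≤ r + s →
      RootedLad G r (S i) a (root (Z := Z) x i (Sum.inr σ)) →
      RootedLad G s (S i) (root (Z := Z) x i (Sum.inr σ)) (root (Z := Z) x i (Sum.inr τ)) →
      RootedLad G r (S j) a (root (Z := Z) x j (Sum.inr σ)) →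
      RootedLad G s (S j) (root (Z := Z) x j (Sum.inr σ)) (root (Z := Z) x j (Sum.inr τ)) →
      LadIn G (k + 1) Set.univ := by
    intro r s a σ τ hστ hrs h1 h1' h2 h2'
    cases σ <;> cases τ
    · exact absurd rfl hστ
    · exact h.join_rail_left hi hij hj a.2 h1' h2 (by omega)
    · exact h.join_rail_right hij hj a.2 h1 h2' hrs
    · exact absurd rfl hστ
  have hne : ∀ {a b : Z}, (Sum.inl a : Z ⊕ Bool) ≠ Sum.inl b → a ≠ b := fun h h' => h (by rw [h'])
  have hne' : ∀ {a b : Bool}, (Sum.inr a : Z ⊕ Bool) ≠ Sum.inr b → a ≠ b := fun h h' =>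
    h (by rw [h'])
  have hbig : k + 1 ≤ r + r ∨ k + 1 ≤ s + s := by omega
  -- At most two of the three distinct types are linking vertices, so a hub always occurs. With two
  -- hubs, the larger of the two rooted ladders is doubled; with one hub, both ladders are used
  -- along the rail.
  rcases a with a | a <;> rcases b with b | b <;> rcases c with c | c
  · rcases hbig with hr | hs
    · exact hubs (hne hab) h1 h2 hr
    · exact hubs (hne hbc) h1' h2' hs
  · rcases hbig with hr | hs
    · exact hubs (hne hab) h1 h2 hr
    · exact side (hne hab).symm h1' h2' hs
  · rcases hbig with hr | hs
    · exact side (hne hac) h1 h2 hr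
    · exact side (hne hac).symm h1'.symm h2'.symm hs
  · exact both (hne' hbc) hrs h1 h1' h2 h2'
  · rcases hbig with hr | hs
    · exact side (hne hbc) h1.symm h2.symm hr
    · exact hubs (hne hbc) h1' h2' hs
  · have hac' := hne' hac
    cases a <;> cases c
    · exact absurd rfl hac'
    · exact h.join_rail_hub hij hj b.2 h1' h2.symm (by omega)
    · exact h.join_rail_hub hij hj b.2 h1.symm h2' hrs
    · exact absurd rfl hac'
  · exact both (hne' hab).symm (by omega) h1'.symm h1.symm h2'.symm h2.symm
  · have h1 := hne' hab
    have h2 := hne' hac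
    have h3 := hne' hbc
    revert h1 h2 h3
    cases a <;> cases b <;> cases c <;> simp

/-- Pigeonhole on the types of the segments: each root is one of at most `t` hubs or one of the two
linking vertices, which gives the factors `t + 2`. -/
theorem ladIn [Finite V] {t : ℕ} (h : HubPath G k Z m x S) (hk : 2 ≤ k) (hG : IsKConnected G 3)
    (hZ : Z.ncard ≤ t)
    (hm : 3 * ((t + 2) * (t + 2) * (t + 2) * ((k + 1) * (k + 1)) + 1) + 2 ≤ m) :
    LadIn G (k + 1) Set.univ := by
  by_contra hcon
  set M := (t + 2) * (t + 2) * (t + 2) * ((k + 1) * (k + 1)) + 1 with hM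
  have hsmall : ∀ {r X u v}, RootedLad G r X u v → r < k + 1 := by
    intro r X u v h
    by_contra hr
    exact hcon (h.ladIn.mono (by omega) (Set.subset_univ _))
  have hex : ∀ g, g < m → ∃ c : (Z ⊕ Bool) × (Z ⊕ Bool) × (Z ⊕ Bool) × Fin (k + 1) × Fin (k + 1),
      c.1 ≠ c.2.1 ∧ c.1 ≠ c.2.2.1 ∧ c.2.1 ≠ c.2.2.1 ∧
      k + 1 ≤ (c.2.2.2.1 : ℕ) + c.2.2.2.2 ∧
      RootedLad G c.2.2.2.1 (S g) (root x g c.1) (root x g c.2.1) ∧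
      RootedLad G c.2.2.2.2 (S g) (root x g c.2.1) (root x g c.2.2.1) := by
    intro g hg
    obtain ⟨j, hj, hjg⟩ : ∃ j, j < m ∧ g ≠ j := by
      by_cases h0 : g = 0
      · exact ⟨1, by omega, by omega⟩
      · exact ⟨0, by omega, h0⟩
    obtain ⟨t₁, t₂, t₃, h12, h13, h23, ht, r, s, hrs, hr, hs⟩ :=
      exists_rootedPair hk hG (h.lad g hg) (three_le_ncard_compl (h.lad j hj) hk (h.disj g j hg hj hjg))
    have hroot : ∀ t ∈ ({t₁, t₂, t₃} : Set V), ∃ τ : Z ⊕ Bool, root x g τ = t := by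
      intro t ht'
      obtain ⟨h1, u, hu, hut⟩ := ht t ht'
      rcases h.nbr g hg u hu t hut with h2 | h2 | h2 | h2
      · exact absurd h2 h1
      · exact ⟨Sum.inl ⟨t, h2⟩, rfl⟩
      · exact ⟨Sum.inr false, h2.symm⟩
      · exact ⟨Sum.inr true, h2.symm⟩
    obtain ⟨τ₁, rfl⟩ := hroot t₁ (by simp)
    obtain ⟨τ₂, rfl⟩ := hroot t₂ (by simp)
    obtain ⟨τ₃, rfl⟩ := hroot t₃ (by simp)
    exact ⟨(τ₁, τ₂, τ₃, ⟨r, hsmall hr⟩, ⟨s, hsmall hs⟩), fun h => h12 (congrArg _ h),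
      fun h => h13 (congrArg _ h), fun h => h23 (congrArg _ h), hrs, hr, hs⟩
  choose! c h12 h13 h23 hrs hr hs using hex
  -- Only the positions `3 * n + 1` are compared: chosen segments are then at distance at least
  -- three and have neighbouring segments on both sides.
  have hninj : ¬ Function.Injective (fun n : Fin M => c (3 * n + 1)) := by
    intro hinj
    have h1 := Nat.card_le_card_of_injective _ hinj
    simp only [Nat.card_eq_fintype_card, Fintype.card_fin, Fintype.card_prod, Nat.card_prod, Nat.card_sum,
      Fintype.card_bool] at h1
    rw [Nat.card_coe_set_eq] at h1
    have h2 : (Z.ncard + 2) * ((Z.ncard + 2) * ((Z.ncard + 2) * ((k + 1) * (k + 1)))) ≤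
        (t + 2) * ((t + 2) * ((t + 2) * ((k + 1) * (k + 1)))) := by gcongr
    have h3 : (t + 2) * ((t + 2) * ((t + 2) * ((k + 1) * (k + 1)))) =
      (t + 2) * (t + 2) * (t + 2) * ((k + 1) * (k + 1)) := by ring
    omega
  simp only [Function.Injective, not_forall] at hninj
  obtain ⟨p, q, hpq, hne⟩ := hninj
  wlog hlt : p < q generalizing p q
  · exact this q p hpq.symm (Ne.symm hne) (lt_of_le_of_ne (not_lt.1 hlt) (Ne.symm hne))
  have hp : 3 * (p : ℕ) + 1 < m := by have := p.2; omega
  have hq : 3 * (q : ℕ) + 1 < m := by have := q.2; omega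
  have hlt' : (p : ℕ) < q := hlt
  have hrq := hr _ hq
  have hsq := hs _ hq
  rw [← hpq] at hrq hsq
  exact hcon (h.ladIn_of_same_type (by omega) (by omega) (by have := q.2; omega) (hrs _ hp)
    (h12 _ hp) (h13 _ hp) (h23 _ hp) (hr _ hp) (hs _ hp) hrq hsq)

end HubPath

end LadderMinor

/-! ### Stars, combs and long paths in connected sets. -/

namespace LadderMinor

variable {V : Type*} {G : SimpleGraph V}

/-- Every component left after removing a vertex `a` from a connected set touches `a`. -/
theorem Conn.comp_touch {S : Set V} {a c : V} (hS : Conn G S) (ha : a ∈ S) (hc : c ∈ S \ {a}) :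
    ∃ b ∈ comp G (S \ {a}) c, G.Adj a b := by
  obtain ⟨x, hx, y, hy, hxy⟩ := hS.exists_exit (A := comp G (S \ {a}) c)
    ⟨c, hc.1, mem_comp hc⟩ (fun h => (comp_subset c (h ha)).2 rfl)
  have hya : y = a := by
    by_contra hne
    exact hy.2 (comp_closed hc hx.2 ⟨hy.1, hne⟩ hxy)
  exact ⟨x, hx.2, hya ▸ hxy.symm⟩

/-- A star attached to a vertex `a` of `B`: disjoint connected sets adjacent to `a`, each consisting
of one of the sets `M i` and of vertices of `B`. -/
def StarIn {ι : Type*} (G : SimpleGraph V) (M : ι → Set V) (m : ℕ) (B : Set V) (s : Finset ι) :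
    Prop :=
  ∃ a ∈ B, ∃ (e : Fin m → ι) (C : Fin m → Set V), (∀ j, e j ∈ s) ∧ (∀ j, Conn G (C j)) ∧
    (∀ i j, i ≠ j → Disjoint (C i) (C j)) ∧ (∀ j, M (e j) ⊆ C j) ∧
    (∀ j, C j ⊆ M (e j) ∪ (B \ {a})) ∧ ∀ j, Touch G (C j) {a}

/-- A chain of `q + 1` subsets of `B` starting at `a`, touching distinct sets `M i`. -/
def CombIn {ι : Type*} (G : SimpleGraph V) (M : ι → Set V) (q : ℕ) (B : Set V) (a : V)
    (s : Finset ι) : Prop :=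
  ∃ (X : ℕ → Set V) (e : ℕ → ι), Chain G X (q + 1) ∧ a ∈ X 0 ∧ (∀ j ≤ q, X j ⊆ B) ∧
    (∀ j ≤ q, e j ∈ s) ∧ (∀ i j, i ≤ q → j ≤ q → e i = e j → i = j) ∧
    ∀ j ≤ q, Touch G (X j) (M (e j))

theorem StarIn.mono {ι : Type*} {M : ι → Set V} {m : ℕ} {B B' : Set V} {s s' : Finset ι}
    (h : StarIn G M m B s) (hB : B ⊆ B') (hs : s ⊆ s') : StarIn G M m B' s' := by
  obtain ⟨a, ha, e, C, h1, h2, h3, h4, h5, h6⟩ := h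
  exact ⟨a, hB ha, e, C, fun j => hs (h1 j), h2, h3, h4, fun j => (h5 j).trans
    (Set.union_subset_union_right _ (Set.sdiff_subset_sdiff_left hB)), h6⟩

/-- A connected set touching sufficiently many disjoint connected sets contains the centre of a
large star or a long comb. -/
theorem starIn_or_combIn [Finite V] {ι : Type*} (M : ι → Set V) {m : ℕ} (hm : 1 ≤ m) (B : Set V) :
    ∀ (q : ℕ) (a : V) (s : Finset ι), Conn G B → a ∈ B → (∀ i ∈ s, Conn G (M i)) →
      (∀ i ∈ s, ∀ j ∈ s, i ≠ j → Disjoint (M i) (M j)) → (∀ i ∈ s, Disjoint (M i) B) →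
      (∀ i ∈ s, Touch G B (M i)) → m ^ q < s.card → StarIn G M m B s ∨ CombIn G M q B a s := by
  classical
  induction B using WellFoundedLT.induction with
  | ind B ih =>
  intro q a s hB ha hM hd hMB ht hs
  rcases q with - | q
  · right
    obtain ⟨i, hi⟩ : s.Nonempty := Finset.card_pos.1 (by omega)
    refine ⟨fun _ => B, fun _ => i, ⟨fun _ _ => hB, fun i j hi hj h => by omega,
      fun i hi => by omega⟩, ha, fun _ _ => subset_rfl, fun _ _ => hi, fun i j hi hj _ => by omega,
      fun _ _ => ht i hi⟩
  have hex : ∀ i, ∃ c, i ∈ s → c ∈ B ∧ Touch G {c} (M i) := by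
    intro i
    by_cases hi : i ∈ s
    · obtain ⟨c, hc, d, hd, hcd⟩ := ht i hi
      exact ⟨c, fun _ => ⟨hc, c, rfl, d, hd, hcd⟩⟩
    · exact ⟨a, fun h => absurd h hi⟩
  choose c hc using hex
  -- Remove `a` from `B` and label `i` by the component containing its contact `c i`, or by `i`
  -- itself if the contact is `a`. Distinct labels give disjoint arms at `a`.
  let K : ι → Set V := fun i => if c i = a then ∅ else comp G (B \ {a}) (c i)
  let κ : ι → Set V ⊕ ι := fun i => if c i = a then Sum.inr i else Sum.inl (K i)
  have hKB : ∀ i, K i ⊆ B \ {a} := by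
    intro i
    simp only [K]
    split_ifs
    · exact Set.empty_subset _
    · exact comp_subset _
  have hconn : ∀ i ∈ s, Conn G (M i ∪ K i) ∧ Touch G (M i ∪ K i) {a} := by
    intro i hi
    by_cases hca : c i = a
    · simp only [K, hca, if_true, Set.union_empty]
      exact ⟨hM i hi, hca ▸ (hc i hi).2.symm⟩
    · simp only [K, hca, if_false]
      have hci : c i ∈ B \ {a} := ⟨(hc i hi).1, hca⟩
      obtain ⟨b, hb, hab⟩ := hB.comp_touch ha hci
      exact ⟨(hM i hi).union_touch (conn_comp hci) ((hc i hi).2.symm.mono subset_rfl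
        (by simpa using mem_comp hci)), b, Or.inr hb, a, rfl, hab.symm⟩
  by_cases hcard : m ≤ (s.image κ).card
  · left
    obtain ⟨T, hT, hTm⟩ := Finset.exists_subset_card_eq hcard
    let f := T.equivFinOfCardEq hTm
    have hpre : ∀ j : Fin m, ∃ i ∈ s, κ i = (f.symm j : Set V ⊕ ι) := fun j =>
      Finset.mem_image.1 (hT (f.symm j).2)
    choose e he hκ using hpre
    have hne : ∀ i j, i ≠ j → κ (e i) ≠ κ (e j) := by
      intro i j hij h
      rw [hκ, hκ] at h
      exact hij (f.symm.injective (Subtype.ext h))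
    refine ⟨a, ha, e, fun j => M (e j) ∪ K (e j), he, fun j => (hconn _ (he j)).1, ?_,
      fun j => Set.subset_union_left, fun j => Set.union_subset_union_right _ (hKB _),
      fun j => (hconn _ (he j)).2⟩
    intro i j hij
    have h1 : e i ≠ e j := fun h => hne i j hij (by rw [h])
    have hMK : ∀ i j, Disjoint (M (e i)) (K (e j)) := fun i j =>
      (hMB _ (he i)).mono_right ((hKB _).trans Set.sdiff_subset)
    simp only [Set.disjoint_union_left, Set.disjoint_union_right]
    refine ⟨⟨hd _ (he i) _ (he j) h1, (hMK j i).symm⟩, hMK i j, ?_⟩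
    have h2 := hne i j hij
    simp only [κ, K] at h2 ⊢
    split_ifs at h2 ⊢ with h3 h4 h4
    · simp
    · simp
    · simp
    · exact comp_disjoint ⟨(hc _ (he i)).1, h3⟩ ⟨(hc _ (he j)).1, h4⟩
        (fun h => h2 (by rw [h]))
  -- With fewer than `m` labels, one label is shared by more than `m ^ q` indices. It belongs to a
  -- component `S`, as a contact at `a` gives a private label.
  · obtain ⟨y, hy, hfib⟩ := Finset.exists_lt_card_fiber_of_mul_lt_card_of_maps_to
      (s := s) (t := s.image κ) (f := κ) (n := m ^ q) (fun i hi => Finset.mem_image_of_mem _ hi)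
      (lt_of_le_of_lt (Nat.mul_le_mul_right _ (by omega : _ ≤ m)) (by rwa [pow_succ'] at hs))
    have hq : 1 ≤ m ^ q := Nat.one_le_pow _ _ hm
    obtain ⟨i, hi, j, hj, hij⟩ := Finset.one_lt_card.1 (lt_of_le_of_lt hq hfib)
    simp only [Finset.mem_filter] at hi hj
    have hia : c i ≠ a := by
      intro h
      have h1 : κ i = Sum.inr i := by simp [κ, h]
      have h2 : κ j = Sum.inr i := by rw [hj.2, ← hi.2, h1]
      by_cases h3 : c j = a
      · simp only [κ, h3, if_true, Sum.inr.injEq] at h2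
        exact hij h2.symm
      · simp [κ, h3] at h2
    have hci : c i ∈ B \ {a} := ⟨(hc i hi.1).1, hia⟩
    obtain ⟨a', ha', haa'⟩ := hB.comp_touch ha hci
    let S := comp G (B \ {a}) (c i)
    have hy' : y = Sum.inl S := by rw [← hi.2]; simp [κ, K, hia, S]
    have hSB : S ⊆ B := (comp_subset _).trans Set.sdiff_subset
    have haS : a ∉ S := fun h => (comp_subset _ h).2 rfl
    have hSlt : S < B := lt_of_le_of_ne hSB (fun h => haS (h ▸ ha))
    have hmem : ∀ l ∈ s, (κ l = y ↔ c l ∈ S) := by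
      intro l hl
      rw [hy']
      constructor
      · intro h
        by_cases h3 : c l = a
        · simp [κ, h3] at h
        · simp only [κ, K, h3, if_false, Sum.inl.injEq] at h
          rw [← h]
          exact mem_comp ⟨(hc l hl).1, h3⟩
      · intro h
        have h3 : c l ≠ a := fun h' => haS (h' ▸ h)
        simp only [κ, K, h3, if_false, Sum.inl.injEq]
        exact comp_eq hci h
    have hrec := ih S hSlt
    -- If all contacts lie in `S`, the comb is found in `S` with the same `q` and `a` is added to
    -- its first set. Otherwise an index with contact outside `S` supplies a new first set, and a
    -- comb shorter by one in `S` suffices.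
    by_cases hall : ∀ l ∈ s, c l ∈ S
    · rcases hrec (q + 1) a' s (conn_comp hci) ha' hM hd (fun l hl => (hMB l hl).mono_right hSB)
        (fun l hl => (hc l hl).2.mono (by simpa using hall l hl) subset_rfl) hs with h | h
      · exact Or.inl (h.mono hSB subset_rfl)
      · right
        obtain ⟨X, e, hX, haX, hXS, hes, hinj, htX⟩ := h
        refine ⟨fun j => if j = 0 then insert a (X 0) else X j, e, ⟨?_, ?_, ?_⟩, ?_, ?_, hes, hinj,
          ?_⟩
        · intro j hj
          split_ifs with h0
          · exact (hX.conn 0 (by omega)).insert_adj ⟨a', haX, haa'.symm⟩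
          · exact hX.conn j hj
        · intro j l hj hl hjl
          have hins : ∀ l ≤ q + 1, l ≠ 0 → Disjoint (insert a (X 0)) (X l) := by
            intro l hl hl0
            rw [Set.disjoint_insert_left]
            exact ⟨fun h => haS (hXS l hl h), hX.disj _ _ (by omega) (by omega) (Ne.symm hl0)⟩
          split_ifs with h0 h1 h1
          · omega
          · exact hins l (by omega) h1
          · exact (hins j (by omega) h0).symm
          · exact hX.disj _ _ hj hl hjl
        · intro j hj
          rw [if_neg (by omega : ¬ j + 1 = 0)]
          split_ifs with h0
          · subst h0
            exact (hX.touch 0 hj).mono (Set.subset_insert _ _) subset_rfl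
          · exact hX.touch j hj
        · simp
        · intro j hj
          simp only
          split_ifs with h0
          · exact Set.insert_subset ha ((hXS 0 (by omega)).trans hSB)
          · exact (hXS j hj).trans hSB
        · intro j hj
          simp only
          split_ifs with h0
          · subst h0
            exact (htX 0 hj).mono (Set.subset_insert _ _) subset_rfl
          · exact htX j hj
    · push Not at hall
      obtain ⟨i₀, hi₀, hi₀S⟩ := hall
      have hfs : s.filter (fun l => κ l = y) ⊆ s := Finset.filter_subset _ _
      rcases hrec q a' (s.filter (fun l => κ l = y)) (conn_comp hci) ha' (fun l hl => hM l (hfs hl))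
        (fun l hl l' hl' => hd l (hfs hl) l' (hfs hl')) (fun l hl => (hMB l (hfs hl)).mono_right hSB)
        (fun l hl => by
          have hls := hfs hl
          have := (hmem l hls).1 (Finset.mem_filter.1 hl).2
          exact (hc l hls).2.mono (by simpa using this) subset_rfl) hfib with h | h
      · exact Or.inl (h.mono hSB hfs)
      · right
        obtain ⟨X, e, hX, haX, hXS, hes, hinj, htX⟩ := h
        have hY : ∃ Y : Set V, Conn G Y ∧ a ∈ Y ∧ Y ⊆ B ∧ Disjoint Y S ∧ Touch G Y (M i₀) := by
          by_cases h0 : c i₀ = a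
          · exact ⟨{a}, conn_singleton a, rfl, by simpa using ha, by simpa using haS,
              h0 ▸ (hc i₀ hi₀).2⟩
          · have hci₀ : c i₀ ∈ B \ {a} := ⟨(hc i₀ hi₀).1, h0⟩
            obtain ⟨b, hb, hab⟩ := hB.comp_touch ha hci₀
            refine ⟨insert a (comp G (B \ {a}) (c i₀)), (conn_comp hci₀).insert_adj
              ⟨b, hb, hab.symm⟩, Set.mem_insert _ _, Set.insert_subset ha ((comp_subset _).trans
              Set.sdiff_subset), ?_, (hc i₀ hi₀).2.mono ?_ subset_rfl⟩
            · rw [Set.disjoint_insert_left]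
              refine ⟨haS, comp_disjoint hci₀ hci fun h => hi₀S ?_⟩
              simp only [S, ← h]
              exact mem_comp hci₀
            · simpa using Or.inr (mem_comp hci₀)
        obtain ⟨Y, hYc, haY, hYB, hYS, hYt⟩ := hY
        have hei₀ : ∀ j ≤ q, e j ≠ i₀ := by
          intro j hj h
          have h1 := Finset.mem_filter.1 (hes j hj)
          exact hi₀S (h ▸ (hmem _ h1.1).1 h1.2)
        refine ⟨fun j => if j = 0 then Y else X (j - 1), fun j => if j = 0 then i₀ else e (j - 1),
          ⟨?_, ?_, ?_⟩, ?_, ?_, ?_, ?_, ?_⟩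
        · intro j hj
          split_ifs with h0
          · exact hYc
          · exact hX.conn _ (by omega)
        · intro j l hj hl hjl
          split_ifs with h0 h1 h1
          · omega
          · exact hYS.mono_right (hXS _ (by omega))
          · exact (hYS.mono_right (hXS _ (by omega))).symm
          · exact hX.disj _ _ (by omega) (by omega) (by omega)
        · intro j hj
          rw [if_neg (by omega : ¬ j + 1 = 0), Nat.add_sub_cancel]
          split_ifs with h0
          · subst h0
            exact ⟨a, haY, a', haX, haa'⟩
          · have := hX.touch (j - 1) (by omega)
            rwa [show j - 1 + 1 = j by omega] at this
        · simpa using haY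
        · intro j hj
          simp only
          split_ifs with h0
          · exact hYB
          · exact (hXS _ (by omega)).trans hSB
        · intro j hj
          simp only
          split_ifs with h0
          · exact hi₀
          · exact hfs (hes _ (by omega))
        · intro j l hj hl
          simp only
          split_ifs with h0 h1 h1
          · omega
          · exact fun h => absurd h.symm (hei₀ _ (by omega))
          · exact fun h => absurd h (hei₀ _ (by omega))
          · intro h
            have := hinj _ _ (by omega) (by omega) h
            omega
        · intro j hj
          simp only
          split_ifs with h0
          · exact hYt
          · exact htX _ (by omega)

/-- A large connected set all of whose vertices have small degree contains a long path. -/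
theorem Conn.exists_long_path [Finite V] {D : ℕ} (hD1 : 1 ≤ D) (hD : ∀ x : V, {y | G.Adj x y}.ncard ≤ D) :
    ∀ (L : ℕ) {S : Set V} {a : V}, Conn G S → a ∈ S → (D + 1) ^ L ≤ S.ncard →
      ∃ p : ℕ → V, p 0 = a ∧ (∀ i ≤ L, p i ∈ S) ∧ (∀ i < L, G.Adj (p i) (p (i + 1))) ∧
        ∀ i j, i ≤ L → j ≤ L → p i = p j → i = j := by
  classical
  intro L
  induction L with
  | zero =>
    intro S a _ ha _
    exact ⟨fun _ => a, rfl, fun _ _ => ha, fun i hi => by omega, fun i j hi hj _ => by omega⟩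
  | succ L ih =>
    intro S a hS ha hcard
    have hex : ∀ x, ∃ b, x ∈ S \ {a} → b ∈ comp G (S \ {a}) x ∧ G.Adj a b := by
      intro x
      by_cases hx : x ∈ S \ {a}
      · obtain ⟨b, hb, hab⟩ := hS.comp_touch ha hx
        exact ⟨b, fun _ => ⟨hb, hab⟩⟩
      · exact ⟨a, fun h => absurd h hx⟩
    choose κ hκ using hex
    have hpos : 1 ≤ (D + 1) ^ L := Nat.one_le_pow _ _ (by omega)
    have hSa : (S \ {a}).ncard + 1 = S.ncard := Set.ncard_sdiff_singleton_add_one ha (Set.toFinite _)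
    -- Each vertex of `S \ {a}` is sent to a neighbour of `a` in its component. There are at most
    -- `D` images and more than `D * ((D + 1) ^ L - 1)` vertices, so some component is large enough
    -- for the induction.
    have h1 : ∃ b ∈ {y | G.Adj a y}, (D + 1) ^ L ≤ (comp G (S \ {a}) b).ncard ∧ b ∈ S \ {a} := by
      have hNcard : (Set.toFinite {y | G.Adj a y}).toFinset.card ≤ D := by
        rw [← Set.ncard_eq_toFinset_card]; exact hD a
      obtain ⟨X, hX⟩ := Nat.exists_eq_add_of_le hpos
      have hXsub : (D + 1) ^ L - 1 = X := by omega
      obtain ⟨b, hb, hfib⟩ := Finset.exists_lt_card_fiber_of_mul_lt_card_of_maps_to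
        (s := (Set.toFinite (S \ {a})).toFinset) (t := (Set.toFinite {y | G.Adj a y}).toFinset)
        (f := κ) (n := X) (fun x hx => by
          rw [Set.Finite.mem_toFinset] at hx ⊢
          exact (hκ x hx).2) (by
        refine (Nat.mul_le_mul_right X hNcard).trans_lt ?_
        rw [← Set.ncard_eq_toFinset_card]
        rw [pow_succ', hX] at hcard
        have : (D + 1) * (1 + X) = D * X + D + 1 + X := by ring
        omega)
      rw [Set.Finite.mem_toFinset] at hb
      have hsub : ∀ x ∈ (Set.toFinite (S \ {a})).toFinset, κ x = b → b ∈ S \ {a} ∧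
          x ∈ comp G (S \ {a}) b := by
        rintro x hx rfl
        rw [Set.Finite.mem_toFinset] at hx
        refine ⟨comp_subset _ (hκ x hx).1, ?_⟩
        rw [comp_eq hx (hκ x hx).1]
        exact mem_comp hx
      obtain ⟨x, hx⟩ := Finset.card_pos.1 (by omega : 0 < (Finset.filter (fun x => κ x = b)
        (Set.toFinite (S \ {a})).toFinset).card)
      rw [Finset.mem_filter] at hx
      refine ⟨b, hb, ?_, (hsub x hx.1 hx.2).1⟩
      rw [hX, add_comm]
      refine hfib.trans_le ?_
      rw [← Set.ncard_coe_finset]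
      refine Set.ncard_le_ncard (fun x hx => ?_) (Set.toFinite _)
      rw [Finset.mem_coe, Finset.mem_filter] at hx
      exact (hsub x hx.1 hx.2).2
    obtain ⟨b, hab, hb, hbS⟩ := h1
    obtain ⟨p, hp0, hpS, hpa, hpi⟩ := ih (conn_comp hbS) (mem_comp hbS) hb
    have hpa' : ∀ i ≤ L, p i ∈ S \ {a} := fun i hi => comp_subset _ (hpS i hi)
    refine ⟨fun i => if i = 0 then a else p (i - 1), by simp, ?_, ?_, ?_⟩
    · intro i hi
      simp only
      split_ifs with h
      · exact ha
      · exact (hpa' _ (by omega)).1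
    · intro i hi
      change G.Adj (if i = 0 then a else p (i - 1)) (if i + 1 = 0 then a else p (i + 1 - 1))
      rw [if_neg (by omega : ¬ i + 1 = 0), Nat.add_sub_cancel]
      split_ifs with h
      · subst h
        rw [hp0]
        exact hab
      · have := hpa (i - 1) (by omega)
        rwa [show i - 1 + 1 = i by omega] at this
    · intro i j hi hj
      simp only
      split_ifs with h h' h'
      · omega
      · exact fun h'' => absurd h''.symm (hpa' _ (by omega)).2
      · exact fun h'' => absurd h'' (hpa' _ (by omega)).2
      · intro h''
        have := hpi _ _ (by omega) (by omega) h''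
        omega

end LadderMinor

/-! ### Hubs and chains of blocks; making a chain local. -/

namespace LadderMinor

universe u

variable {V : Type u} {G : SimpleGraph V}

/-- Many pairs with few pairs having a given first or second entry contain many pairs that differ
in both entries. -/
theorem exists_matching {D : ℕ} : ∀ (K : ℕ) (T : Finset (ℕ × ℕ)),
    (∀ i, (T.filter (fun e => e.1 = i)).card ≤ D) →
    (∀ j, (T.filter (fun e => e.2 = j)).card ≤ D) → K * (2 * D) < T.card →
      ∃ f : Fin (K + 1) → ℕ × ℕ, (∀ i, f i ∈ T) ∧ Function.Injective (fun i => (f i).1) ∧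
        Function.Injective (fun i => (f i).2) := by
  classical
  intro K
  induction K with
  | zero =>
    intro T _ _ h
    obtain ⟨e, he⟩ := Finset.card_pos.1 (by omega : 0 < T.card)
    exact ⟨fun _ => e, fun _ => he, fun i j _ => Fin.ext (by omega),
      fun i j _ => Fin.ext (by omega)⟩
  | succ K ih =>
    intro T h1 h2 h
    obtain ⟨e, he⟩ := Finset.card_pos.1 (by omega : 0 < T.card)
    -- Greedy choice: a chosen pair excludes at most `2 * D` pairs.
    let T' := T.filter (fun e' => e'.1 ≠ e.1 ∧ e'.2 ≠ e.2)
    have hsub : T' ⊆ T := Finset.filter_subset _ _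
    have hT : T ⊆ T' ∪ (T.filter (fun e' => e'.1 = e.1) ∪ T.filter (fun e' => e'.2 = e.2)) := by
      intro x hx
      simp only [T', Finset.mem_union, Finset.mem_filter, hx, true_and]
      tauto
    have h3 := (Finset.card_le_card hT).trans (Finset.card_union_le _ _)
    have h4 := Finset.card_union_le (T.filter (fun e' => e'.1 = e.1))
      (T.filter (fun e' => e'.2 = e.2))
    have h5 := h1 e.1
    have h6 := h2 e.2
    have h7 : (K + 1) * (2 * D) = K * (2 * D) + 2 * D := by ring
    obtain ⟨f, hf, hf1, hf2⟩ := ih T'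
      (fun i => (Finset.card_le_card (Finset.filter_subset_filter _ hsub)).trans (h1 i))
      (fun i => (Finset.card_le_card (Finset.filter_subset_filter _ hsub)).trans (h2 i)) (by omega)
    have hfe : ∀ i, (f i).1 ≠ e.1 ∧ (f i).2 ≠ e.2 := fun i => (Finset.mem_filter.1 (hf i)).2
    refine ⟨Fin.cons e f, ?_, ?_, ?_⟩
    · intro i
      refine Fin.cases ?_ (fun i => ?_) i
      · simpa using he
      · simpa using hsub (hf i)
    · intro i j
      refine Fin.cases ?_ (fun i => ?_) i <;> refine Fin.cases ?_ (fun j => ?_) j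
      · simp
      · simpa using fun h => absurd h.symm (hfe j).1
      · simpa using fun h => absurd h (hfe i).1
      · simpa using fun h => hf1 h
    · intro i j
      refine Fin.cases ?_ (fun i => ?_) i <;> refine Fin.cases ?_ (fun j => ?_) j
      · simp
      · simpa using fun h => absurd h.symm (hfe j).2
      · simpa using fun h => absurd h (hfe i).2
      · simpa using fun h => hf2 h

/-- If every position of a long interval is crossed by few of the given pairs, then there are
`n` consecutive segments of equal length such that no pair with an end in one of the segments
jumps over a segment. -/
theorem exists_window (n : ℕ) : ∀ (C : ℕ) (T : Finset (ℕ × ℕ)) (a : ℕ),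
    (∀ c, a ≤ c → c < a + n ^ (C + 1) → (T.filter (fun e => e.1 ≤ c ∧ c < e.2)).card ≤ C) →
      ∃ b l, 0 < l ∧ a ≤ b ∧ b + n * l ≤ a + n ^ (C + 1) ∧ ∀ e ∈ T,
        ((b ≤ e.1 ∧ e.1 < b + n * l) ∨ (b ≤ e.2 ∧ e.2 < b + n * l)) →
          ∀ j < n, ¬ (e.1 < b + j * l ∧ b + (j + 1) * l ≤ e.2) := by
  intro C
  induction C with
  | zero =>
    intro T a h
    refine ⟨a, 1, by omega, le_rfl, by simp, fun e he _ j hj hcon => ?_⟩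
    have h1 := h (a + j) (by omega) (by simpa using hj)
    have h2 : 0 < (T.filter (fun e => e.1 ≤ a + j ∧ a + j < e.2)).card :=
      Finset.card_pos.2 ⟨e, Finset.mem_filter.2 ⟨he, by omega, by omega⟩⟩
    omega
  | succ C ih =>
    intro T a h
    rcases Nat.eq_zero_or_pos n with rfl | hn
    · exact ⟨a, 1, by omega, le_rfl, by simp, fun e he _ j hj => by omega⟩
    -- A pair `e` jumping over a segment crosses each of its positions. Inside that segment the
    -- crossing bound drops by one once `e` is erased, and `e` itself has no end there, so it does
    -- no harm to the window found by induction.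
    by_cases hcon : ∀ e ∈ T, ((a ≤ e.1 ∧ e.1 < a + n * n ^ (C + 1)) ∨
        (a ≤ e.2 ∧ e.2 < a + n * n ^ (C + 1))) →
          ∀ j < n, ¬ (e.1 < a + j * n ^ (C + 1) ∧ a + (j + 1) * n ^ (C + 1) ≤ e.2)
    · exact ⟨a, n ^ (C + 1), by positivity, le_rfl, by rw [← pow_succ'], hcon⟩
    · push Not at hcon
      obtain ⟨e, he, -, j, hj, he1, he2⟩ := hcon
      have hjn : (j + 1) * n ^ (C + 1) ≤ n ^ (C + 1 + 1) := by
        rw [pow_succ' n (C + 1)]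
        exact Nat.mul_le_mul_right _ hj
      have hj1 : (j + 1) * n ^ (C + 1) = j * n ^ (C + 1) + n ^ (C + 1) := by ring
      obtain ⟨b, l, hl, hab, hbl, hT⟩ := ih (T.erase e) (a + j * n ^ (C + 1)) (by
        intro c hc1 hc2
        have h1 := h c (by omega) (by omega)
        rw [Finset.filter_erase, Finset.card_erase_of_mem (Finset.mem_filter.2
          ⟨he, by omega, by omega⟩)]
        omega)
      refine ⟨b, l, hl, by omega, by omega, fun e' he' hend => ?_⟩
      by_cases hee : e' = e
      · subst hee
        omega
      · exact hT e' (Finset.mem_erase.2 ⟨hee, he'⟩) hend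

/-- Disjoint connected sets, each containing a ladder with `k` rungs and touching every
vertex of `Z`. -/
structure HubBlocks {ι : Type*} (G : SimpleGraph V) (k : ℕ) (Z : Set V) (B : ι → Set V) :
    Prop where
  conn : ∀ i, Conn G (B i)
  disj : ∀ i j, i ≠ j → Disjoint (B i) (B j)
  disjZ : ∀ i, Disjoint (B i) Z
  touchZ : ∀ i, ∀ z ∈ Z, Touch G (B i) {z}
  lad : ∀ i, LadIn G k (B i)

theorem HubBlocks.comp {ι κ : Type*} {k : ℕ} {Z : Set V} {B : ι → Set V} (h : HubBlocks G k Z B)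
    {e : κ → ι} (he : Function.Injective e) : HubBlocks G k Z (fun i => B (e i)) :=
  ⟨fun _ => h.conn _, fun _ _ hij => h.disj _ _ (he.ne hij), fun _ => h.disjZ _,
    fun _ => h.touchZ _, fun _ => h.lad _⟩

theorem HubBlocks.absorb [Finite V] {ι : Type*} [Finite ι] {k : ℕ} {Z : Set V} {B : ι → Set V}
    (h : HubBlocks G k Z B) : ∃ B' : ι → Set V, HubBlocks G k Z B' ∧ (∀ i, B i ⊆ B' i) ∧
      ∀ i, ∀ u ∈ B' i, ∀ v, G.Adj u v → v ∈ Z ∨ ∃ j, v ∈ B' j := by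
  obtain ⟨B', h1, h2, h3, h4, h5⟩ := exists_absorb (G := G) Zᶜ B h.conn
    (fun i => Set.subset_compl_iff_disjoint_right.2 (h.disjZ i)) h.disj
  refine ⟨B', ⟨h2, h4, fun i => Set.subset_compl_iff_disjoint_right.1 (h3 i),
    fun i z hz => (h.touchZ i z hz).mono (h1 i) subset_rfl, fun i => (h.lad i).mono le_rfl (h1 i)⟩,
    h1, fun i u hu v huv => ?_⟩
  by_cases hv : v ∈ Z
  · exact Or.inl hv
  · exact Or.inr (h5 i u hu v hv huv)

/-- In every `3`-connected graph, `n` blocks with `t` common hubs yield a ladder with `k + 1`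
rungs. -/
def Forces (k t n : ℕ) : Prop :=
  ∀ (V : Type u) [Finite V] (G : SimpleGraph V) (Z : Set V) (B : Fin n → Set V),
    IsKConnected G 3 → Z.ncard = t → HubBlocks G k Z B → LadIn G (k + 1) Set.univ

theorem Forces.mono {k t n m : ℕ} (h : Forces.{u} k t n) (hnm : n ≤ m) : Forces.{u} k t m :=
  fun V _ G Z _ hG hZ hB => h V G Z _ hG hZ (hB.comp (Fin.castLE_injective hnm))

/-- The centre of the star is a further hub for its arms, each of which still contains a block. -/
theorem StarIn.ladIn [Finite V] {ι : Type*} {k t m : ℕ} (hF : Forces.{u} k (t + 1) m)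
    (hG : IsKConnected G 3) {Z : Set V} (hZ : Z.ncard = t) {M : ι → Set V} {B : Set V}
    {s : Finset ι} (h : StarIn G M m B s) (hBZ : Disjoint B Z) (hMB : ∀ i ∈ s, Disjoint (M i) B)
    (hMZ : ∀ i ∈ s, Disjoint (M i) Z) (ht : ∀ i ∈ s, ∀ z ∈ Z, Touch G (M i) {z})
    (hl : ∀ i ∈ s, LadIn G k (M i)) : LadIn G (k + 1) Set.univ := by
  obtain ⟨a, ha, e, C, he, hC, hd, hMC, hCM, hta⟩ := h
  have haZ : a ∉ Z := Set.disjoint_left.1 hBZ ha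
  refine hF V G (insert a Z) C hG (by rw [Set.ncard_insert_of_notMem haZ (Set.toFinite _), hZ])
    ⟨hC, hd, fun j => ?_, fun j z hz => ?_, fun j => (hl _ (he j)).mono le_rfl (hMC j)⟩
  · rw [Set.disjoint_insert_right]
    refine ⟨fun h => ?_, ?_⟩
    · rcases hCM j h with h' | h'
      · exact Set.disjoint_left.1 (hMB _ (he j)) h' ha
      · exact h'.2 rfl
    · refine Disjoint.mono_left (hCM j) ?_
      rw [Set.disjoint_union_left]
      exact ⟨hMZ _ (he j), hBZ.mono_left Set.sdiff_subset⟩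
  · rcases hz with rfl | hz
    · exact hta j
    · exact (ht _ (he j) z hz).mono (hMC j) subset_rfl

/-- A chain of blocks with common hubs `Z`. -/
structure HubChain (G : SimpleGraph V) (k : ℕ) (Z : Set V) (n : ℕ) (B : ℕ → Set V) : Prop
    extends Chain G B n where
  disjZ : ∀ i, i < n → Disjoint (B i) Z
  touchZ : ∀ i, i < n → ∀ z ∈ Z, Touch G (B i) {z}
  lad : ∀ i, i < n → LadIn G k (B i)

namespace HubChain

variable {k n t m : ℕ} {Z : Set V} {B : ℕ → Set V}

theorem reflect (h : HubChain G k Z n B) : HubChain G k Z n (fun i => B (n - 1 - i)) :=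
  ⟨h.toChain.reflect, fun i hi => h.disjZ _ (by omega), fun i hi => h.touchZ _ (by omega),
    fun i hi => h.lad _ (by omega)⟩

theorem exists_absorb [Finite V] (h : HubChain G k Z n B) : ∃ B', HubChain G k Z n B' ∧
    ∀ i < n, ∀ u ∈ B' i, ∀ v, G.Adj u v → v ∈ Z ∨ ∃ j < n, v ∈ B' j := by
  have hB : HubBlocks G k Z (fun i : Fin n => B i) :=
    ⟨fun i => h.conn _ i.2, fun i j hij => h.disj _ _ i.2 j.2 (fun h => hij (Fin.ext h)),
      fun i => h.disjZ _ i.2, fun i => h.touchZ _ i.2, fun i => h.lad _ i.2⟩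
  obtain ⟨B', hB', hsub, hnbr⟩ := hB.absorb
  have hval : ∀ i (hi : i < n), (if hi : i < n then B' ⟨i, hi⟩ else ∅) = B' ⟨i, hi⟩ :=
    fun i hi => dif_pos hi
  refine ⟨fun i => if hi : i < n then B' ⟨i, hi⟩ else ∅, ⟨⟨?_, ?_, ?_⟩, ?_, ?_, ?_⟩, ?_⟩
  · intro i hi
    simpa only [hval i hi] using hB'.conn _
  · intro i j hi hj hij
    simpa only [hval i hi, hval j hj] using hB'.disj _ _ (by simpa using hij)
  · intro i hi
    simpa only [hval i (by omega), hval _ hi] using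
      (h.touch i hi).mono (hsub ⟨i, by omega⟩) (hsub ⟨i + 1, hi⟩)
  · intro i hi
    simpa only [hval i hi] using hB'.disjZ _
  · intro i hi
    simpa only [hval i hi] using hB'.touchZ _
  · intro i hi
    simpa only [hval i hi] using hB'.lad _
  · intro i hi u hu v huv
    simp only [hval i hi] at hu
    rcases hnbr _ u hu v huv with h | ⟨j, hj⟩
    · exact Or.inl h
    · exact Or.inr ⟨j, j.2, by simpa only [hval j j.2] using hj⟩

/-- A block touching many later blocks. -/
theorem ladIn_of_touch_later [Finite V] (h : HubChain G k Z n B) (hG : IsKConnected G 3)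
    (hZ : Z.ncard = t) (hm : 1 ≤ m) (hF : Forces.{u} k (t + 1) m) {i : ℕ} (s : Finset ℕ)
    (hs : ∀ j ∈ s, i < j ∧ j < n ∧ Touch G (B i) (B j)) (hcard : m ^ (k * k) < s.card) :
    LadIn G (k + 1) Set.univ := by
  obtain ⟨j₀, hj₀⟩ := Finset.card_pos.1 (by omega : 0 < s.card)
  have hi : i < n := (hs j₀ hj₀).1.trans (hs j₀ hj₀).2.1
  obtain ⟨a, ha⟩ := (h.conn i hi).1
  have hdi : ∀ j ∈ s, Disjoint (B j) (B i) := fun j hj =>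
    h.disj _ _ (hs j hj).2.1 hi (hs j hj).1.ne'
  -- A star gives a new hub. A comb inside `B i` is one rail, the chain of all later blocks is the
  -- other, and the contacts of the comb are more than `k ^ 2` direct rungs.
  rcases starIn_or_combIn B hm (B i) (k * k) a s (h.conn i hi) ha
    (fun j hj => h.conn j (hs j hj).2.1)
    (fun j hj l hl hjl => h.disj _ _ (hs j hj).2.1 (hs l hl).2.1 hjl)
    hdi (fun j hj => (hs j hj).2.2) hcard with hst | ⟨X, e, hX, -, hXB, hes, hinj, ht⟩
  · exact hst.ladIn hF hG hZ (h.disjZ i hi) hdi (fun j hj => h.disjZ j (hs j hj).2.1)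
      (fun j hj => h.touchZ j (hs j hj).2.1) (fun j hj => h.lad j (hs j hj).2.1)
  · have hes' : ∀ j : Fin (k * k + 1), i < e j ∧ e j < n := fun j =>
      ⟨(hs _ (hes j (by omega))).1, (hs _ (hes j (by omega))).2.1⟩
    refine ladIn_of_rungs (ι := Fin (k * k + 1)) (W := fun j => B (i + 1 + j)) (b := n - (i + 1))
      hX ⟨fun j hj => h.conn _ (by omega), fun j l hj hl hjl => h.disj _ _ (by omega) (by omega)
        (by omega), fun j hj => h.touch _ (by omega)⟩
      (fun j l hj hl => (h.disj _ _ hi (by omega) (by omega)).mono_left (hXB j (by omega)))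
      (fun j => j) (fun j => e j - (i + 1)) (fun _ => ∅) Fin.val_injective ?_ (fun j => j.2) ?_ ?_ ?_
      (by simp) (by simp) (by simp) (by simp)
    · intro j l hjl
      have h1 := hes' j
      have h2 := hes' l
      simp only at hjl
      exact Fin.ext (hinj _ _ (by omega) (by omega) (by omega))
    · intro j
      have h1 := hes' j
      show e j - (i + 1) < _
      omega
    · intro j
      simpa using hX.conn j j.2
    · intro j
      have h1 := hes' j
      simpa [show i + 1 + (e j - (i + 1)) = e j by omega] using ht j (by omega)

theorem ladIn_of_touch_earlier [Finite V] (h : HubChain G k Z n B) (hG : IsKConnected G 3)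
    (hZ : Z.ncard = t) (hm : 1 ≤ m) (hF : Forces.{u} k (t + 1) m) {i : ℕ} (hi : i < n)
    (s : Finset ℕ) (hs : ∀ j ∈ s, j < i ∧ Touch G (B i) (B j)) (hcard : m ^ (k * k) < s.card) :
    LadIn G (k + 1) Set.univ := by
  refine h.reflect.ladIn_of_touch_later hG hZ hm hF (i := n - 1 - i)
    (s.image (fun j => n - 1 - j)) ?_ ?_
  · intro j hj
    obtain ⟨l, hl, rfl⟩ := Finset.mem_image.1 hj
    have h1 := hs l hl
    refine ⟨by omega, by omega, ?_⟩
    rw [show n - 1 - (n - 1 - i) = i by omega, show n - 1 - (n - 1 - l) = l by omega]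
    exact h1.2
  · rwa [Finset.card_image_of_injOn]
    intro x hx y hy hxy
    have h1 := hs x hx
    have h2 := hs y hy
    simp only at hxy
    omega

/-- Many disjoint pairs of touching blocks crossing a common position. -/
theorem ladIn_of_matching (h : HubChain G k Z n B) {c : ℕ} (hc : c < n)
    (f : Fin (k * k + 1) → ℕ × ℕ) (h1 : Function.Injective (fun i => (f i).1))
    (h2 : Function.Injective (fun i => (f i).2))
    (hf : ∀ i, (f i).1 ≤ c ∧ c < (f i).2 ∧ (f i).2 < n ∧ Touch G (B (f i).1) (B (f i).2)) :
    LadIn G (k + 1) Set.univ := by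
  refine ladIn_of_rungs (ι := Fin (k * k + 1)) (U := B) (a := c + 1)
    (W := fun j => B (c + 1 + j)) (b := n - (c + 1))
    ⟨fun j hj => h.conn _ (by omega), fun j l hj hl hjl => h.disj _ _ (by omega) (by omega)
        (by omega), fun j hj => h.touch _ (by omega)⟩
    ⟨fun j hj => h.conn _ (by omega), fun j l hj hl hjl => h.disj _ _ (by omega) (by omega)
        (by omega), fun j hj => h.touch _ (by omega)⟩
    (fun j l hj hl => h.disj _ _ (by omega) (by omega) (by omega))
    (fun j => (f j).1) (fun j => (f j).2 - (c + 1)) (fun _ => ∅) h1 ?_ ?_ ?_ ?_ ?_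
    (by simp) (by simp) (by simp) (by simp)
  · intro j l hjl
    have h3 := hf j
    have h4 := hf l
    simp only at hjl
    exact h2 (by simp only; omega)
  · intro j
    have h3 := hf j
    omega
  · intro j
    have h3 := hf j
    omega
  · intro j
    have h3 := hf j
    simpa using h.conn _ (by omega)
  · intro j
    have h3 := hf j
    simpa [show c + 1 + ((f j).2 - (c + 1)) = (f j).2 by omega] using h3.2.2.2

/-- In a long chain of blocks one finds a new chain of `n'` blocks such that only consecutive
inner blocks are adjacent. -/
theorem exists_local [Finite V] {n' : ℕ} (h : HubChain G k Z n B) (hG : IsKConnected G 3)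
    (hZ : Z.ncard = t) (hm : 1 ≤ m) (hF : Forces.{u} k (t + 1) m)
    (hn : n' ^ (k * k * (2 * m ^ (k * k)) + 1) ≤ n) : LadIn G (k + 1) Set.univ ∨
      ∃ B', HubChain G k Z n' B' ∧ ∀ i, 1 ≤ i → i + 1 < n' → ∀ u ∈ B' i, ∀ v, G.Adj u v →
        v ∈ Z ∨ v ∈ B' (i - 1) ∨ v ∈ B' i ∨ v ∈ B' (i + 1) := by
  classical
  obtain ⟨B₀, h, hnbr⟩ := h.exists_absorb
  rw [or_iff_not_imp_left]
  intro hcon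
  -- `T` records the pairs of touching blocks. Few of them share an end, by the new-hub argument; so
  -- many pairs crossing a position would contain a matching of `k ^ 2 + 1` pairs, which are rungs
  -- between the two parts of the chain.
  let T : Finset (ℕ × ℕ) := (Finset.range n ×ˢ Finset.range n).filter
    (fun e => e.1 < e.2 ∧ Touch G (B₀ e.1) (B₀ e.2))
  have hT : ∀ e, e ∈ T ↔ e.1 < e.2 ∧ e.2 < n ∧ Touch G (B₀ e.1) (B₀ e.2) := by
    intro e
    simp only [T, Finset.mem_filter, Finset.mem_product, Finset.mem_range]
    constructor
    · tauto
    · rintro ⟨h1, h2, h3⟩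
      exact ⟨⟨by omega, h2⟩, h1, h3⟩
  have hdepth : ∀ c, 0 ≤ c → c < 0 + n' ^ (k * k * (2 * m ^ (k * k)) + 1) →
      (T.filter (fun e => e.1 ≤ c ∧ c < e.2)).card ≤ k * k * (2 * m ^ (k * k)) := by
    intro c _ hc
    by_contra hlt
    push Not at hlt
    obtain ⟨f, hf, hf1, hf2⟩ := exists_matching (D := m ^ (k * k)) (k * k) _ (by
      intro i
      by_contra hi
      push Not at hi
      refine hcon (h.ladIn_of_touch_later hG hZ hm hF (i := i) (Finset.image Prod.snd
        ((T.filter (fun e => e.1 ≤ c ∧ c < e.2)).filter (fun e => e.1 = i))) ?_ ?_)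
      · intro j hj
        obtain ⟨e, he, rfl⟩ := Finset.mem_image.1 hj
        simp only [Finset.mem_filter, hT] at he
        obtain ⟨⟨h1, -⟩, rfl⟩ := he
        exact h1
      · rwa [Finset.card_image_of_injOn]
        intro e he e' he' hee
        simp only [Finset.coe_filter, Finset.mem_filter, Set.mem_ofPred_eq] at he he'
        exact Prod.ext (he.2.trans he'.2.symm) hee) (by
      intro i
      by_contra hi
      push Not at hi
      have hin : i < n := by
        obtain ⟨e, he⟩ := Finset.card_pos.1 (lt_of_le_of_lt (Nat.zero_le _) hi)
        simp only [Finset.mem_filter, hT] at he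
        omega
      refine hcon (h.ladIn_of_touch_earlier hG hZ hm hF hin (Finset.image Prod.fst
        ((T.filter (fun e => e.1 ≤ c ∧ c < e.2)).filter (fun e => e.2 = i))) ?_ ?_)
      · intro j hj
        obtain ⟨e, he, rfl⟩ := Finset.mem_image.1 hj
        simp only [Finset.mem_filter, hT] at he
        obtain ⟨⟨h1, -⟩, rfl⟩ := he
        exact ⟨h1.1, h1.2.2.symm⟩
      · rwa [Finset.card_image_of_injOn]
        intro e he e' he' hee
        simp only [Finset.coe_filter, Finset.mem_filter, Set.mem_ofPred_eq] at he he'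
        exact Prod.ext hee (he.2.trans he'.2.symm)) hlt
    refine hcon (h.ladIn_of_matching (c := c) (by omega) f hf1 hf2 fun i => ?_)
    have := hf i
    simp only [Finset.mem_filter, hT] at this
    tauto
  obtain ⟨b, l, hl, -, hbl, hwin⟩ := exists_window n' _ T 0 hdepth
  have hle : ∀ j < n', b + (j + 1) * l ≤ n := by
    intro j hj
    have h1 : (j + 1) * l ≤ n' * l := Nat.mul_le_mul_right _ hj
    omega
  have hj1 : ∀ j, (j + 1) * l = j * l + l := fun j => by ring
  have hmulle : ∀ j j', j ≤ j' → j * l ≤ j' * l := fun j j' h => Nat.mul_le_mul_right _ h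
  -- The blocks of each segment of the window are united. Since no pair with an end in the window
  -- jumps over a segment, inner unions touch only their neighbours.
  let β : ℕ → Set V := fun j => ⋃ i ∈ Set.Icc (b + j * l) (b + j * l + l - 1), B₀ i
  have hβ : ∀ j i, b + j * l ≤ i → i < b + (j + 1) * l → B₀ i ⊆ β j := by
    intro j i h1 h2
    have h3 := hj1 j
    exact Set.subset_biUnion_of_mem (u := B₀) (show i ∈ Set.Icc _ _ from ⟨h1, by omega⟩)
  have hβ' : ∀ j v, v ∈ β j → ∃ i, b + j * l ≤ i ∧ i < b + (j + 1) * l ∧ v ∈ B₀ i := by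
    intro j v hv
    simp only [β, Set.mem_iUnion, Set.mem_Icc, exists_prop] at hv
    obtain ⟨i, ⟨h1, h2⟩, h3⟩ := hv
    have h4 := hj1 j
    exact ⟨i, h1, by omega, h3⟩
  refine ⟨β, ⟨⟨?_, ?_, ?_⟩, ?_, ?_, ?_⟩, ?_⟩
  · intro j hj
    have h1 := hle j hj
    have h2 := hj1 j
    exact h.toChain.conn_Icc (by omega) (by omega)
  · intro j j' hj hj' hjj
    rw [Set.disjoint_left]
    intro v hv hv'
    obtain ⟨i, h1, h2, h3⟩ := hβ' j v hv
    obtain ⟨i', h1', h2', h3'⟩ := hβ' j' v hv'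
    have h4 := hle j hj
    have h5 := hle j' hj'
    refine Set.disjoint_left.1 (h.disj i i' (by omega) (by omega) fun hii => ?_) h3 h3'
    subst hii
    rcases lt_or_gt_of_ne hjj with h6 | h6
    · have := hmulle (j + 1) j' h6
      omega
    · have := hmulle (j' + 1) j h6
      omega
  · intro j hj
    have h1 := hle (j + 1) hj
    have h2 := hj1 j
    have h3 := hj1 (j + 1)
    refine (h.touch (b + (j + 1) * l - 1) (by omega)).mono (hβ j _ (by omega) (by omega))
      (hβ (j + 1) _ (by omega) (by omega))
  · intro j hj
    rw [Set.disjoint_left]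
    intro v hv hvZ
    obtain ⟨i, h1, h2, h3⟩ := hβ' j v hv
    have h4 := hle j hj
    exact Set.disjoint_left.1 (h.disjZ i (by omega)) h3 hvZ
  · intro j hj z hz
    have h2 := hj1 j
    have h4 := hle j hj
    exact (h.touchZ (b + j * l) (by omega) z hz).mono (hβ j _ le_rfl (by omega)) subset_rfl
  · intro j hj
    have h2 := hj1 j
    have h4 := hle j hj
    exact (h.lad (b + j * l) (by omega)).mono le_rfl (hβ j _ le_rfl (by omega))
  · intro j hj1' hj u hu v huv
    obtain ⟨i, h1, h2, h3⟩ := hβ' j u hu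
    have h4 := hle j (by omega)
    rcases hnbr i (by omega) u h3 v huv with hv | ⟨i', hi', hv⟩
    · exact Or.inl hv
    right
    obtain ⟨j, rfl⟩ : ∃ j', j = j' + 1 := ⟨j - 1, by omega⟩
    have e1 := hj1 j
    have e2 := hj1 (j + 1)
    have e3 := hj1 (j + 1 + 1)
    have e4 := hmulle (j + 1 + 1) n' (by omega)
    have ht : Touch G (B₀ i) (B₀ i') := ⟨u, h3, v, hv, huv⟩
    have hlow : b + j * l ≤ i' := by
      by_contra hlt
      exact hwin (i', i) ((hT _).2 ⟨by simp only; omega, by simp only; omega, ht.symm⟩)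
        (Or.inr ⟨by simp only; omega, by simp only; omega⟩) j (by omega)
        ⟨by simp only; omega, by simp only; omega⟩
    have hhigh : i' < b + (j + 1 + 1 + 1) * l := by
      by_contra hlt
      exact hwin (i, i') ((hT _).2 ⟨by simp only; omega, by simp only; omega, ht⟩)
        (Or.inl ⟨by simp only; omega, by simp only; omega⟩) (j + 1 + 1) (by omega)
        ⟨by simp only; omega, by simp only; omega⟩
    rw [Nat.add_sub_cancel]
    by_cases h5 : i' < b + (j + 1) * l
    · exact Or.inl (hβ _ _ hlow h5 hv)
    · by_cases h6 : i' < b + (j + 1 + 1) * l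
      · exact Or.inr (Or.inl (hβ _ _ (by omega) h6 hv))
      · exact Or.inr (Or.inr (hβ (j + 1 + 1) _ (by omega) hhigh hv))

end HubChain

end LadderMinor

/-! ### Cut vertices of local chains and the resulting path of segments. -/

namespace LadderMinor

universe u

variable {V : Type u} {G : SimpleGraph V}

/-- The subgraph of `G` on the same vertex set consisting of the edges inside `Y`. -/
def within (G : SimpleGraph V) (Y : Set V) : SimpleGraph V where
  Adj u v := G.Adj u v ∧ u ∈ Y ∧ v ∈ Y
  symm := ⟨fun _ _ h => ⟨h.1.symm, h.2.2, h.2.1⟩⟩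
  loopless := ⟨fun _ h => G.irrefl h.1⟩

theorem Conn.of_within {Y D : Set V} (h : Conn (within G Y) D)
    (hD : (D ∩ Y).Nonempty) : D ⊆ Y ∧ Conn G D := by
  refine ⟨(h.2 (D ∩ Y) Set.inter_subset_left hD fun a _ b hb hab => ⟨hb, hab.2.2⟩).trans
    Set.inter_subset_right, h.1, fun A hA hne hcl => h.2 A hA hne fun a ha b hb hab =>
      hcl a ha b hb hab.1⟩

namespace HubChain

variable {k n t m : ℕ} {Z : Set V} {B : ℕ → Set V}

/-- Inner blocks of the chain are adjacent only to hubs and to their two neighbouring blocks. -/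
def Local (G : SimpleGraph V) (Z : Set V) (n : ℕ) (B : ℕ → Set V) : Prop :=
  ∀ i, 1 ≤ i → i + 1 < n → ∀ u ∈ B i, ∀ v, G.Adj u v →
    v ∈ Z ∨ v ∈ B (i - 1) ∨ v ∈ B i ∨ v ∈ B (i + 1)

/-- The union of `s` blocks following block `o`. -/
def region (B : ℕ → Set V) (o s : ℕ) : Set V := ⋃ i ∈ Set.Icc (o + 1) (o + s), B i

theorem mem_region {o s : ℕ} {v : V} :
    v ∈ region B o s ↔ ∃ i, o + 1 ≤ i ∧ i ≤ o + s ∧ v ∈ B i := by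
  simp only [region, Set.mem_iUnion, Set.mem_Icc, exists_prop, and_assoc]

theorem eq_of_mem (h : HubChain G k Z n B) {i j : ℕ} {v : V} (hi : i < n) (hj : j < n)
    (hvi : v ∈ B i) (hvj : v ∈ B j) : i = j := by
  by_contra hij
  exact Set.disjoint_left.1 (h.disj i j hi hj hij) hvi hvj

/-- A connected set inside a region that meets its two outer blocks meets every block. -/
theorem meets_block (h : HubChain G k Z n B) (hloc : Local G Z n B) {o s c : ℕ}
    (hn : o + s + 1 < n) {D : Set V} (hD : Conn G D) (hDY : D ⊆ region B o s)
    (h1 : (D ∩ B (o + 1)).Nonempty) (h2 : (D ∩ B (o + s)).Nonempty) (hc1 : o + 1 ≤ c)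
    (hc2 : c ≤ o + s) : (D ∩ B c).Nonempty := by
  by_contra hcon
  rw [Set.not_nonempty_iff_eq_empty] at hcon
  have hcD : ∀ v ∈ D, v ∉ B c := fun v hv hvc => by
    have : v ∈ D ∩ B c := ⟨hv, hvc⟩
    simp [hcon] at this
  have hc1' : o + 1 < c := lt_of_le_of_ne hc1 fun h' => by simp [← h', h1.ne_empty] at hcon
  have hc2' : c < o + s := lt_of_le_of_ne hc2 fun h' => by simp [h', h2.ne_empty] at hcon
  -- A connected set missing block `c` would have an edge from a block before `c` to a block after
  -- `c`, against locality.
  obtain ⟨u, ⟨hu, i, hi1, hi2, hui⟩, v, ⟨hv, hvA⟩, huv⟩ := hD.exists_exit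
    (A := {v | ∃ i, o + 1 ≤ i ∧ i < c ∧ v ∈ B i})
    (h1.imp fun v hv => ⟨hv.1, o + 1, le_rfl, hc1', hv.2⟩) (by
      intro hsub
      obtain ⟨v, hv, hv'⟩ := h2
      obtain ⟨i, hi1, hi2, hvi⟩ := hsub hv
      have := h.eq_of_mem (by omega) (by omega) hvi hv'
      omega)
  obtain ⟨j, hj1, hj2, hvj⟩ := mem_region.1 (hDY hv)
  have hjc : c < j := by
    by_contra hlt
    rcases Nat.lt_or_ge j c with h3 | h3
    · exact hvA ⟨j, hj1, h3, hvj⟩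
    · exact hcD v hv ((by omega : j = c) ▸ hvj)
  rcases hloc i (by omega) (by omega) u hui v huv with h3 | h3 | h3 | h3
  · exact Set.disjoint_left.1 (h.disjZ j (by omega)) hvj h3
  · have := h.eq_of_mem (by omega) (by omega) h3 hvj
    omega
  · have := h.eq_of_mem (by omega) (by omega) h3 hvj
    omega
  · have := h.eq_of_mem (by omega) (by omega) h3 hvj
    omega

theorem conn_region (h : HubChain G k Z n B) {o s : ℕ} (hs : 1 ≤ s) (hn : o + s < n) :
    Conn G (region B o s) := h.toChain.conn_Icc (by omega) hn

/-- Two disjoint connected sets running through many blocks yield a large ladder. -/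
theorem ladIn_of_links (h : HubChain G k Z n B) (hloc : Local G Z n B) {o : ℕ}
    (hn : o + (k * k + 1) + 1 < n) {D : Fin 2 → Set V} (hD : ∀ i, Conn G (D i))
    (hDY : ∀ i, D i ⊆ region B o (k * k + 1)) (hd : Disjoint (D 0) (D 1))
    (h1 : ∀ i, (D i ∩ B (o + 1)).Nonempty) (h2 : ∀ i, (D i ∩ B (o + (k * k + 1))).Nonempty) :
    LadIn G (k + 1) Set.univ := by
  have hpath : ∀ i, ∃ (l : ℕ) (p : ℕ → V), (∀ j ≤ l, p j ∈ D i) ∧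
      (∀ j < l, G.Adj (p j) (p (j + 1))) ∧ (∀ j ≤ l, ∀ j' ≤ l, p j = p j' → j = j') ∧
      ∀ c, o + 1 ≤ c → c ≤ o + (k * k + 1) → ∃ j ≤ l, p j ∈ B c := by
    intro i
    obtain ⟨a, ha, ha'⟩ := h1 i
    obtain ⟨b, hb, hb'⟩ := h2 i
    obtain ⟨l, p, rfl, rfl, hp, hadj, hinj⟩ := (hD i).exists_path ha hb
    refine ⟨l, p, hp, hadj, hinj, fun c hc1 hc2 => ?_⟩
    have hP := conn_iUnion_Icc (G := G) (fun j => {p j}) (Nat.zero_le l)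
      (fun j _ _ => conn_singleton _) (fun j _ hj => ⟨_, rfl, _, rfl, hadj j hj⟩)
    have hmem : ∀ v, v ∈ (⋃ j ∈ Set.Icc 0 l, {p j} : Set V) ↔ ∃ j ≤ l, v = p j := by
      intro v
      simp
    obtain ⟨v, hv, hvc⟩ := h.meets_block hloc hn hP (fun v hv => by
      obtain ⟨j, hj, rfl⟩ := (hmem v).1 hv
      exact hDY i (hp j hj)) ⟨p 0, (hmem _).2 ⟨0, by omega, rfl⟩, ha'⟩
      ⟨p l, (hmem _).2 ⟨l, le_rfl, rfl⟩, hb'⟩ hc1 hc2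
    obtain ⟨j, hj, rfl⟩ := (hmem v).1 hv
    exact ⟨j, hj, hvc⟩
  obtain ⟨l, p, hpD, hpadj, hpinj, hpB⟩ := hpath 0
  obtain ⟨l', q, hqD, hqadj, hqinj, hqB⟩ := hpath 1
  have hpq : ∀ i j, i ≤ l → j ≤ l' → p i ≠ q j := fun i j hi hj heq =>
    Set.disjoint_left.1 hd (hpD i hi) (heq ▸ hqD j hj)
  -- Both paths meet every block of the region, and the block, being connected, contains a link
  -- between them. Links in different blocks are disjoint and serve as rungs.
  have hlink : ∀ c : Fin (k * k + 1), ∃ (E : Set V) (α β : ℕ), E ⊆ B (o + 1 + c) ∧ Conn G E ∧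
      α ≤ l ∧ β ≤ l' ∧ p α ∈ E ∧ q β ∈ B (o + 1 + c) ∧ (∀ j ≤ l, p j ∈ E → j = α) ∧
      (∀ j ≤ l', q j ∉ E) ∧ Touch G E {q β} := by
    intro c
    have hc := c.2
    obtain ⟨i, hi, hiB⟩ := hpB (o + 1 + c) (by omega) (by omega)
    obtain ⟨j, hj, hjB⟩ := hqB (o + 1 + c) (by omega) (by omega)
    obtain ⟨E, hE, a, b, hEc, haE, ⟨α, hα, rfl⟩, hu, hEQ, hb, ⟨β, hβ, rfl⟩, d, hd, hdb⟩ :=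
      exists_link (P := {v | ∃ j ≤ l, p j = v}) (Q := {v | ∃ j ≤ l', q j = v})
        (h.conn (o + 1 + c) (by omega)) ⟨p i, hiB, i, hi, rfl⟩ ⟨q j, hjB, j, hj, rfl⟩ (by
          rw [Set.disjoint_left]
          rintro v ⟨i, hi, rfl⟩ ⟨j, hj, hji⟩
          exact hpq i j hi hj hji.symm)
    exact ⟨E, α, β, hE, hEc, hα, hβ, haE, hb, fun j hj hjE => hpinj j hj α hα (hu _ hjE ⟨j, hj, rfl⟩),
      fun j hj hjE => Set.disjoint_left.1 hEQ hjE ⟨j, hj, rfl⟩, d, hd, q β, rfl, hdb⟩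
  choose E α β hE hEc hα hβ hpE hqE hEu hEq hEt using hlink
  have hinjB : ∀ (i j : Fin (k * k + 1)) v, v ∈ B (o + 1 + i) → v ∈ B (o + 1 + j) → i = j := by
    intro i j v hi hj
    have := h.eq_of_mem (by omega) (by omega) hi hj
    exact Fin.ext (by omega)
  refine ladIn_of_rungs (ι := Fin (k * k + 1)) (U := fun j => {p j}) (a := l + 1)
    (W := fun j => {q j}) (b := l' + 1)
    ⟨fun j _ => conn_singleton _, fun i j hi hj hij => ?_,
      fun j hj => ⟨_, rfl, _, rfl, hpadj j (by omega)⟩⟩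
    ⟨fun j _ => conn_singleton _, fun i j hi hj hij => ?_,
      fun j hj => ⟨_, rfl, _, rfl, hqadj j (by omega)⟩⟩ ?_ α β E ?_ ?_
    (fun i => by have := hα i; omega) (fun i => by have := hβ i; omega) ?_ ?_ ?_ ?_ ?_ (by simp)
  · simpa using fun heq => hij (hpinj i (by omega) j (by omega) heq)
  · simpa using fun heq => hij (hqinj i (by omega) j (by omega) heq)
  · intro i j hi hj
    simpa using hpq i j (by omega) (by omega)
  · intro i j hij
    exact hinjB i j _ (hE i (hpE i)) (hE j (hij ▸ hpE j))
  · intro i j hij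
    exact hinjB i j _ (hqE i) (hij ▸ hqE j)
  · intro i
    rw [Set.union_eq_self_of_subset_right (by simpa using hpE i)]
    exact hEc i
  · intro i
    exact (hEt i).mono Set.subset_union_left subset_rfl
  · intro i j hij
    rw [Set.disjoint_left]
    intro v hv hv'
    exact hij (hinjB i j v (hE i hv) (hE j hv'))
  · intro i j hj hji
    simpa using fun hjE => hji (hEu i j (by omega) hjE)
  · intro i j hj
    simpa using hEq i j (by omega)

/-- A vertex `x` separating the region after block `o` into a left part `L` and a right
part `R`. -/
structure Cut (G : SimpleGraph V) (B : ℕ → Set V) (o s : ℕ) (x : V) (L R : Set V) : Prop where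
  union : L ∪ R = region B o s
  inter : L ∩ R = {x}
  edge : ∀ u ∈ L, ∀ v ∈ R, G.Adj u v → u = x ∨ v = x
  left : ∀ u ∈ region B o s, ∀ v ∈ B o, G.Adj u v → u ∈ L
  right : ∀ u ∈ region B o s, ∀ v ∈ B (o + s + 1), G.Adj u v → u ∈ R

theorem exists_cut [Finite V] (h : HubChain G k Z n B) (hloc : Local G Z n B) {o : ℕ}
    (hn : o + (k * k + 1) + 1 < n) :
    LadIn G (k + 1) Set.univ ∨ ∃ x L R, Cut G B o (k * k + 1) x L R := by
  have hY := h.conn_region (o := o) (s := k * k + 1) (by omega) (by omega)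
  obtain ⟨Y, hYdef⟩ : ∃ Y, Y = region B o (k * k + 1) := ⟨_, rfl⟩
  have hYmem : ∀ v, v ∈ Y ↔ ∃ i, o + 1 ≤ i ∧ i ≤ o + (k * k + 1) ∧ v ∈ B i := fun v => by
    rw [hYdef, mem_region]
  rw [← hYdef] at hY
  have hBY : ∀ i, o + 1 ≤ i → i ≤ o + (k * k + 1) → B i ⊆ Y := fun i h1 h2 v hv =>
    (hYmem v).2 ⟨i, h1, h2, hv⟩
  let P : Set V := {u | u ∈ Y ∧ ∃ v ∈ B o, G.Adj u v}
  let Q : Set V := {u | u ∈ Y ∧ ∃ v ∈ B (o + (k * k + 1) + 1), G.Adj u v}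
  have hP : ∀ u ∈ P, u ∈ B (o + 1) := by
    rintro u ⟨hu, v, hv, huv⟩
    obtain ⟨i, hi1, hi2, hui⟩ := (hYmem u).1 hu
    rcases hloc i (by omega) (by omega) u hui v huv with h3 | h3 | h3 | h3
    · exact absurd h3 (Set.disjoint_left.1 (h.disjZ o (by omega)) hv)
    · have := h.eq_of_mem (by omega) (by omega) h3 hv
      exact (by omega : i = o + 1) ▸ hui
    · have := h.eq_of_mem (by omega) (by omega) h3 hv
      omega
    · have := h.eq_of_mem (by omega) (by omega) h3 hv
      omega
  have hQ : ∀ u ∈ Q, u ∈ B (o + (k * k + 1)) := by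
    rintro u ⟨hu, v, hv, huv⟩
    obtain ⟨i, hi1, hi2, hui⟩ := (hYmem u).1 hu
    rcases hloc i (by omega) (by omega) u hui v huv with h3 | h3 | h3 | h3
    · exact absurd h3 (Set.disjoint_left.1 (h.disjZ _ (by omega)) hv)
    · have := h.eq_of_mem (by omega) (by omega) h3 hv
      omega
    · have := h.eq_of_mem (by omega) (by omega) h3 hv
      omega
    · have := h.eq_of_mem (by omega) (by omega) h3 hv
      exact (by omega : i = o + (k * k + 1)) ▸ hui
  -- Two disjoint connections across the region give the ladder. Otherwise a separation of order at
  -- most one exists, and its order inside the connected region is exactly one, which yields the cut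
  -- vertex.
  by_cases hsep : Unseparated (within G Y) 2 P Q
  · left
    obtain ⟨D, hD, hd, hDP, hDQ⟩ := menger _ _ _ hsep
    have hD' := fun i => (hD i).of_within ((hDP i).imp fun v hv => ⟨hv.1, hv.2.1⟩)
    exact h.ladIn_of_links hloc hn (fun i => (hD' i).2) (fun i => hYdef ▸ (hD' i).1)
      (hd 0 1 (by simp)) (fun i => (hDP i).imp fun v hv => ⟨hv.1, hP v hv.2⟩)
      (fun i => (hDQ i).imp fun v hv => ⟨hv.1, hQ v hv.2⟩)
  · right
    unfold Unseparated at hsep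
    push Not at hsep
    obtain ⟨X₁, X₂, hX, hPX, hQX, hlt⟩ := hsep
    have hcov : ∀ v, v ∈ X₁ ∨ v ∈ X₂ := fun v => by
      have := hX.cover ▸ Set.mem_univ v
      exact this
    have hPne : (Y ∩ X₁).Nonempty := by
      obtain ⟨v, hv, u, hu, hvu⟩ := h.touch o (by omega)
      have hu' := hBY (o + 1) le_rfl (by omega) hu
      exact ⟨u, hu', hPX ⟨hu', v, hv, hvu.symm⟩⟩
    have hQne : (Y ∩ X₂).Nonempty := by
      obtain ⟨u, hu, v, hv, huv⟩ := h.touch (o + (k * k + 1)) (by omega)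
      have hu' := hBY _ (by omega) le_rfl hu
      exact ⟨u, hu', hQX ⟨hu', v, hv, huv⟩⟩
    have hne : ∃ x ∈ Y, x ∈ X₁ ∩ X₂ := by
      by_contra hcon
      push Not at hcon
      obtain ⟨u, ⟨hu, hu1⟩, v, ⟨hv, hv1⟩, huv⟩ := hY.exists_exit hPne (fun hsub => by
        obtain ⟨v, hv, hv'⟩ := hQne
        exact hcon v hv ⟨hsub hv, hv'⟩)
      rcases hX.edge (u := u) (v := v) ⟨huv, hu, hv⟩ with h3 | h3
      · exact hv1 h3.2
      · exact hcon u hu ⟨hu1, h3.1⟩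
    obtain ⟨x, hxY, hx⟩ := hne
    have hxx : ∀ v, v ∈ X₁ → v ∈ X₂ → v = x := fun v h1 h2 =>
      (Set.ncard_le_one_iff (Set.toFinite _)).1 (by omega : (X₁ ∩ X₂).ncard ≤ 1) ⟨h1, h2⟩ hx
    refine ⟨x, X₁ ∩ Y, X₂ ∩ Y, ?_, ?_, ?_, ?_, ?_⟩
    · rw [← Set.union_inter_distrib_right, hX.cover, Set.univ_inter, hYdef]
    · ext v
      constructor
      · rintro ⟨h1, h2⟩
        exact hxx v h1.1 h2.1
      · rintro rfl
        exact ⟨⟨hx.1, hxY⟩, hx.2, hxY⟩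
    · rintro u ⟨hu, huY⟩ v ⟨hv, hvY⟩ huv
      rcases hX.edge (u := u) (v := v) ⟨huv, huY, hvY⟩ with h3 | h3
      · exact Or.inr (hxx v h3.2 hv)
      · exact Or.inl (hxx u hu h3.1)
    · intro u hu v hv huv
      rw [← hYdef] at hu
      exact ⟨hPX ⟨hu, v, hv, huv⟩, hu⟩
    · intro u hu v hv huv
      rw [← hYdef] at hu
      exact ⟨hQX ⟨hu, v, hv, huv⟩, hu⟩

theorem region_nbr (hloc : Local G Z n B) {o s : ℕ} (hn : o + s + 1 < n)
    {u v : V} (hu : u ∈ region B o s) (huv : G.Adj u v) :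
    v ∈ Z ∨ v ∈ B o ∨ v ∈ region B o s ∨ v ∈ B (o + s + 1) := by
  obtain ⟨i, hi1, hi2, hui⟩ := mem_region.1 hu
  have hreg : ∀ j, o ≤ j → j ≤ o + s + 1 → v ∈ B j →
      v ∈ B o ∨ v ∈ region B o s ∨ v ∈ B (o + s + 1) := by
    intro j hj1 hj2 hv
    rcases Nat.eq_or_lt_of_le hj1 with rfl | h1
    · exact Or.inl hv
    rcases Nat.eq_or_lt_of_le hj2 with rfl | h2
    · exact Or.inr (Or.inr hv)
    · exact Or.inr (Or.inl (mem_region.2 ⟨j, by omega, by omega, hv⟩))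
  rcases hloc i (by omega) (by omega) u hui v huv with h3 | h3 | h3 | h3
  · exact Or.inl h3
  · exact Or.inr (hreg _ (by omega) (by omega) h3)
  · exact Or.inr (hreg _ (by omega) (by omega) h3)
  · exact Or.inr (hreg _ (by omega) (by omega) h3)

/-- Cut vertices in regularly spaced regions of the chain give a path of hubs. -/
theorem exists_hubPath {s : ℕ} (h : HubChain G k Z n B) (hloc : Local G Z n B) (hs : 1 ≤ s)
    (hn : (m + 1) * (s + 1) < n) {x : ℕ → V} {L R : ℕ → Set V}
    (hcut : ∀ g ≤ m, Cut G B (g * (s + 1)) s (x g) (L g) (R g)) :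
    ∃ S, HubPath G k Z m x S := by
  have hpos : ∀ g ≤ m, g * (s + 1) + s + 1 < n := by
    intro g hg
    have h1 : (g + 1) * (s + 1) ≤ (m + 1) * (s + 1) := Nat.mul_le_mul_right _ (by omega)
    have h2 : (g + 1) * (s + 1) = g * (s + 1) + s + 1 := by ring
    omega
  have hsucc : ∀ g, (g + 1) * (s + 1) = g * (s + 1) + s + 1 := fun g => by ring
  -- Block `g * (s + 1)` is a divider and the next `s` blocks form the region of `x g`; division by
  -- `s + 1` recovers `g`.
  have hdiv : ∀ g i, g * (s + 1) ≤ i → i ≤ g * (s + 1) + s → i / (s + 1) = g := by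
    intro g i h1 h2
    rw [Nat.div_eq_iff (by omega)]
    rw [Nat.mul_comm] at h1 h2
    constructor
    · rw [Nat.mul_comm]; exact h1
    · rw [Nat.mul_comm g]; omega
  have hLreg : ∀ g ≤ m, L g ⊆ region B (g * (s + 1)) s := fun g hg =>
    (hcut g hg).union ▸ Set.subset_union_left
  have hRreg : ∀ g ≤ m, R g ⊆ region B (g * (s + 1)) s := fun g hg =>
    (hcut g hg).union ▸ Set.subset_union_right
  have hxL : ∀ g ≤ m, x g ∈ L g ∧ x g ∈ R g := fun g hg => by
    have : x g ∈ L g ∩ R g := (hcut g hg).inter ▸ rfl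
    exact this
  have hxx : ∀ g ≤ m, ∀ v, v ∈ L g → v ∈ R g → v = x g := fun g hg v h1 h2 => by
    have : v ∈ L g ∩ R g := ⟨h1, h2⟩
    rwa [(hcut g hg).inter] at this
  have hregreg : ∀ g h' v, g ≤ m → h' ≤ m → v ∈ region B (g * (s + 1)) s →
      v ∈ region B (h' * (s + 1)) s → g = h' := by
    intro g g' v hg hg' h1 h2
    obtain ⟨i, hi1, hi2, hi⟩ := mem_region.1 h1
    obtain ⟨j, hj1, hj2, hj⟩ := mem_region.1 h2
    have := hpos g hg
    have := hpos g' hg'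
    have hij := h.eq_of_mem (by omega) (by omega) hi hj
    subst hij
    rw [← hdiv g i (by omega) hi2, ← hdiv g' i (by omega) hj2]
  have hregB : ∀ g h' v, g ≤ m → h' ≤ m + 1 → v ∈ region B (g * (s + 1)) s →
      v ∉ B (h' * (s + 1)) := by
    intro g g' v hg hg' h1 h2
    obtain ⟨i, hi1, hi2, hi⟩ := mem_region.1 h1
    have := hpos g hg
    have h3 : g' * (s + 1) ≤ (m + 1) * (s + 1) := Nat.mul_le_mul_right _ hg'
    have hij := h.eq_of_mem (by omega) (by omega) hi h2
    have h4 := hdiv g i (by omega) hi2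
    rw [hij, Nat.mul_div_cancel _ (by omega)] at h4
    subst h4
    omega
  have hregZ : ∀ g ≤ m, ∀ v ∈ region B (g * (s + 1)) s, v ∉ Z := by
    intro g hg v hv
    obtain ⟨i, hi1, hi2, hi⟩ := mem_region.1 hv
    have := hpos g hg
    exact Set.disjoint_left.1 (h.disjZ i (by omega)) hi
  have hBn : ∀ g ≤ m, (g + 1) * (s + 1) < n := fun g hg => by
    have := hpos g hg
    rw [hsucc]
    omega
  -- Everything between `x g` and `x (g + 1)`: the right part of one region, the divider block, and
  -- the left part of the next region. It may be disconnected, so the segment is the component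
  -- containing the divider block.
  let W : ℕ → Set V := fun g =>
    (R g \ {x g} ∪ B ((g + 1) * (s + 1))) ∪ L (g + 1) \ {x (g + 1)}
  have hxW : ∀ g g', g < m → g' ≤ m → x g' ∉ W g := by
    rintro g g' hg hg' ((⟨h1, h2⟩ | h1) | ⟨h1, h2⟩)
    · exact h2 (by rw [hregreg g' g (x g') hg' (by omega) (hLreg _ hg' (hxL _ hg').1)
        (hRreg g (by omega) h1)]; rfl)
    · exact hregB g' (g + 1) _ hg' (by omega) (hLreg _ hg' (hxL _ hg').1) h1
    · exact h2 (by rw [hregreg g' (g + 1) (x g') hg' (by omega) (hLreg _ hg' (hxL _ hg').1)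
        (hLreg (g + 1) (by omega) h1)]; rfl)
  have hWZ : ∀ g < m, ∀ v ∈ W g, v ∉ Z := by
    rintro g hg v ((⟨h1, -⟩ | h1) | ⟨h1, -⟩)
    · exact hregZ g (by omega) v (hRreg g (by omega) h1)
    · exact Set.disjoint_left.1 (h.disjZ _ (hBn g (by omega))) h1
    · exact hregZ (g + 1) (by omega) v (hLreg (g + 1) (by omega) h1)
  have hWnbr : ∀ g < m, ∀ u ∈ W g, ∀ v, G.Adj u v → v ∈ W g ∨ v ∈ Z ∨ v = x g ∨ v = x (g + 1) := by
    intro g hg u hu v huv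
    have hR : v ∈ R g → v ∈ W g ∨ v ∈ Z ∨ v = x g ∨ v = x (g + 1) := fun hv => by
      by_cases hvx : v = x g
      · exact Or.inr (Or.inr (Or.inl hvx))
      · exact Or.inl (Or.inl (Or.inl ⟨hv, hvx⟩))
    have hL : v ∈ L (g + 1) → v ∈ W g ∨ v ∈ Z ∨ v = x g ∨ v = x (g + 1) := fun hv => by
      by_cases hvx : v = x (g + 1)
      · exact Or.inr (Or.inr (Or.inr hvx))
      · exact Or.inl (Or.inr ⟨hv, hvx⟩)
    rcases hu with (⟨hu, hux⟩ | hu) | ⟨hu, hux⟩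
    · have hur := hRreg g (by omega) hu
      rcases region_nbr hloc (hpos g (by omega)) hur huv with h1 | h1 | h1 | h1
      · exact Or.inr (Or.inl h1)
      · exact absurd (hxx g (by omega) u ((hcut g (by omega)).left u hur v h1 huv) hu) hux
      · rw [← (hcut g (by omega)).union] at h1
        rcases h1 with h1 | h1
        · rcases (hcut g (by omega)).edge v h1 u hu huv.symm with h2 | h2
          · exact Or.inr (Or.inr (Or.inl h2))
          · exact absurd h2 hux
        · exact hR h1
      · rw [← hsucc] at h1
        exact Or.inl (Or.inl (Or.inr h1))
    · have h1 := hpos (g + 1) (by omega)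
      have h0 := hsucc g
      rcases hloc ((g + 1) * (s + 1)) (by omega) (by omega) u hu v huv with h2 | h2 | h2 | h2
      · exact Or.inr (Or.inl h2)
      · refine hR ((hcut g (by omega)).right v (mem_region.2 ⟨_, ?_, ?_, h2⟩) u ?_ huv.symm)
        · omega
        · omega
        · rwa [← hsucc]
      · exact Or.inl (Or.inl (Or.inr h2))
      · exact hL ((hcut (g + 1) (by omega)).left v (mem_region.2 ⟨_, by omega, by omega, h2⟩) u hu
          huv.symm)
    · have hur := hLreg (g + 1) (by omega) hu
      rcases region_nbr hloc (hpos (g + 1) (by omega)) hur huv with h1 | h1 | h1 | h1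
      · exact Or.inr (Or.inl h1)
      · exact Or.inl (Or.inl (Or.inr h1))
      · rw [← (hcut (g + 1) (by omega)).union] at h1
        rcases h1 with h1 | h1
        · exact hL h1
        · rcases (hcut (g + 1) (by omega)).edge u hu v h1 huv with h2 | h2
          · exact absurd h2 hux
          · exact Or.inr (Or.inr (Or.inr h2))
      · exact absurd (hxx (g + 1) (by omega) u hu ((hcut (g + 1) (by omega)).right u hur v h1 huv))
          hux
  have hb : ∀ g, ∃ b, g < m → b ∈ B ((g + 1) * (s + 1)) := by
    intro g
    by_cases hg : g < m
    · obtain ⟨b, hb⟩ := (h.conn _ (hBn g hg.le)).1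
      exact ⟨b, fun _ => hb⟩
    · exact ⟨x 0, fun h' => absurd h' hg⟩
  choose b hb using hb
  have hBW : ∀ g, B ((g + 1) * (s + 1)) ⊆ W g := fun g v hv => Or.inl (Or.inr hv)
  have hSW : ∀ g, comp G (W g) (b g) ⊆ W g := fun g => comp_subset _
  have hBS : ∀ g < m, B ((g + 1) * (s + 1)) ⊆ comp G (W g) (b g) := fun g hg =>
    subset_comp (h.conn _ (hBn g hg.le)) (hBW g) (hb g hg)
  have hSnbr : ∀ g < m, ∀ u ∈ comp G (W g) (b g), ∀ v, G.Adj u v →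
      v ∈ comp G (W g) (b g) ∨ v ∈ Z ∨ v = x g ∨ v = x (g + 1) := by
    intro g hg u hu v huv
    rcases hWnbr g hg u (hSW g hu) v huv with h1 | h1
    · exact Or.inl (comp_closed (hBW g (hb g hg)) hu h1 huv)
    · exact Or.inr h1
  refine ⟨fun g => comp G (W g) (b g), ?_, ?_, ?_, ?_, ?_, ?_, hSnbr, ?_, ?_, ?_, ?_⟩
  · intro g g' hg hg' heq
    exact hregreg g g' (x g) hg hg' (hLreg g hg (hxL g hg).1) (heq ▸ hLreg g' hg' (hxL g' hg').1)
  · intro g hg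
    exact hregZ g hg _ (hLreg g hg (hxL g hg).1)
  · intro g hg
    exact conn_comp (hBW g (hb g hg))
  · intro g g' hg hg' hne
    refine Disjoint.mono (hSW g) (hSW g') ?_
    rw [Set.disjoint_left]
    rintro v ((⟨h1, h2⟩ | h1) | ⟨h1, h2⟩) ((⟨h3, h4⟩ | h3) | ⟨h3, h4⟩)
    · exact hne (hregreg _ _ v (by omega) (by omega) (hRreg g (by omega) h1)
        (hRreg g' (by omega) h3))
    · exact hregB g _ v (by omega) (by omega) (hRreg g (by omega) h1) h3
    · have := hregreg _ _ v (by omega) (by omega) (hRreg g (by omega) h1)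
        (hLreg (g' + 1) (by omega) h3)
      subst this
      exact h2 (hxx _ (by omega) v h3 h1)
    · exact hregB g' _ v (by omega) (by omega) (hRreg g' (by omega) h3) h1
    · have h5 := h.eq_of_mem (hBn g (by omega)) (hBn g' (by omega)) h1 h3
      have := Nat.eq_of_mul_eq_mul_right (by omega : 0 < s + 1) h5
      omega
    · exact hregB (g' + 1) _ v (by omega) (by omega) (hLreg (g' + 1) (by omega) h3) h1
    · have := hregreg _ _ v (by omega) (by omega) (hLreg (g + 1) (by omega) h1)
        (hRreg g' (by omega) h3)
      subst this
      exact h2 (hxx _ (by omega) v h1 h3)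
    · exact hregB (g + 1) _ v (by omega) (by omega) (hLreg (g + 1) (by omega) h1) h3
    · have := hregreg _ _ v (by omega) (by omega) (hLreg (g + 1) (by omega) h1)
        (hLreg (g' + 1) (by omega) h3)
      omega
  · intro g hg
    rw [Set.disjoint_left]
    exact fun v hv => hWZ g hg v (hSW g hv)
  · intro g g' hg hg' hmem
    exact hxW g g' hg hg' (hSW g hmem)
  · intro g hg
    have hT := h.conn_region (o := g * (s + 1)) (s := s + 1) (by omega) (hpos g (by omega))
    have hsub : region B (g * (s + 1)) s ⊆ region B (g * (s + 1)) (s + 1) := fun v hv => by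
      obtain ⟨i, h1, h2, h3⟩ := mem_region.1 hv
      exact mem_region.2 ⟨i, h1, by omega, h3⟩
    have hsup : ∀ v ∈ region B (g * (s + 1)) (s + 1), v ∈ region B (g * (s + 1)) s ∨
        v ∈ B ((g + 1) * (s + 1)) := fun v hv => by
      obtain ⟨i, h1, h2, h3⟩ := mem_region.1 hv
      rcases Nat.eq_or_lt_of_le h2 with rfl | h2
      · right
        rw [hsucc]
        exact h3
      · exact Or.inl (mem_region.2 ⟨i, h1, by omega, h3⟩)
    have hxT := hsub (hLreg g (by omega) (hxL g (by omega)).1)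
    -- The region together with the divider block is connected and contains `x g`, so some edge
    -- leaves the segment inside it. Its outer end cannot be a hub or `x (g + 1)`, hence it is `x
    -- g`.
    obtain ⟨u, ⟨-, hu⟩, v, ⟨hv, hvS⟩, huv⟩ := hT.exists_exit (A := comp G (W g) (b g))
      ⟨b g, mem_region.2 ⟨(g + 1) * (s + 1), by rw [hsucc]; omega, by rw [hsucc]; omega, hb g hg⟩,
        hBS g hg (hb g hg)⟩ (fun hsub' => hxW g g hg (by omega) (hSW g (hsub' hxT)))
    refine ⟨u, hu, x g, rfl, ?_⟩
    rcases hSnbr g hg u hu v huv with h1 | h1 | h1 | h1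
    · exact absurd h1 hvS
    · rcases hsup v hv with h2 | h2
      · exact absurd h1 (hregZ g (by omega) v h2)
      · exact absurd h1 (hWZ g hg v (hBW g h2))
    · exact h1 ▸ huv
    · have h3 := hLreg (g + 1) (by omega) (hxL (g + 1) (by omega)).1
      rw [← h1] at h3
      rcases hsup v hv with h2 | h2
      · have := hregreg _ _ v (by omega) (by omega) h2 h3
        omega
      · exact absurd h2 (hregB _ _ v (by omega) (by omega) h3)
  · intro g hg
    have h0 := hpos (g + 1) (by omega)
    have h00 := hsucc g
    have hT := h.toChain.conn_Icc (i := (g + 1) * (s + 1)) (j := (g + 1) * (s + 1) + s) (by omega)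
      (by omega)
    have hmem : ∀ v, v ∈ (⋃ i ∈ Set.Icc ((g + 1) * (s + 1)) ((g + 1) * (s + 1) + s), B i) ↔
        v ∈ B ((g + 1) * (s + 1)) ∨ v ∈ region B ((g + 1) * (s + 1)) s := by
      intro v
      rw [mem_region]
      simp only [Set.mem_iUnion, Set.mem_Icc, exists_prop]
      constructor
      · rintro ⟨i, ⟨h1, h2⟩, h3⟩
        rcases Nat.eq_or_lt_of_le h1 with rfl | h1
        · exact Or.inl h3
        · exact Or.inr ⟨i, h1, h2, h3⟩
      · rintro (h3 | ⟨i, h1, h2, h3⟩)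
        · exact ⟨_, ⟨le_rfl, by omega⟩, h3⟩
        · exact ⟨i, ⟨by omega, h2⟩, h3⟩
    obtain ⟨u, ⟨-, hu⟩, v, ⟨hv, hvS⟩, huv⟩ := hT.exists_exit (A := comp G (W g) (b g))
      ⟨b g, (hmem _).2 (Or.inl (hb g hg)), hBS g hg (hb g hg)⟩ (fun hsub' =>
        hxW g (g + 1) hg (by omega) (hSW g (hsub' ((hmem _).2
          (Or.inr (hLreg (g + 1) (by omega) (hxL (g + 1) (by omega)).1))))))
    refine ⟨u, hu, x (g + 1), rfl, ?_⟩
    rcases hSnbr g hg u hu v huv with h1 | h1 | h1 | h1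
    · exact absurd h1 hvS
    · rcases (hmem v).1 hv with h2 | h2
      · exact absurd h1 (hWZ g hg v (hBW g h2))
      · exact absurd h1 (hregZ (g + 1) (by omega) v h2)
    · have h3 := hLreg g (by omega) (hxL g (by omega)).1
      rw [← h1] at h3
      rcases (hmem v).1 hv with h2 | h2
      · exact absurd h2 (hregB _ _ v (by omega) (by omega) h3)
      · have := hregreg _ _ v (by omega) (by omega) h2 h3
        omega
    · exact h1 ▸ huv
  · intro g hg z hz
    exact (h.touchZ _ (hBn g (by omega)) z hz).mono (hBS g hg) subset_rfl
  · intro g hg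
    exact (h.lad _ (hBn g (by omega))).mono le_rfl (hBS g hg)

end HubChain

/-- Long chains of blocks with common hubs contain a larger ladder. -/
theorem Forces.exists_chain {k t m : ℕ} (hk : 2 ≤ k) (hF : Forces.{u} k (t + 1) m) :
    ∃ n, ∀ (V : Type u) [Finite V] (G : SimpleGraph V) (Z : Set V) (B : ℕ → Set V),
      IsKConnected G 3 → Z.ncard = t → HubChain G k Z n B → LadIn G (k + 1) Set.univ := by
  obtain ⟨M, hM⟩ : ∃ M, M = 3 * ((t + 2) * (t + 2) * (t + 2) * ((k + 1) * (k + 1)) + 1) + 2 :=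
    ⟨_, rfl⟩
  -- The base of the power is the length of local chain needed for the cut vertices `x 0, ..., x M`,
  -- spaced by `k * k + 2`; the exponent is the price of locality in `exists_local`.
  refine ⟨((M + 1) * (k * k + 1 + 1) + 1) ^ (k * k * (2 * (m + 1) ^ (k * k)) + 1),
    fun V _ G Z B hG hZ h => ?_⟩
  rcases h.exists_local hG hZ (by omega : 1 ≤ m + 1) (hF.mono (by omega)) le_rfl with hl | ⟨B', h, hloc⟩
  · exact hl
  by_contra hcon
  have hcut : ∀ g, ∃ x L R, g ≤ M → HubChain.Cut G B' (g * (k * k + 1 + 1)) (k * k + 1) x L R := by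
    intro g
    by_cases hg : g ≤ M
    · have h1 : (g + 1) * (k * k + 1 + 1) ≤ (M + 1) * (k * k + 1 + 1) :=
        Nat.mul_le_mul_right _ (by omega)
      have h2 : (g + 1) * (k * k + 1 + 1) = g * (k * k + 1 + 1) + (k * k + 1) + 1 := by ring
      obtain ⟨x, L, R, hx⟩ := (h.exists_cut hloc (o := g * (k * k + 1 + 1)) (by omega)).resolve_left
        hcon
      exact ⟨x, L, R, fun _ => hx⟩
    · obtain ⟨x, -⟩ := (h.conn 0 (by omega)).1
      exact ⟨x, ∅, ∅, fun h' => absurd h' hg⟩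
  choose x L R hcut using hcut
  obtain ⟨S, hS⟩ := h.exists_hubPath hloc (by omega) (by omega) hcut
  exact hcon (hS.ladIn hk hG (t := t) hZ.le (by omega))

end LadderMinor

/-! ### The induction on the number of hubs, and the case of one rung. -/

namespace LadderMinor

universe u

variable {V : Type u} {G : SimpleGraph V}

/-- `k + 1` blocks with `k + 1` common hubs contain `K_{k+1,k+1}`, hence the ladder. -/
theorem forces_succ (k : ℕ) : Forces.{u} k (k + 1) (k + 1) := by
  intro V _ G Z B _ hZ h
  obtain ⟨z⟩ : Nonempty (Fin (k + 1) ≃ Z) :=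
    ⟨(Finite.equivFinOfCardEq (by rw [Nat.card_coe_set_eq, hZ])).symm⟩
  -- Column `j` consists of the block and the hub of index `j`, with the rows exchanged in alternate
  -- columns. Every edge of the ladder then joins a block to a hub.
  let f : Bool → ℕ → Set V := fun b j =>
    if hj : j < k + 1 then (if b = decide (j % 2 = 0) then B ⟨j, hj⟩ else {(z ⟨j, hj⟩ : V)}) else ∅
  have hf : ∀ b j (hj : j < k + 1), f b j =
      if b = decide (j % 2 = 0) then B ⟨j, hj⟩ else {(z ⟨j, hj⟩ : V)} := fun b j hj => dif_pos hj
  have hBz : ∀ i j, Disjoint (B i) {(z j : V)} := fun i j => by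
    simpa using Set.disjoint_right.1 (h.disjZ i) (z j).2
  refine ⟨f, ⟨?_, ?_, ?_, ?_⟩, fun _ _ _ => Set.subset_univ _⟩
  · intro b j hj
    rw [hf b j hj]
    split_ifs
    · exact h.conn _
    · exact conn_singleton _
  · intro b j b' j' hj hj' hne
    rw [hf b j hj, hf b' j' hj']
    split_ifs with h1 h2 h2
    · refine h.disj _ _ fun heq => hne ?_
      rw [Fin.mk.injEq] at heq
      subst heq
      rw [h1, h2]
    · exact hBz _ _
    · exact (hBz _ _).symm
    · rw [Set.disjoint_singleton]
      intro heq
      have h3 := z.injective (Subtype.ext heq)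
      rw [Fin.mk.injEq] at h3
      subst h3
      refine hne ?_
      revert h1 h2
      cases b <;> cases b' <;> cases decide (j % 2 = 0) <;> simp
  · intro j hj
    rw [hf _ j hj, hf _ j hj]
    have ht := h.touchZ ⟨j, hj⟩ _ (z ⟨j, hj⟩).2
    cases decide (j % 2 = 0)
    · simpa using ht.symm
    · simpa using ht
  · intro b j hj
    rw [hf _ j (by omega), hf _ (j + 1) hj]
    have h1 := h.touchZ ⟨j, by omega⟩ _ (z ⟨j + 1, hj⟩).2
    have h2 := h.touchZ ⟨j + 1, hj⟩ _ (z ⟨j, by omega⟩).2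
    have h3 : decide ((j + 1) % 2 = 0) = !decide (j % 2 = 0) := by
      rw [Bool.eq_iff_iff]
      simp
      omega
    rw [h3]
    cases b <;> cases decide (j % 2 = 0)
    · simpa using h1
    · simpa using h2.symm
    · simpa using h2.symm
    · simpa using h1

/-- The graph of touching blocks. -/
def quotientGraph {ι : Type*} (G : SimpleGraph V) (B : ι → Set V) : SimpleGraph ι where
  Adj i j := i ≠ j ∧ Touch G (B i) (B j)
  symm := ⟨fun _ _ h => ⟨h.1.symm, h.2.symm⟩⟩
  loopless := ⟨fun _ h => h.1 rfl⟩

theorem Forces.exists_pred {k t m : ℕ} (hk : 2 ≤ k) (hF : Forces.{u} k (t + 1) m) :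
    ∃ n, Forces.{u} k t n := by
  classical
  obtain ⟨n₂, hn₂⟩ := hF.exists_chain hk
  obtain ⟨D, hDdef⟩ : ∃ D, D = (m + 1) ^ n₂ := ⟨_, rfl⟩
  have hD1 : 1 ≤ D := hDdef ▸ Nat.one_le_pow _ _ (by omega)
  obtain ⟨c, hc⟩ : ∃ c, c = t * t * t * ((k + 1) * (k + 1)) + 2 := ⟨_, rfl⟩
  -- `D` bounds the number of blocks touching a given one, `(D + 1) ^ n₂` blocks in one component
  -- contain a path long enough for a chain, and `c` components suffice for `ladIn_of_isolated`.
  refine ⟨c * (D + 1) ^ n₂ + 1, ?_⟩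
  intro V _ G Z B₀ hG hZ h₀
  by_contra hcon
  obtain ⟨B, h, -, hnbr⟩ := h₀.absorb
  have hdeg : ∀ i, {j | (quotientGraph G B).Adj i j}.ncard ≤ D := by
    intro i
    by_contra hlt
    push Not at hlt
    rw [Set.ncard_eq_toFinset_card _ (Set.toFinite _)] at hlt
    obtain ⟨a, ha⟩ := (h.conn i).1
    have hs : ∀ j ∈ (Set.toFinite {j | (quotientGraph G B).Adj i j}).toFinset,
        i ≠ j ∧ Touch G (B i) (B j) := fun j hj => by
      rw [Set.Finite.mem_toFinset] at hj
      exact hj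
    rcases starIn_or_combIn (G := G) B (by omega : 1 ≤ m + 1) (B i) n₂ a _ (h.conn i) ha
      (fun j _ => h.conn j) (fun j _ l _ hjl => h.disj j l hjl)
      (fun j hj => h.disj j i (hs j hj).1.symm) (fun j hj => (hs j hj).2) (hDdef.symm.trans_lt hlt) with
      hst | ⟨X, e, hX, -, hXB, hes, hinj, ht⟩
    · exact hcon (hst.ladIn (hF.mono (by omega)) hG hZ (h.disjZ i)
        (fun j hj => h.disj j i (hs j hj).1.symm) (fun j _ => h.disjZ j) (fun j _ => h.touchZ j)
        (fun j _ => h.lad j))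
    -- Each piece of the comb is united with the block it touches, which makes the comb a chain of
    -- blocks with the same hubs.
    · refine hcon (hn₂ V G Z (fun j => X j ∪ B (e j)) hG hZ ⟨⟨?_, ?_, ?_⟩, ?_, ?_, ?_⟩)
      · intro j hj
        exact (hX.conn j (by omega)).union_touch (h.conn _) (ht j (by omega))
      · intro j l hj hl hjl
        have hXe : ∀ j l, j < n₂ → l < n₂ → Disjoint (X j) (B (e l)) := fun j l hj hl =>
          (h.disj i (e l) (hs _ (hes l (by omega))).1).mono_left (hXB j (by omega))
        simp only [Set.disjoint_union_left, Set.disjoint_union_right]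
        exact ⟨⟨hX.disj _ _ (by omega) (by omega) hjl, (hXe l j hl hj).symm⟩, hXe j l hj hl,
          h.disj _ _ fun heq => hjl (hinj _ _ (by omega) (by omega) heq)⟩
      · intro j hj
        exact (hX.touch j (by omega)).mono Set.subset_union_left Set.subset_union_left
      · intro j hj
        rw [Set.disjoint_union_left]
        exact ⟨(h.disjZ i).mono_left (hXB j (by omega)), h.disjZ _⟩
      · intro j hj z hz
        exact (h.touchZ _ z hz).mono Set.subset_union_right subset_rfl
      · intro j hj
        exact (h.lad _).mono le_rfl Set.subset_union_right
  let K : Fin (c * (D + 1) ^ n₂ + 1) → Set (Fin (c * (D + 1) ^ n₂ + 1)) :=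
    comp (quotientGraph G B) Set.univ
  have hmem : ∀ i, i ∈ K i := fun i => mem_comp (Set.mem_univ i)
  have hKeq : ∀ i j, j ∈ K i → K j = K i := fun i j hj => comp_eq (Set.mem_univ i) hj
  -- After absorption, the union of a component of blocks has outer neighbours only in `Z`. Either
  -- there are `c` such unions, or one component is large.
  by_cases hcard : c ≤ (Finset.univ.image K).card
  · obtain ⟨T, hT, hTc⟩ := Finset.exists_subset_card_eq hcard
    let f := T.equivFinOfCardEq hTc
    have hpre : ∀ j : Fin c, ∃ i, K i = (f.symm j : Set _) := fun j => by
      obtain ⟨i, -, hi⟩ := Finset.mem_image.1 (hT (f.symm j).2)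
      exact ⟨i, hi⟩
    choose e he using hpre
    refine hcon (ladIn_of_isolated hk hG hZ.le (X := fun a => ⋃ i ∈ K (e a), B i)
      (fun a => (h.lad (e a)).mono le_rfl (Set.subset_biUnion_of_mem (u := B) (hmem _)))
      ?_ ?_ ?_ (by omega : t * t * t * ((k + 1) * (k + 1)) + 1 < c))
    · intro a b hab
      simp only [Set.disjoint_iUnion_left, Set.disjoint_iUnion_right]
      intro i hi j hj
      refine h.disj _ _ ?_
      rintro rfl
      have h1 := (hKeq _ _ hj).symm.trans (hKeq _ _ hi)
      rw [he, he] at h1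
      exact hab (f.symm.injective (Subtype.ext h1))
    · intro a
      simp only [Set.disjoint_iUnion_left]
      exact fun i _ => h.disjZ i
    · intro a u hu v huv
      simp only [Set.mem_iUnion, exists_prop] at hu ⊢
      obtain ⟨i, hi, hui⟩ := hu
      rcases hnbr i u hui v huv with hv | ⟨j, hj⟩
      · exact Or.inr hv
      · left
        by_cases hij : i = j
        · subst hij
          exact ⟨i, hi, hj⟩
        · exact ⟨j, comp_closed (Set.mem_univ _) hi (Set.mem_univ _)
            ⟨hij, u, hui, v, hj, huv⟩, hj⟩
  · obtain ⟨y, hy, hfib⟩ := Finset.exists_lt_card_fiber_of_mul_lt_card_of_maps_to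
      (s := Finset.univ) (t := Finset.univ.image K) (f := K) (n := (D + 1) ^ n₂)
      (fun i hi => Finset.mem_image_of_mem _ hi) (by
        rw [Finset.card_univ, Fintype.card_fin]
        exact Nat.lt_succ_of_le (Nat.mul_le_mul_right _ (by omega)))
    obtain ⟨i, -, rfl⟩ := Finset.mem_image.1 hy
    have hlarge : (D + 1) ^ n₂ ≤ (K i).ncard := by
      refine hfib.le.trans ?_
      rw [← Set.ncard_coe_finset]
      refine Set.ncard_le_ncard (fun j hj => ?_) (Set.toFinite _)
      simp only [Finset.coe_filter, Finset.mem_univ, true_and, Set.mem_ofPred_eq] at hj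
      exact hj ▸ hmem j
    obtain ⟨p, -, -, hadj, hinj⟩ := (conn_comp (Set.mem_univ i)).exists_long_path hD1 hdeg n₂
      (hmem i) hlarge
    exact hcon (hn₂ V G Z (fun j => B (p j)) hG hZ ⟨⟨fun j _ => h.conn _, fun j l hj hl hjl =>
      h.disj _ _ fun heq => hjl (hinj _ _ hj.le hl.le heq), fun j hj => (hadj j (by omega)).2⟩,
      fun j _ => h.disjZ _, fun j _ => h.touchZ _, fun j _ => h.lad _⟩)

/-- Downward induction starting with `k + 1` hubs; `d` counts the hubs given up. -/
theorem exists_forces_zero {k : ℕ} (hk : 2 ≤ k) : ∃ n, Forces.{u} k 0 n := by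
  have h : ∀ d ≤ k + 1, ∃ n, Forces.{u} k (k + 1 - d) n := by
    intro d
    induction d with
    | zero => exact fun _ => ⟨k + 1, forces_succ k⟩
    | succ d ih =>
      intro hd
      obtain ⟨m, hm⟩ := ih (by omega)
      rw [show k + 1 - d = k + 1 - (d + 1) + 1 by omega] at hm
      exact hm.exists_pred hk
  simpa using h (k + 1) le_rfl

/-- Two disjoint edges in a `3`-connected graph lie in a model of the ladder with two rungs. -/
theorem ladIn_two_of_disjoint_edges [Finite V] (hG : IsKConnected G 3) {a b c d : V}
    (hab : G.Adj a b) (hcd : G.Adj c d) (hdisj : Disjoint ({a, b} : Set V) {c, d}) :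
    LadIn G 2 Set.univ := by
  have hsep : Unseparated G 2 {a, b} {c, d} := by
    intro X Y hXY hX hY
    by_contra hlt
    have hfin : ((X ∩ Y).ncard : ℕ∞) = (X ∩ Y).encard := (Set.toFinite _).cast_ncard_eq
    have hlt' : (X ∩ Y).encard < ((3 : ℕ) : ℕ∞) := by
      rw [← hfin]
      exact_mod_cast (by omega : (X ∩ Y).ncard < 3)
    rcases hG.2 X Y hXY hlt' with rfl | rfl
    · have := Set.ncard_le_ncard hY (Set.toFinite _)
      rw [Set.ncard_pair hcd.ne] at this
      simp only [Set.univ_inter] at hlt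
      omega
    · have := Set.ncard_le_ncard hX (Set.toFinite _)
      rw [Set.ncard_pair hab.ne] at this
      simp only [Set.inter_univ] at hlt
      omega
  obtain ⟨D, hD, hd, hDA, hDC⟩ := menger _ _ _ hsep
  have hD01 := hd 0 1 (by simp)
  have hadj : ∀ {x y : V}, G.Adj x y → (∀ i, (D i ∩ {x, y}).Nonempty) →
      ∃ p q, p ∈ D 0 ∧ q ∈ D 1 ∧ G.Adj p q ∧ p ∈ ({x, y} : Set V) ∧ q ∈ ({x, y} : Set V) := by
    intro x y hxy hne
    obtain ⟨p, hp, hp'⟩ := hne 0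
    obtain ⟨q, hq, hq'⟩ := hne 1
    refine ⟨p, q, hp, hq, ?_, hp', hq'⟩
    have hpq : p ≠ q := by
      rintro rfl
      exact Set.disjoint_left.1 hD01 hp hq
    rcases hp' with rfl | rfl <;> rcases hq' with rfl | rfl
    · exact absurd rfl hpq
    · exact hxy
    · exact hxy.symm
    · exact absurd rfl hpq
  obtain ⟨p, q, hp, hq, hpq, hp', hq'⟩ := hadj hab hDA
  obtain ⟨r, s, hr, hs, hrs, hr', hs'⟩ := hadj hcd hDC
  -- Two disjoint connections between the edges, each split between its two ends, give the four
  -- branch sets; the given edges become the rungs.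
  obtain ⟨P, R, hPR, hPRd, hP, hR, hpP, hrR⟩ := (hD 0).exists_split hp hr (by
    rintro rfl
    exact Set.disjoint_left.1 hdisj hp' hr')
  obtain ⟨Q, S, hQS, hQSd, hQ, hS, hqQ, hsS⟩ := (hD 1).exists_split hq hs (by
    rintro rfl
    exact Set.disjoint_left.1 hdisj hq' hs')
  have hPRt := (hD 0).touch_of_union_eq hPR hP.1 hR.1 hPRd
  have hQSt := (hD 1).touch_of_union_eq hQS hQ.1 hS.1 hQSd
  rw [← hPR, ← hQS] at hD01
  simp only [Set.disjoint_union_left, Set.disjoint_union_right] at hD01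
  obtain ⟨⟨h1, h2⟩, h3, h4⟩ := hD01
  refine ⟨fun b j => if b then (if j = 0 then P else R) else (if j = 0 then Q else S),
    ⟨?_, ?_, ?_, ?_⟩, fun _ _ _ => Set.subset_univ _⟩
  · intro b j hj
    cases b <;> interval_cases j <;> simpa
  · intro b j b' j' hj hj' hne
    cases b <;> cases b' <;> interval_cases j <;> interval_cases j' <;>
      first
      | exact absurd rfl hne
      | simpa using hPRd
      | simpa using hPRd.symm
      | simpa using hQSd
      | simpa using hQSd.symm
      | simp [h1, h2, h3, h4, h1.symm, h2.symm, h3.symm, h4.symm]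
  · intro j hj
    interval_cases j
    · exact ⟨p, by simpa using hpP, q, by simpa using hqQ, hpq⟩
    · exact ⟨r, by simpa using hrR, s, by simpa using hsS, hrs⟩
  · intro b j hj
    obtain rfl : j = 0 := by omega
    cases b
    · simpa using hQSt
    · simpa using hPRt

theorem LadIn.exists_adj {k : ℕ} (hk : 1 ≤ k) {X : Set V} (h : LadIn G k X) :
    ∃ a b, a ∈ X ∧ b ∈ X ∧ G.Adj a b := by
  obtain ⟨f, hf, hfX⟩ := h
  obtain ⟨a, ha, b, hb, hab⟩ := hf.rung 0 (by omega)
  exact ⟨a, b, hfX _ _ (by omega) ha, hfX _ _ (by omega) hb, hab⟩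

end LadderMinor

theorem theorem2 (k : ℕ) (hk : 1 ≤ k) :
    ∃ N : ℕ, 1 ≤ N ∧
      ∀ (V : Type*) [Finite V] (G : SimpleGraph V),
        LadderMinor.IsKConnected G 3 →
        LadderMinor.IsMinor (LadderMinor.disjointCopies N (LadderMinor.ladder k)) G →
        LadderMinor.IsMinor (LadderMinor.ladder (k + 1)) G := by
  -- A ladder with one rung has only two vertices, too few for three disjoint paths to leave it, so
  -- `k = 1` is handled directly with two disjoint edges.
  rcases Nat.eq_or_lt_of_le hk with rfl | hk2
  · refine ⟨2, by omega, fun V _ G hG hM => ?_⟩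
    obtain ⟨B, -, hd, hl⟩ := LadderMinor.exists_blocks le_rfl hM
    obtain ⟨a, b, ha, hb, hab⟩ := (hl 0).exists_adj le_rfl
    obtain ⟨c, d, hc, hd', hcd⟩ := (hl 1).exists_adj le_rfl
    refine LadderMinor.isMinor_ladder (LadderMinor.ladIn_two_of_disjoint_edges hG hab hcd ?_)
    refine (hd 0 1 (by simp)).mono ?_ ?_
    · rintro x (rfl | rfl)
      · exact ha
      · exact hb
    · rintro x (rfl | rfl)
      · exact hc
      · exact hd'
  · obtain ⟨n, hn⟩ := LadderMinor.exists_forces_zero hk2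
    refine ⟨n + 1, by omega, fun V _ G hG hM => ?_⟩
    obtain ⟨B, hB, hd, hl⟩ := LadderMinor.exists_blocks hk hM
    -- The induction is applied with no hubs; the extra copy only ensures that `N` is positive.
    exact LadderMinor.isMinor_ladder (hn.mono (by omega) V G ∅ B hG (Set.ncard_empty _)
      ⟨hB, hd, fun _ => Set.disjoint_empty _, fun _ z hz => hz.elim, hl⟩)
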